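/- **Setting.** Let $J$ be an index set (finite, infinite or empty), $t_n\in\mathbb R$ and $b_n\in(1,\infty]$ for $n\in J$, and suppose that for some $\varepsilon>0$ one has $t_n\ge\varepsilon$ for all $n$ and $|t_n-t_m|\ge\varepsilon$ for all $n\ne m$. Put $\beta_n=\frac{\sqrt{b_n}+1}{\sqrt{b_n}-1}$ (with $\beta_n=1$ if $b_n=\infty$) and $\mu=\sum_{n\in J}\beta_n\delta_{t_n}$. Let $A^+=A^+_\mu$ be the operator in $L^2(0,\infty)$ acting as $f\mapsto -f''$ on the functions $f\in H^2((0,\infty)\setminus\{t_n\}_{n\in J})$ with $f(0)=0$ and, for every $n\in J$, $$f(t_n+)=\sqrt{b_n}\,f(t_n-),\qquad f'(t_n+)=\tfrac1{\sqrt{b_n}}f'(t_n-),\tag{1}$$ where for $b_n=\infty$ condition (1) means $f(t_n-)=0$ and $f'(t_n+)=0$. Let $A_0^+=-d^2/dt^2$ be the Dirichlet Laplacian in $L^2(0,\infty)$ (the case $\mu=0$), let $\mathfrak H=\ell^2(J,\mathbb C^2)$, and let $\gamma:\operatorname{dom}A_0^+\to\mathfrak H$ be the trace operator $(\gamma f)_n=(f(t_n),f'(t_n))^T$.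 For $z\in\mathbb C\setminus[0,\infty)$ let $k$ be the square root of $z$ with $\operatorname{Im}k>0$. Let $T(z)$ be the operator in $\mathfrak H$ with the $2\times2$ blocks $$T(z)_{nm}=\begin{pmatrix}\frac1{2ik}\big(e^{ik|t_n-t_m|}-e^{ik(t_n+t_m)}\big)&\frac12\big(\sigma_{mn}e^{ik|t_n-t_m|}-e^{ik(t_n+t_m)}\big)\\[2pt]\frac12\big(\sigma_{nm}e^{ik|t_n-t_m|}-e^{ik(t_n+t_m)}\big)&-\frac{ik}2\big(e^{ik|t_n-t_m|}+e^{ik(t_n+t_m)}\big)\end{pmatrix},$$ where $\sigma_{mn}=\operatorname{sgn}(t_m-t_n)$ and $\operatorname{sgn}0=0$, and let $B$ be the (possibly unbounded) multiplication operator in $\mathfrak H$, on its maximal domain, with blocks $B_{nm}=\delta_{nm}\frac{\beta_n}2\begin{pmatrix}0&1\\1&0\end{pmatrix}$. **Resolvent formula.** Let $z\in\mathbb C\setminus[0,\infty)$. Then $\gamma$ is defined on all of $\operatorname{dom}A_0^+$, $T(z)$ is defined on all of $\mathfrak H$, the operators $A_0^+-z$, $A_0^+-\overline z$, $A^+-z$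 and $T(z)+B$ (on $\operatorname{dom}B$) are bijections of their domains onto the whole space with bounded inverses, $\gamma(A_0^+-z)^{-1}$ and $\gamma(A_0^+-\overline z)^{-1}$ are bounded, and $$(A^+-z)^{-1}=(A_0^+-z)^{-1}+\big(\gamma(A_0^+-\overline z)^{-1}\big)^*\,(T(z)+B)^{-1}\,\gamma(A_0^+-z)^{-1}.$$ **The m-function.** Moreover, with $z=k^2$ as above, there is a nontrivial solution $f_+$ of $-f_+''=zf_+$ on $\mathbb R\setminus\{t_n\}_{n\in J}$ that satisfies (1) for all $n\in J$ and is square integrable at $+\infty$. Every such solution has $f_+(0)\neq0$, the quotient $m_+(z;0)=f_+'(0)/f_+(0)$ does not depend on its choice, and $$m_+(k^2;0)=ik+\sum_{n,m\in J}e^{ik(t_n+t_m)}\begin{pmatrix}1\\ ik\end{pmatrix}^T(T(k^2)+B)^{-1}_{n,m}\begin{pmatrix}1\\ ik\end{pmatrix}$$ as an unconditionally convergent series, where $(T(k^2)+B)^{-1}_{n,m}$ is the $(n,m)$-entry, a $2\times2$ matrix, of $(T(k^2)+B)^{-1}$. -/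

import Mathlib

open MeasureTheory Filter Topology Set
open scoped ENNReal

namespace PointInteraction

/-- The Hilbert space `L²(0, ∞)`. -/
abbrev L2HalfLine : Type := Lp ℂ 2 ((volume : Measure ℝ).restrict (Ioi 0))

/-- The Hilbert space `ℓ²(J, ℂ²)`. -/
abbrev TraceSpace (J : Type*) : Type _ := lp (fun _ : J => EuclideanSpace ℂ (Fin 2)) 2

/-- The mass `(√b + 1) / (√b - 1)` of an atom with parameter `b ∈ (1, ∞]`; it is `1` for
`b = ∞`. -/
noncomputable def massOf (b : ℝ≥0∞) : ℝ :=
  if b = ⊤ then 1 else (√b.toReal + 1) / (√b.toReal - 1)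

/-- The data of an atomic measure `∑ n, massOf (b n) • δ_(t n)` on the half-line: uniformly
separated points at a positive distance from `0`, with parameters `b n ∈ (1, ∞]`.
The index set may be finite, infinite or empty. -/
structure AtomicMeasure (J : Type*) where
  t : J → ℝ
  b : J → ℝ≥0∞
  one_lt_b : ∀ n, 1 < b n
  separated : ∃ ε : ℝ, 0 < ε ∧ (∀ n, ε ≤ t n) ∧ ∀ n m, n ≠ m → ε ≤ |t n - t m|

/-- The zero measure. -/
def AtomicMeasure.empty : AtomicMeasure Empty where
  t := Empty.elim
  b := Empty.elim
  one_lt_b := fun n => n.elim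
  separated := ⟨1, one_pos, fun n => n.elim, fun n => n.elim⟩

/-- `u ∈ H²((0, ∞) \ S)` for a closed discrete set `S`, with `u' = v` and `u'' = w`, where `u` is
the continuously differentiable representative on `(0, ∞) \ S`: there `u` has derivative `v`,
`v` is locally absolutely continuous with derivative `w`, and `u, v, w` are in `L²(0, ∞)`. -/
structure IsH2 (S : Set ℝ) (u v w : ℝ → ℂ) : Prop where
  memLp_u : MemLp u 2 ((volume : Measure ℝ).restrict (Ioi 0))
  memLp_v : MemLp v 2 ((volume : Measure ℝ).restrict (Ioi 0))
  memLp_w : MemLp w 2 ((volume : Measure ℝ).restrict (Ioi 0))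
  hasDerivAt : ∀ x ∈ Ioi (0 : ℝ) \ S, HasDerivAt u (v x) x
  integral_eq : ∀ x y : ℝ, x ≤ y → Icc x y ⊆ Ioi (0 : ℝ) \ S → ∫ s in x..y, w s = v y - v x

/-- The conditions `u(s+) = √b u(s-)`, `v(s+) = v(s-) / √b`, all four one-sided limits existing;
for `b = ∞` the conditions `u(s-) = 0`, `v(s+) = 0`. -/
def JumpCondition (b : ℝ≥0∞) (s : ℝ) (u v : ℝ → ℂ) : Prop :=
  if b = ⊤ then Tendsto u (𝓝[<] s) (𝓝 0) ∧ Tendsto v (𝓝[>] s) (𝓝 0)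
  else ∃ a c : ℂ,
    Tendsto u (𝓝[<] s) (𝓝 a) ∧ Tendsto u (𝓝[>] s) (𝓝 ((√b.toReal : ℝ) * a)) ∧
    Tendsto v (𝓝[<] s) (𝓝 c) ∧ Tendsto v (𝓝[>] s) (𝓝 (((√b.toReal : ℝ) : ℂ)⁻¹ * c))

lemma tendsto_add_zero {l : Filter ℝ} {u v : ℝ → ℂ} (hu : Tendsto u l (𝓝 0))
    (hv : Tendsto v l (𝓝 0)) : Tendsto (u + v) l (𝓝 0) :=
  (add_zero (0 : ℂ)) ▸ hu.add hv

lemma tendsto_smul_zero {l : Filter ℝ} {u : ℝ → ℂ} (r : ℂ) (hu : Tendsto u l (𝓝 0)) :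
    Tendsto (r • u) l (𝓝 0) :=
  (smul_zero r : r • (0 : ℂ) = 0) ▸ hu.const_smul r

lemma JumpCondition.zero (b : ℝ≥0∞) (s : ℝ) : JumpCondition b s 0 0 := by
  have h : ∀ l : Filter ℝ, Tendsto (0 : ℝ → ℂ) l (𝓝 0) := fun l => tendsto_const_nhds
  unfold JumpCondition
  split_ifs
  · exact ⟨h _, h _⟩
  · exact ⟨0, 0, h _, by rw [mul_zero]; exact h _, h _, by rw [mul_zero]; exact h _⟩

lemma JumpCondition.add {b : ℝ≥0∞} {s : ℝ} {u v u' v' : ℝ → ℂ}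
    (h : JumpCondition b s u v) (h' : JumpCondition b s u' v') :
    JumpCondition b s (u + u') (v + v') := by
  unfold JumpCondition at *
  split_ifs at * with hb
  · exact ⟨tendsto_add_zero h.1 h'.1, tendsto_add_zero h.2 h'.2⟩
  · obtain ⟨a, c, h1, h2, h3, h4⟩ := h
    obtain ⟨a', c', h1', h2', h3', h4'⟩ := h'
    exact ⟨a + a', c + c', h1.add h1', by rw [mul_add]; exact h2.add h2', h3.add h3',
      by rw [mul_add]; exact h4.add h4'⟩

lemma JumpCondition.smul {b : ℝ≥0∞} {s : ℝ} {u v : ℝ → ℂ} (r : ℂ)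
    (h : JumpCondition b s u v) : JumpCondition b s (r • u) (r • v) := by
  unfold JumpCondition at *
  split_ifs at * with hb
  · exact ⟨tendsto_smul_zero r h.1, tendsto_smul_zero r h.2⟩
  · obtain ⟨a, c, h1, h2, h3, h4⟩ := h
    refine ⟨r • a, r • c, h1.const_smul r, ?_, h3.const_smul r, ?_⟩
    · rw [mul_smul_comm]; exact h2.const_smul r
    · rw [mul_smul_comm]; exact h4.const_smul r

lemma intervalIntegrable_of_memLp {w : ℝ → ℂ} {x y : ℝ} (hxy : x ≤ y)
    (hw : MemLp w 2 ((volume : Measure ℝ).restrict (Ioi 0))) (h : Icc x y ⊆ Ioi (0 : ℝ)) :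
    IntervalIntegrable w volume x y := by
  have h1 : MemLp w 2 (volume.restrict (Icc x y)) := hw.mono_measure (Measure.restrict_mono h le_rfl)
  have h2 : IntegrableOn w (Icc x y) := h1.integrable (by norm_num)
  exact (intervalIntegrable_iff_integrableOn_Icc_of_le hxy).2 h2

lemma IsH2.zero (S : Set ℝ) : IsH2 S 0 0 0 where
  memLp_u := MemLp.zero
  memLp_v := MemLp.zero
  memLp_w := MemLp.zero
  hasDerivAt := fun x _ => hasDerivAt_const x 0
  integral_eq := by simp

lemma IsH2.add {S : Set ℝ} {u v w u' v' w' : ℝ → ℂ} (h : IsH2 S u v w) (h' : IsH2 S u' v' w') :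
    IsH2 S (u + u') (v + v') (w + w') where
  memLp_u := h.memLp_u.add h'.memLp_u
  memLp_v := h.memLp_v.add h'.memLp_v
  memLp_w := h.memLp_w.add h'.memLp_w
  hasDerivAt := fun x hx => (h.hasDerivAt x hx).add (h'.hasDerivAt x hx)
  integral_eq := fun x y hxy hS => by
    have hS' : Icc x y ⊆ Ioi (0 : ℝ) := hS.trans sdiff_subset
    simp only [Pi.add_apply]
    rw [intervalIntegral.integral_add (intervalIntegrable_of_memLp hxy h.memLp_w hS')
      (intervalIntegrable_of_memLp hxy h'.memLp_w hS'), h.integral_eq x y hxy hS,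
      h'.integral_eq x y hxy hS]
    ring

lemma IsH2.smul {S : Set ℝ} {u v w : ℝ → ℂ} (r : ℂ) (h : IsH2 S u v w) :
    IsH2 S (r • u) (r • v) (r • w) where
  memLp_u := h.memLp_u.const_smul r
  memLp_v := h.memLp_v.const_smul r
  memLp_w := h.memLp_w.const_smul r
  hasDerivAt := fun x hx => (h.hasDerivAt x hx).const_smul r
  integral_eq := fun x y hxy hS => by
    simp only [Pi.smul_apply]
    rw [intervalIntegral.integral_smul, h.integral_eq x y hxy hS, smul_sub]

/-- If `u` vanishes almost everywhere, so does `u`, and `u'`, at every regular point. -/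
lemma IsH2.eq_zero {S : Set ℝ} (hS : IsClosed S) {u v w : ℝ → ℂ} (h : IsH2 S u v w)
    (hu : u =ᵐ[(volume : Measure ℝ).restrict (Ioi 0)] 0) :
    ∀ x ∈ Ioi (0 : ℝ) \ S, u x = 0 ∧ v x = 0 := by
  have hO : IsOpen (Ioi (0 : ℝ) \ S) := isOpen_Ioi.sdiff hS
  have hu0 : EqOn u 0 (Ioi (0 : ℝ) \ S) := by
    have hc : ContinuousOn u (Ioi (0 : ℝ) \ S) := fun x hx =>
      (h.hasDerivAt x hx).continuousAt.continuousWithinAt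
    exact Measure.eqOn_open_of_ae_eq (ae_restrict_of_ae_restrict_of_subset sdiff_subset hu) hO hc
      continuousOn_const
  intro x hx
  refine ⟨hu0 hx, ?_⟩
  have h1 : u =ᶠ[𝓝 x] fun _ => 0 := by
    filter_upwards [hO.mem_nhds hx] with y hy using hu0 hy
  exact ((h.hasDerivAt x hx).congr_of_eventuallyEq h1.symm).unique (hasDerivAt_const x 0)

/-- If `u` vanishes almost everywhere, so does `u''`. -/
lemma IsH2.ae_eq_zero {S : Set ℝ} (hS : IsClosed S) (hc : S.Countable) {u v w : ℝ → ℂ}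
    (h : IsH2 S u v w) (hu : u =ᵐ[(volume : Measure ℝ).restrict (Ioi 0)] 0) :
    w =ᵐ[(volume : Measure ℝ).restrict (Ioi 0)] 0 := by
  have hO : IsOpen (Ioi (0 : ℝ) \ S) := isOpen_Ioi.sdiff hS
  have hv := fun x hx => (h.eq_zero hS hu x hx).2
  have key : volume {x | x ∈ Ioi (0 : ℝ) \ S ∧ w x ≠ 0} = 0 := by
    refine measure_null_of_locally_null _ fun p hp => ?_
    obtain ⟨δ, hδ, hball⟩ := Metric.isOpen_iff.1 hO p hp.1
    have hsub : Icc (p - δ / 2) (p + δ / 2) ⊆ Ioi (0 : ℝ) \ S := fun y hy => hball (by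
      rw [Metric.mem_ball, Real.dist_eq, abs_lt]; constructor <;> linarith [hy.1, hy.2])
    have hle : p - δ / 2 ≤ p + δ / 2 := by linarith
    have hint := intervalIntegrable_of_memLp hle h.memLp_w (hsub.trans sdiff_subset)
    have hae := hint.ae_hasDerivAt_integral
    have hnull : volume {x | x ∈ Ioo (p - δ / 2) (p + δ / 2) ∧ w x ≠ 0} = 0 := by
      rw [measure_eq_zero_iff_ae_notMem]
      filter_upwards [hae] with x hx hmem
      obtain ⟨hxI, hwx⟩ := hmem
      have hd := hx (by rw [uIcc_of_le hle]; exact Ioo_subset_Icc_self hxI) (p - δ / 2)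
        left_mem_uIcc
      have hz : (fun y => ∫ s in (p - δ / 2)..y, w s) =ᶠ[𝓝 x] fun _ => 0 := by
        filter_upwards [isOpen_Ioo.mem_nhds hxI] with y hy
        have hy' : Icc (p - δ / 2) y ⊆ Ioi (0 : ℝ) \ S :=
          (Icc_subset_Icc_right hy.2.le).trans hsub
        rw [h.integral_eq _ _ hy.1.le hy', hv y (hy' ⟨hy.1.le, le_rfl⟩),
          hv _ (hy' ⟨le_rfl, hy.1.le⟩), sub_zero]
      exact hwx ((hd.congr_of_eventuallyEq hz.symm).unique (hasDerivAt_const x 0))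
    refine ⟨{x | x ∈ Ioo (p - δ / 2) (p + δ / 2) ∧ w x ≠ 0}, ?_, hnull⟩
    have hn : Ioo (p - δ / 2) (p + δ / 2) ∈ 𝓝 p :=
      isOpen_Ioo.mem_nhds ⟨by linarith, by linarith⟩
    filter_upwards [mem_nhdsWithin_of_mem_nhds hn, self_mem_nhdsWithin] with y hy hy'
    exact ⟨hy, hy'.2⟩
  have hS0 : volume S = 0 := hc.measure_zero _
  rw [EventuallyEq, ae_restrict_iff' measurableSet_Ioi]
  filter_upwards [measure_eq_zero_iff_ae_notMem.1 key, measure_eq_zero_iff_ae_notMem.1 hS0]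
    with x h1 h2 hx
  by_contra hne
  exact h1 ⟨⟨hx, h2⟩, hne⟩

lemma AtomicMeasure.isClosed_range {J : Type*} (μ : AtomicMeasure J) : IsClosed (range μ.t) := by
  obtain ⟨ε, hε, -, h⟩ := μ.separated
  refine Metric.isClosed_of_pairwise_le_dist hε ?_
  rintro _ ⟨n, rfl⟩ _ ⟨m, rfl⟩ hne
  exact h n m fun e => hne (by rw [e])

lemma AtomicMeasure.countable_range {J : Type*} (μ : AtomicMeasure J) :
    (range μ.t).Countable := by
  obtain ⟨ε, hε, -, h⟩ := μ.separated
  refine MapsTo.countable_of_injOn (f := fun x : ℝ => ⌊x / ε⌋) (mapsTo_univ _ _) ?_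
    countable_univ
  rintro _ ⟨n, rfl⟩ _ ⟨m, rfl⟩ he
  by_contra hne
  have h1 := h n m fun e => hne (by rw [e])
  have h2 := Int.abs_sub_lt_one_of_floor_eq_floor he
  rw [← sub_div, abs_div, abs_of_pos hε, div_lt_one hε] at h2
  exact absurd h1 h2.not_ge

/-- The graph of `A_μ⁺`: the pairs `(f, -f'')` where `f ∈ H²((0, ∞) \ {t_n})` satisfies `f(0) = 0`
and the jump conditions at all `t_n`. -/
def AtomicMeasure.laplacianGraph {J : Type*} (μ : AtomicMeasure J) :
    Submodule ℂ (L2HalfLine × L2HalfLine) where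
  carrier := {p | ∃ u v w : ℝ → ℂ, IsH2 (range μ.t) u v w ∧
    p.1 =ᵐ[(volume : Measure ℝ).restrict (Ioi 0)] u ∧
    p.2 =ᵐ[(volume : Measure ℝ).restrict (Ioi 0)] -w ∧
    Tendsto u (𝓝[>] 0) (𝓝 0) ∧ ∀ n, JumpCondition (μ.b n) (μ.t n) u v}
  zero_mem' := ⟨0, 0, 0, IsH2.zero _, Lp.coeFn_zero _ _ _, by
    simpa using Lp.coeFn_zero ℂ 2 ((volume : Measure ℝ).restrict (Ioi 0)),
    tendsto_const_nhds, fun n => JumpCondition.zero _ _⟩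
  add_mem' := by
    rintro p q ⟨u, v, w, h, h1, h2, h3, h4⟩ ⟨u', v', w', h', h1', h2', h3', h4'⟩
    refine ⟨u + u', v + v', w + w', h.add h', (Lp.coeFn_add _ _).trans (h1.add h1'), ?_,
      tendsto_add_zero h3 h3', fun n => (h4 n).add (h4' n)⟩
    rw [neg_add]
    exact (Lp.coeFn_add _ _).trans (h2.add h2')
  smul_mem' := by
    rintro r p ⟨u, v, w, h, h1, h2, h3, h4⟩
    refine ⟨r • u, r • v, r • w, h.smul r, (Lp.coeFn_smul _ _).trans (h1.const_smul r), ?_,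
      tendsto_smul_zero r h3, fun n => (h4 n).smul r⟩
    rw [← smul_neg]
    exact (Lp.coeFn_smul _ _).trans (h2.const_smul r)

/-- The half-line operator `A_μ⁺` in `L²(0, ∞)`. -/
noncomputable def AtomicMeasure.laplacian {J : Type*} (μ : AtomicMeasure J) :
    L2HalfLine →ₗ.[ℂ] L2HalfLine :=
  μ.laplacianGraph.toLinearPMap

lemma AtomicMeasure.graph_laplacian {J : Type*} (μ : AtomicMeasure J) :
    μ.laplacian.graph = μ.laplacianGraph := by
  refine Submodule.toLinearPMap_graph_eq _ ?_
  rintro ⟨f, g⟩ ⟨u, v, w, h, h1, h2, -, -⟩ hf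
  dsimp only at hf h1 h2 ⊢
  subst hf
  have hw := h.ae_eq_zero μ.isClosed_range μ.countable_range
    (h1.symm.trans (Lp.coeFn_zero _ _ _))
  refine Lp.eq_zero_iff_ae_eq_zero.2 (h2.trans ?_)
  simpa using hw.neg

/-- The Dirichlet Laplacian `A_0⁺ = -d²/dt²` in `L²(0, ∞)`, with domain
`{f ∈ H²(0, ∞) : f(0) = 0}`. -/
noncomputable def dirichletLaplacian : L2HalfLine →ₗ.[ℂ] L2HalfLine :=
  AtomicMeasure.empty.laplacian

/-- The graph of the trace operator: the pairs of `f ∈ dom A_0⁺` and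
`(f(t_n), f'(t_n))_n ∈ ℓ²(J, ℂ²)`. -/
def AtomicMeasure.traceGraph {J : Type*} (μ : AtomicMeasure J) :
    Submodule ℂ (L2HalfLine × TraceSpace J) where
  carrier := {p | ∃ u v w : ℝ → ℂ, IsH2 ∅ u v w ∧
    p.1 =ᵐ[(volume : Measure ℝ).restrict (Ioi 0)] u ∧ Tendsto u (𝓝[>] 0) (𝓝 0) ∧
    ∀ n, p.2 n = !₂[u (μ.t n), v (μ.t n)]}
  zero_mem' := ⟨0, 0, 0, IsH2.zero _, Lp.coeFn_zero _ _ _, tendsto_const_nhds, fun n => by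
    ext i; fin_cases i <;> simp⟩
  add_mem' := by
    rintro p q ⟨u, v, w, h, h1, h2, h3⟩ ⟨u', v', w', h', h1', h2', h3'⟩
    refine ⟨u + u', v + v', w + w', h.add h', (Lp.coeFn_add _ _).trans (h1.add h1'),
      tendsto_add_zero h2 h2', fun n => ?_⟩
    ext i
    fin_cases i <;> simp [h3, h3']
  smul_mem' := by
    rintro r p ⟨u, v, w, h, h1, h2, h3⟩
    refine ⟨r • u, r • v, r • w, h.smul r, (Lp.coeFn_smul _ _).trans (h1.const_smul r),
      tendsto_smul_zero r h2, fun n => ?_⟩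
    ext i
    fin_cases i <;> simp [h3]

/-- The trace operator `γ f = (f(t_n), f'(t_n))_n` from `L²(0, ∞)` to `ℓ²(J, ℂ²)`, defined for the
`f ∈ dom A_0⁺` whose trace is square summable. -/
noncomputable def AtomicMeasure.trace {J : Type*} (μ : AtomicMeasure J) :
    L2HalfLine →ₗ.[ℂ] TraceSpace J :=
  μ.traceGraph.toLinearPMap

lemma AtomicMeasure.graph_trace {J : Type*} (μ : AtomicMeasure J) :
    μ.trace.graph = μ.traceGraph := by
  refine Submodule.toLinearPMap_graph_eq _ ?_
  rintro ⟨f, c⟩ ⟨u, v, w, h, h1, -, h3⟩ hf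
  dsimp only at hf h1 h3 ⊢
  subst hf
  have h0 := h.eq_zero isClosed_empty (h1.symm.trans (Lp.coeFn_zero _ _ _))
  obtain ⟨ε, hε, hpos, -⟩ := μ.separated
  ext n i
  have := h0 (μ.t n) ⟨lt_of_lt_of_le hε (hpos n), notMem_empty _⟩
  rw [h3 n]
  fin_cases i <;> simp [this.1, this.2]

/-- The graph of the operator in `ℓ²(J, ℂ²)` with the matrix `M` of `2 × 2` blocks. -/
def blockGraph {J : Type*} (M : J → J → Matrix (Fin 2) (Fin 2) ℂ) :
    Submodule ℂ (TraceSpace J × TraceSpace J) where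
  carrier := {p | ∀ n, HasSum (fun m => Matrix.toEuclideanLin (M n m) (p.1 m)) (p.2 n)}
  zero_mem' := fun n => by simp
  add_mem' := fun {p q} hp hq n => by simpa using (hp n).add (hq n)
  smul_mem' := fun r p hp n => by simpa using (hp n).const_smul r

/-- The operator `(M x)_n = ∑ m, M_{nm} x_m` in `ℓ²(J, ℂ²)` with its maximal domain: all `x` for
which these series converge and define an element of `ℓ²(J, ℂ²)`. -/
noncomputable def blockOperator {J : Type*} (M : J → J → Matrix (Fin 2) (Fin 2) ℂ) :
    TraceSpace J →ₗ.[ℂ] TraceSpace J :=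
  (blockGraph M).toLinearPMap

lemma graph_blockOperator {J : Type*} (M : J → J → Matrix (Fin 2) (Fin 2) ℂ) :
    (blockOperator M).graph = blockGraph M := by
  refine Submodule.toLinearPMap_graph_eq _ ?_
  rintro ⟨x, y⟩ h hx
  dsimp only at hx ⊢
  subst hx
  ext n : 2
  refine (h n).unique ?_
  simp

/-- The square root `k` of `z` with `Im k > 0`, for `z ∉ [0, ∞)`. -/
noncomputable def momentum (z : ℂ) : ℂ := Complex.I * (-z) ^ (1 / 2 : ℂ)

lemma momentum_sq (z : ℂ) : momentum z ^ 2 = z := by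
  have h : ((-z) ^ (1 / 2 : ℂ)) ^ 2 = -z := by
    rw [one_div]; exact_mod_cast Complex.cpow_nat_inv_pow (-z) two_ne_zero
  rw [momentum, mul_pow, h, Complex.I_sq]; ring

lemma momentum_im_pos {z : ℂ} (hz : ¬ (0 ≤ z.re ∧ z.im = 0)) : 0 < (momentum z).im := by
  have hs : -z ∈ Complex.slitPlane := by
    rw [Complex.mem_slitPlane_iff]
    by_contra! h
    simp only [Complex.neg_re, Complex.neg_im, neg_eq_zero] at h
    exact hz ⟨by linarith [h.1], h.2⟩
  obtain ⟨ha, h0⟩ := Complex.mem_slitPlane_iff_arg.1 hs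
  have h1 : (momentum z).im = ((-z) ^ (1 / 2 : ℂ)).re := by simp [momentum]
  have h2 : (Complex.log (-z) * (1 / 2 : ℂ)).im = Complex.arg (-z) / 2 := by
    rw [show (1 / 2 : ℂ) = ((1 / 2 : ℝ) : ℂ) by norm_num, Complex.im_mul_ofReal, Complex.log_im]
    ring
  rw [h1, Complex.cpow_def_of_ne_zero h0, Complex.exp_re, h2]
  refine mul_pos (Real.exp_pos _) (Real.cos_pos_of_mem_Ioo ⟨?_, ?_⟩)
  · linarith [Complex.neg_pi_lt_arg (-z)]
  · linarith [lt_of_le_of_ne (Complex.arg_le_pi (-z)) ha]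

/-- `momentum z` is the only square root of `z` in the upper half-plane. -/
lemma eq_momentum {z k : ℂ} (hk : 0 < k.im) (hkz : k ^ 2 = z) : k = momentum z := by
  rcases sq_eq_sq_iff_eq_or_eq_neg.1 (hkz.trans (momentum_sq z).symm) with h | h
  · exact h
  · have hz : ¬ (0 ≤ z.re ∧ z.im = 0) := by
      rintro ⟨h1, h2⟩
      rw [← hkz, pow_two] at h1 h2
      simp only [Complex.mul_re, Complex.mul_im] at h1 h2
      have h3 : k.re = 0 := by
        rcases mul_eq_zero.1 (show k.re * k.im = 0 by linarith) with h | h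
        · exact h
        · exact absurd h hk.ne'
      rw [h3] at h1
      nlinarith
    have := momentum_im_pos hz
    rw [h, Complex.neg_im] at hk
    linarith

/-- The matrix `T(z)`. -/
noncomputable def AtomicMeasure.tMatrix {J : Type*} (μ : AtomicMeasure J) (z : ℂ) (n m : J) :
    Matrix (Fin 2) (Fin 2) ℂ :=
  let k := momentum z
  let d := Complex.exp (Complex.I * k * (|μ.t n - μ.t m| : ℝ))
  let s := Complex.exp (Complex.I * k * (μ.t n + μ.t m : ℝ))
  let σ : ℂ := (SignType.sign (μ.t n - μ.t m) : ℝ)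
  !![1 / (2 * Complex.I * k) * (d - s), 1 / 2 * (-σ * d - s);
     1 / 2 * (σ * d - s), -(Complex.I * k / 2) * (d + s)]

open Classical in
/-- The matrix `B`, which is block diagonal. -/
noncomputable def AtomicMeasure.bMatrix {J : Type*} (μ : AtomicMeasure J) (n m : J) :
    Matrix (Fin 2) (Fin 2) ℂ :=
  if n = m then (1 / 2 * massOf (μ.b n) : ℂ) • !![0, 1; 1, 0] else 0

/-- The operator `T(z)` in `ℓ²(J, ℂ²)`. -/
noncomputable def AtomicMeasure.T {J : Type*} (μ : AtomicMeasure J) (z : ℂ) :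
    TraceSpace J →ₗ.[ℂ] TraceSpace J :=
  blockOperator (μ.tMatrix z)

/-- The (possibly unbounded) multiplication operator `B` in `ℓ²(J, ℂ²)`. -/
noncomputable def AtomicMeasure.B {J : Type*} (μ : AtomicMeasure J) :
    TraceSpace J →ₗ.[ℂ] TraceSpace J :=
  blockOperator μ.bMatrix

/-- The operator `A - z`, with the domain of `A`. -/
noncomputable def shift {E : Type*} [AddCommGroup E] [Module ℂ E] (A : E →ₗ.[ℂ] E) (z : ℂ) :
    E →ₗ.[ℂ] E where
  domain := A.domain
  toFun := A.toFun - z • A.domain.subtype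

/-- `R = A⁻¹`: the unbounded operator `A` is a bijection of its domain onto the whole space, and
its inverse is the bounded operator `R`. -/
def IsBoundedInverse {E F : Type*} [NormedAddCommGroup E] [NormedSpace ℂ E]
    [NormedAddCommGroup F] [NormedSpace ℂ F] (A : E →ₗ.[ℂ] F) (R : F →L[ℂ] E) : Prop :=
  (∀ f : A.domain, R (A f) = f) ∧ ∀ g : F, ∃ f : A.domain, A f = g ∧ R g = f

/-- `C = S R` for bounded `R`, an unbounded operator `S` and bounded `C`; in particular `R` maps
into the domain of `S`. -/
def IsComp {E F G : Type*} [NormedAddCommGroup E] [NormedSpace ℂ E]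
    [NormedAddCommGroup F] [NormedSpace ℂ F] [NormedAddCommGroup G] [NormedSpace ℂ G]
    (S : F →ₗ.[ℂ] G) (R : E →L[ℂ] F) (C : E →L[ℂ] G) : Prop :=
  ∀ g : E, ∃ f : S.domain, (f : F) = R g ∧ S f = C g

open Classical in
/-- The `(n, m)`-entry, a `2 × 2` matrix, of a bounded operator in `ℓ²(J, ℂ²)`. -/
noncomputable def blockEntry {J : Type*} (K : TraceSpace J →L[ℂ] TraceSpace J) (n m : J) :
    Matrix (Fin 2) (Fin 2) ℂ :=
  Matrix.of fun i j =>
    (K (lp.single (E := fun _ : J => EuclideanSpace ℂ (Fin 2)) 2 m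
      (EuclideanSpace.single j 1)) : J → EuclideanSpace ℂ (Fin 2)) n i

/-- A nontrivial solution `f`, with derivative `f'`, of `-f'' = z f` on `ℝ \ {t_n}` that satisfies
the jump conditions at all `t_n` and is square integrable at `+∞`. -/
structure AtomicMeasure.IsWeylSolution {J : Type*} (μ : AtomicMeasure J) (z : ℂ)
    (f f' : ℝ → ℂ) : Prop where
  hasDerivAt : ∀ x ∉ range μ.t, HasDerivAt f (f' x) x
  hasDerivAt' : ∀ x ∉ range μ.t, HasDerivAt f' (-z * f x) x
  jump : ∀ n, JumpCondition (μ.b n) (μ.t n) f f'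
  memLp : MemLp f 2 ((volume : Measure ℝ).restrict (Ioi 0))
  nontrivial : ∃ x ∉ range μ.t, f x ≠ 0

/-- `m = m_+(z; s)`: Weyl solutions `f` exist, and `f'(s) / f(s) = m` for each of them. -/
def AtomicMeasure.IsMPlus {J : Type*} (μ : AtomicMeasure J) (z : ℂ) (s : ℝ) (m : ℂ) : Prop :=
  (∃ f f', μ.IsWeylSolution z f f') ∧
    ∀ f f', μ.IsWeylSolution z f f' → f s ≠ 0 ∧ f' s / f s = m

end PointInteraction

open PointInteraction

/-! At each t_n describe a piecewise H² function by its jumps [u], [u'] and its averages {u}, {u'}.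
Condition (1) becomes {u} = (β_n/2)[u] and {u'} = -(β_n/2)[u'], including b_n = ∞, where β_n = 1
(`jumpCondition_iff`).

For x in ℓ²(J, ℂ²) let u solve -u'' = k²u off the points, with u(0) = 0, [u'] = -x₀, [u] = x₁, and
let a be its averages (`exists_jumpSolution`). Pairing u by Green's formula with the solutions
having one unit jump, which are read off from Green's function, gives T(z)x = -a
(`JumpSolution.hasSum_tMatrix`). Hence, for φ smooth across the points, φ + u satisfies (1) exactly
when (T(z) + B)x is the trace of φ (`JumpSolution.mem_graph_T_add_B_iff`). With φ the Dirichlet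
resolvent applied to g, and u recognized through Green's formula as the adjoint of the conjugate
trace map applied to x (`JumpSolution.adjoint_ae_eq`), this is the resolvent formula
(`isBoundedInverse_krein`).

Invertibility rests on coercivity: after multiplication by the conjugate of k, the form ∫|u'|² -
k²|u|² has an imaginary part of definite sign, so the H¹ energy is bounded by the boundary terms Σ[ū
u']. Condition (1) makes these vanish, which bounds A⁺ - z below. For (T(z) + B)x = y the masses β_n
cancel and the boundary terms are at most ‖x‖‖y‖, while trace estimates bound ‖x‖² by the energy; so
T(z) + B is bounded below however large the β_n are (`norm_le_of_mem_graph_T_add_B`). As its matrix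
is symmetric without conjugation, a vector orthogonal to its range is the conjugate of a kernel
vector, so the range is dense; the graph is closed, so the range is everything.

For the m-function take φ = e^{iks}. The Weyl solution is φ + u with (T(z) + B)x = ξ, ξ the trace of
φ, and the Wronskian of u and φ gives u'(0) = Σ ξ_n·x_n. Substituting x = (T(z) + B)⁻¹ξ and
expanding gives the double series, absolutely convergent because ξ is in ℓ¹. -/

namespace PointInteraction

local notation "ν₊" => Measure.restrict (volume : Measure ℝ) (Ioi (0 : ℝ))

/-! ### Absolutely continuous functions -/

/-- Real and imaginary parts are integrated separately and recombined. Absolute continuity is wanted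
because it makes a function with a.e. vanishing derivative constant. -/
lemma exists_absolutelyContinuous_primitive {f : ℝ → ℂ} {a b : ℝ}
    (h : IntervalIntegrable f volume a b) :
    ∃ Φ : ℝ → ℂ, AbsolutelyContinuousOnInterval Φ a b ∧
      (∀ x ∈ uIcc a b, Φ x = ∫ s in a..x, f s) ∧
      ∀ᵐ x, x ∈ uIcc a b → HasDerivAt Φ (f x) x := by
  have hc : ∀ c : ℂ, AbsolutelyContinuousOnInterval (fun _ : ℝ => c) a b := fun c =>
    (LipschitzWith.const c).lipschitzOnWith.absolutelyContinuousOnInterval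
  have hre : IntervalIntegrable (fun s => (f s).re) volume a b := ⟨h.1.re, h.2.re⟩
  have him : IntervalIntegrable (fun s => (f s).im) volume a b := ⟨h.1.im, h.2.im⟩
  refine ⟨fun x => (∫ s in a..x, (f s).re) • (1 : ℂ) + (∫ s in a..x, (f s).im) • Complex.I,
    ((hre.absolutelyContinuousOnInterval_intervalIntegral left_mem_uIcc).smul (hc 1)).add
      ((him.absolutelyContinuousOnInterval_intervalIntegral left_mem_uIcc).smul
        (hc Complex.I)), ?_, ?_⟩
  · intro x hx
    have hfx : IntervalIntegrable f volume a x :=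
      h.mono_set (uIcc_subset_uIcc left_mem_uIcc hx)
    simp only [Complex.real_smul, mul_one]
    rw [← Complex.re_add_im (∫ s in a..x, f s)]
    have h1 := intervalIntegral.intervalIntegral_re hfx
    have h2 := intervalIntegral.intervalIntegral_im hfx
    simp only [RCLike.re_to_complex, RCLike.im_to_complex] at h1 h2
    rw [h1, h2]
  · filter_upwards [hre.ae_hasDerivAt_integral, him.ae_hasDerivAt_integral] with x h1 h2 hx
    have := ((h1 hx a left_mem_uIcc).smul_const (1 : ℂ)).add
      ((h2 hx a left_mem_uIcc).smul_const Complex.I)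
    convert! this using 1
    simp

/-- The product rule for primitives of locally integrable functions. -/
lemma integral_deriv_mul_eq_sub {F G f g : ℝ → ℂ} {a b : ℝ} (hab : a ≤ b)
    (hf : IntervalIntegrable f volume a b) (hg : IntervalIntegrable g volume a b)
    (hF : ∀ x ∈ Icc a b, ∫ s in a..x, f s = F x - F a)
    (hG : ∀ x ∈ Icc a b, ∫ s in a..x, g s = G x - G a) :
    IntervalIntegrable (fun s => f s * G s + F s * g s) volume a b ∧
    ∫ s in a..b, (f s * G s + F s * g s) = F b * G b - F a * G a := by
  have hu : uIcc a b = Icc a b := uIcc_of_le hab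
  have hc : ∀ c : ℂ, AbsolutelyContinuousOnInterval (fun _ : ℝ => c) a b := fun c =>
    (LipschitzWith.const c).lipschitzOnWith.absolutelyContinuousOnInterval
  obtain ⟨Φ, hΦ, hΦ', hΦd⟩ := exists_absolutelyContinuous_primitive hf
  obtain ⟨Ψ, hΨ, hΨ', hΨd⟩ := exists_absolutelyContinuous_primitive hg
  have hFe : ∀ x ∈ uIcc a b, F x = F a + Φ x := fun x hx => by
    rw [hΦ' x hx, hF x (hu ▸ hx)]; ring
  have hGe : ∀ x ∈ uIcc a b, G x = G a + Ψ x := fun x hx => by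
    rw [hΨ' x hx, hG x (hu ▸ hx)]; ring
  have hFac := (hc (F a)).add hΦ
  have hGac := (hc (G a)).add hΨ
  have hFc : ContinuousOn F (uIcc a b) := hFac.continuousOn.congr fun x hx => hFe x hx
  have hGc : ContinuousOn G (uIcc a b) := hGac.continuousOn.congr fun x hx => hGe x hx
  have hint : IntervalIntegrable (fun s => f s * G s + F s * g s) volume a b :=
    (hf.mul_continuousOn hGc).add (hg.continuousOn_mul hFc)
  refine ⟨hint, ?_⟩
  obtain ⟨X, hX, hX', hXd⟩ := exists_absolutelyContinuous_primitive hint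
  -- The product minus the primitive of its formal derivative is absolutely continuous with
  -- derivative zero a.e.
  obtain ⟨C, hC⟩ := ((hFac.smul hGac).sub hX).const_of_ae_hasDerivAt_zero (by
    filter_upwards [hΦd, hΨd, hXd] with x h1 h2 h3 hx
    have := (((h1 hx).const_add (F a)).mul ((h2 hx).const_add (G a))).sub (h3 hx)
    convert! this using 1
    rw [hFe x hx, hGe x hx]; ring)
  have hC' : ∀ x ∈ uIcc a b, F x * G x - X x = C := fun x hx => by
    rw [hFe x hx, hGe x hx]; exact hC x hx
  have e1 := hC' a left_mem_uIcc
  have e2 := hC' b right_mem_uIcc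
  rw [hX' a left_mem_uIcc, intervalIntegral.integral_same] at e1
  rw [hX' b right_mem_uIcc] at e2
  linear_combination e1 - e2

/-! ### Schur's test -/

/-- Split K = K^{1/2} · K^{1/2}, apply Cauchy–Schwarz in b for fixed a, then exchange the integrals
by Tonelli. -/
lemma lintegral_sq_lintegral_mul_le {α β : Type*} [MeasurableSpace α] [MeasurableSpace β]
    {μ : Measure α} {ν : Measure β} [SFinite μ] [SFinite ν] {K : α → β → ℝ≥0∞}
    {h : β → ℝ≥0∞} (hK : Measurable (Function.uncurry K)) (hh : Measurable h) {C D : ℝ≥0∞}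
    (hC : ∀ a, ∫⁻ b, K a b ∂ν ≤ C) (hD : ∀ b, ∫⁻ a, K a b ∂μ ≤ D) :
    ∫⁻ a, (∫⁻ b, K a b * h b ∂ν) ^ 2 ∂μ ≤ C * D * ∫⁻ b, h b ^ 2 ∂ν := by
  have h2 : ∀ x : ℝ≥0∞, x ^ (1 / 2 : ℝ) * x ^ (1 / 2 : ℝ) = x := fun x => by
    rw [← ENNReal.rpow_add_of_nonneg _ _ (by norm_num) (by norm_num)]; norm_num
  have hKa : ∀ a, Measurable (K a) := fun a => hK.of_uncurry_left
  have h1 : ∀ a, (∫⁻ b, K a b * h b ∂ν) ^ 2 ≤ C * ∫⁻ b, K a b * h b ^ 2 ∂ν := by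
    intro a
    have := ENNReal.lintegral_mul_le_Lp_mul_Lq ν Real.HolderConjugate.two_two
      (f := fun b => K a b ^ (1 / 2 : ℝ)) (g := fun b => K a b ^ (1 / 2 : ℝ) * h b)
      ((hKa a).pow_const _).aemeasurable (((hKa a).pow_const _).mul hh).aemeasurable
    have e1 : ∀ b, ((fun b => K a b ^ (1 / 2 : ℝ)) * fun b => K a b ^ (1 / 2 : ℝ) * h b) b
        = K a b * h b := fun b => by
      simp only [Pi.mul_apply]; rw [← mul_assoc, h2]
    have e2 : ∀ b, (K a b ^ (1 / 2 : ℝ)) ^ (2 : ℝ) = K a b := fun b => by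
      rw [← ENNReal.rpow_mul]; norm_num
    have e3 : ∀ b, (K a b ^ (1 / 2 : ℝ) * h b) ^ (2 : ℝ) = K a b * h b ^ 2 := fun b => by
      rw [ENNReal.mul_rpow_of_nonneg _ _ (by norm_num), e2, ENNReal.rpow_two]
    simp only [e1, e2, e3] at this
    calc (∫⁻ b, K a b * h b ∂ν) ^ 2
        ≤ ((∫⁻ b, K a b ∂ν) ^ (1 / 2 : ℝ) * (∫⁻ b, K a b * h b ^ 2 ∂ν) ^ (1 / 2 : ℝ)) ^ 2 := by
          gcongr
      _ = (∫⁻ b, K a b ∂ν) * ∫⁻ b, K a b * h b ^ 2 ∂ν := by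
          rw [mul_pow, pow_two, pow_two, h2, h2]
      _ ≤ _ := by gcongr; exact hC a
  calc ∫⁻ a, (∫⁻ b, K a b * h b ∂ν) ^ 2 ∂μ ≤ ∫⁻ a, C * ∫⁻ b, K a b * h b ^ 2 ∂ν ∂μ :=
        lintegral_mono h1
    _ = C * ∫⁻ a, ∫⁻ b, K a b * h b ^ 2 ∂ν ∂μ := by
        refine lintegral_const_mul _ (Measurable.lintegral_prod_right' (f := fun p : α × β =>
          K p.1 p.2 * h p.2 ^ 2) (hK.mul ((hh.comp measurable_snd).pow_const 2)))
    _ = C * ∫⁻ b, ∫⁻ a, K a b * h b ^ 2 ∂μ ∂ν := by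
        rw [lintegral_lintegral_swap]
        exact (hK.mul ((hh.comp measurable_snd).pow_const 2)).aemeasurable
    _ ≤ C * ∫⁻ b, D * h b ^ 2 ∂ν := by
        gcongr with b
        rw [lintegral_mul_const _ (hK.of_uncurry_right)]
        gcongr
        exact hD b
    _ = _ := by rw [lintegral_const_mul _ (hh.pow_const 2), mul_assoc]

/-- Schur's test for the square integrability of a function dominated by an integral operator. -/
lemma memLp_two_of_norm_le_lintegral {α β : Type*} [MeasurableSpace α] [MeasurableSpace β]
    {μ : Measure α} {ν : Measure β} [SFinite μ] [SFinite ν] {K : α → β → ℝ≥0∞}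
    {h : β → ℂ} (hK : Measurable (Function.uncurry K)) (hh : MemLp h 2 ν) {C D : ℝ≥0∞}
    (hC : ∀ a, ∫⁻ b, K a b ∂ν ≤ C) (hD : ∀ b, ∫⁻ a, K a b ∂μ ≤ D) (hCt : C ≠ ⊤) (hDt : D ≠ ⊤)
    {F : α → ℂ} (hF : AEStronglyMeasurable F μ)
    (hle : ∀ᵐ a ∂μ, ‖F a‖ₑ ≤ ∫⁻ b, K a b * ‖h b‖ₑ ∂ν) : MemLp F 2 μ := by
  obtain ⟨h', hh', he⟩ := hh.1
  refine ⟨hF, ?_⟩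
  rw [eLpNorm_lt_top_iff_lintegral_rpow_enorm_lt_top (by norm_num) (by norm_num)]
  have hfin : ∫⁻ b, ‖h' b‖ₑ ^ 2 ∂ν < ⊤ := by
    have := (hh.ae_eq he).2
    rw [eLpNorm_lt_top_iff_lintegral_rpow_enorm_lt_top (by norm_num) (by norm_num)] at this
    simpa using this
  calc ∫⁻ a, ‖F a‖ₑ ^ (2 : ℝ≥0∞).toReal ∂μ ≤ ∫⁻ a, (∫⁻ b, K a b * ‖h' b‖ₑ ∂ν) ^ 2 ∂μ := by
        refine lintegral_mono_ae ?_
        filter_upwards [hle] with a ha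
        have e : ∫⁻ b, K a b * ‖h b‖ₑ ∂ν = ∫⁻ b, K a b * ‖h' b‖ₑ ∂ν :=
          lintegral_congr_ae (by filter_upwards [he] with b hb; rw [hb])
        rw [e] at ha
        simp only [ENNReal.toReal_ofNat, ENNReal.rpow_two]
        gcongr
    _ ≤ C * D * ∫⁻ b, ‖h' b‖ₑ ^ 2 ∂ν :=
        lintegral_sq_lintegral_mul_le hK hh'.measurable.enorm hC hD
    _ < ⊤ := ENNReal.mul_lt_top (ENNReal.mul_lt_top hCt.lt_top hDt.lt_top) hfin

/-! ### Bounded inverses -/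

/-- Used for the Dirichlet Laplacian and for T(z) + B; for A⁺ - z the inverse is supplied by the
resolvent formula itself. -/
lemma exists_isBoundedInverse {E F : Type*} [NormedAddCommGroup E] [NormedSpace ℂ E]
    [NormedAddCommGroup F] [NormedSpace ℂ F] (A : E →ₗ.[ℂ] F) (C : ℝ)
    (hb : ∀ f : A.domain, ‖(f : E)‖ ≤ C * ‖A f‖) (hs : ∀ g, ∃ f : A.domain, A f = g) :
    ∃ R : F →L[ℂ] E, IsBoundedInverse A R := by
  have hinj : ∀ f : A.domain, A f = 0 → f = 0 := fun f hf => by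
    have := hb f
    rw [hf, norm_zero, mul_zero] at this
    exact Subtype.ext (norm_le_zero_iff.1 this)
  have hbij : Function.Bijective A.toFun :=
    ⟨(injective_iff_map_eq_zero A.toFun).2 hinj, hs⟩
  let e := LinearEquiv.ofBijective A.toFun hbij
  have he : ∀ g, A (e.symm g) = g := fun g => e.apply_symm_apply g
  let R : F →L[ℂ] E := (A.domain.subtype ∘ₗ e.symm.toLinearMap).mkContinuous C fun g => by
    have := hb (e.symm g)
    rwa [he] at this
  have hR : ∀ g, R g = e.symm g := fun g => rfl
  refine ⟨R, fun f => ?_, fun g => ⟨e.symm g, he g, hR g⟩⟩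
  rw [hR]
  exact congrArg _ (e.symm_apply_apply f)

/-! ### Piecewise `H¹` functions -/

/-- `F ∈ H¹((0, ∞) \ S)` with derivative `f`, `F` being locally absolutely continuous. -/
structure IsH1 (S : Set ℝ) (F f : ℝ → ℂ) : Prop where
  memLp : MemLp F 2 ν₊
  memLp' : MemLp f 2 ν₊
  integral_eq : ∀ x y : ℝ, x ≤ y → Icc x y ⊆ Ioi (0 : ℝ) \ S → ∫ s in x..y, f s = F y - F x

/-- The squared `H¹` norm. -/
noncomputable def energy (F f : ℝ → ℂ) : ℝ := ∫ x, ‖F x‖ ^ 2 + ‖f x‖ ^ 2 ∂ν₊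

lemma IsH2.isH1 {S : Set ℝ} {u v w : ℝ → ℂ} (h : IsH2 S u v w) : IsH1 S u v where
  memLp := h.memLp_u
  memLp' := h.memLp_v
  integral_eq _ _ hxy hS := intervalIntegral.integral_eq_sub_of_hasDerivAt
    (fun s hs => h.hasDerivAt s (hS (uIcc_of_le hxy ▸ hs)))
    (intervalIntegrable_of_memLp hxy h.memLp_v (hS.trans sdiff_subset))

lemma IsH2.isH1' {S : Set ℝ} {u v w : ℝ → ℂ} (h : IsH2 S u v w) : IsH1 S v w where
  memLp := h.memLp_v
  memLp' := h.memLp_w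
  integral_eq := h.integral_eq

lemma IsH1.conj {S : Set ℝ} {F f : ℝ → ℂ} (h : IsH1 S F f) :
    IsH1 S (fun x => starRingEnd ℂ (F x)) (fun x => starRingEnd ℂ (f x)) where
  memLp := h.memLp.star
  memLp' := h.memLp'.star
  integral_eq x y hxy hI := by
    rw [← map_sub, ← h.integral_eq x y hxy hI]
    simp only [intervalIntegral.integral_of_le hxy, integral_conj]

lemma integrable_norm_sq {f : ℝ → ℂ} {ν : Measure ℝ} (h : MemLp f 2 ν) :
    Integrable (fun x => ‖f x‖ ^ 2) ν :=
  (memLp_two_iff_integrable_sq_norm h.1).1 h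

lemma IsH1.integrable_energy {S : Set ℝ} {F f : ℝ → ℂ} (h : IsH1 S F f) :
    Integrable (fun x => ‖F x‖ ^ 2 + ‖f x‖ ^ 2) ν₊ :=
  (integrable_norm_sq h.memLp).add (integrable_norm_sq h.memLp')

/-- Expanding ∫(δ‖f‖ - B)² ≥ 0, with δ the total mass and B = ∫‖f‖, gives δ(δ∫‖f‖² - B²) ≥ 0; the
case δ = 0 is separate. -/
lemma sq_integral_norm_le {f : ℝ → ℂ} {ν : Measure ℝ} [IsFiniteMeasure ν] (h : MemLp f 2 ν) :
    (∫ x, ‖f x‖ ∂ν) ^ 2 ≤ ν.real univ * ∫ x, ‖f x‖ ^ 2 ∂ν := by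
  have hi : Integrable (fun x => ‖f x‖) ν := (h.integrable (by norm_num)).norm
  have hi2 := integrable_norm_sq h
  set B := ∫ x, ‖f x‖ ∂ν
  set δ := ν.real univ
  have h0 : 0 ≤ ∫ x, (δ * ‖f x‖ - B) ^ 2 ∂ν := integral_nonneg fun x => sq_nonneg _
  have e : ∀ x, (δ * ‖f x‖ - B) ^ 2 = δ ^ 2 * ‖f x‖ ^ 2 - 2 * δ * B * ‖f x‖ + B ^ 2 := fun x => by
    ring
  simp_rw [e] at h0
  have hi3 : Integrable (fun x => δ ^ 2 * ‖f x‖ ^ 2 - 2 * δ * B * ‖f x‖) ν :=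
    (hi2.const_mul _).sub (hi.const_mul _)
  rw [integral_add hi3 (integrable_const _), integral_sub (hi2.const_mul _) (hi.const_mul _),
    integral_const_mul, integral_const_mul,
    integral_const, smul_eq_mul] at h0
  change 0 ≤ δ ^ 2 * _ - 2 * δ * B * B + δ * B ^ 2 at h0
  have hδ : 0 ≤ δ := measureReal_nonneg
  rcases hδ.eq_or_lt with hδ | hδ
  · have hν : ν = 0 := Measure.measure_univ_eq_zero.1
      ((measureReal_eq_zero_iff (measure_ne_top _ _)).1 hδ.symm)
    have : B = 0 := by simp [B, hν]
    rw [this, ← hδ]; simp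
  · have : 0 ≤ δ * (δ * (∫ x, ‖f x‖ ^ 2 ∂ν) - B ^ 2) := by linarith
    have := (mul_nonneg_iff_of_pos_left hδ).1 this
    linarith

/-! ### `H¹` functions on a single interval without points -/

section Interval

variable {S : Set ℝ} {F f : ℝ → ℂ} {a b : ℝ}

lemma memLp_Ioo (h : MemLp f 2 ν₊) (hI : Ioo a b ⊆ Ioi 0) :
    MemLp f 2 (volume.restrict (Ioo a b)) :=
  h.mono_measure (Measure.restrict_mono hI le_rfl)

/-- Cutting f off outside the interval gives it a continuous primitive on the whole line. The
one-sided limits at both endpoints are the values of this extension. -/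
lemma IsH1.exists_continuous (h : IsH1 S F f) (hab : a < b) (hI : Ioo a b ⊆ Ioi 0 \ S) :
    ∃ Φ : ℝ → ℂ, Continuous Φ ∧ EqOn F Φ (Ioo a b) := by
  have hm := memLp_Ioo h.memLp' (hI.trans sdiff_subset)
  have hi : Integrable ((Ioo a b).indicator f) :=
    (integrable_indicator_iff measurableSet_Ioo).2 (hm.integrable (by norm_num))
  set c := (a + b) / 2
  have hc : c ∈ Ioo a b := ⟨by simp only [c]; linarith, by simp only [c]; linarith⟩
  refine ⟨fun x => F c + ∫ s in c..x, (Ioo a b).indicator f s,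
    continuous_const.add
      (intervalIntegral.continuous_primitive (fun _ _ => hi.intervalIntegrable) c),
    fun x hx => ?_⟩
  have hsub : uIcc c x ⊆ Ioo a b := ordConnected_Ioo.uIcc_subset hc hx
  have e : ∫ s in c..x, (Ioo a b).indicator f s = ∫ s in c..x, f s :=
    intervalIntegral.integral_congr fun s hs => indicator_of_mem (hsub hs) _
  simp only
  rw [e]
  rcases le_total c x with hcx | hcx
  · rw [h.integral_eq c x hcx ((uIcc_of_le hcx ▸ hsub).trans hI)]; ring
  · rw [intervalIntegral.integral_symm,
      h.integral_eq x c hcx ((uIcc_of_ge hcx ▸ hsub).trans hI)]; ring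

lemma IsH1.continuousOn_Ioo (h : IsH1 S F f) (hab : a < b) (hI : Ioo a b ⊆ Ioi 0 \ S) :
    ContinuousOn F (Ioo a b) := by
  obtain ⟨Φ, hΦ, he⟩ := h.exists_continuous hab hI
  exact hΦ.continuousOn.congr he

lemma IsH1.exists_tendsto_right (h : IsH1 S F f) (hab : a < b) (hI : Ioo a b ⊆ Ioi 0 \ S) :
    ∃ l, Tendsto F (𝓝[>] a) (𝓝 l) := by
  obtain ⟨Φ, hΦ, he⟩ := h.exists_continuous hab hI
  refine ⟨Φ a, (hΦ.continuousWithinAt (s := Ioi a)).tendsto.congr' ?_⟩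
  filter_upwards [Ioo_mem_nhdsGT hab] with x hx using (he hx).symm

lemma IsH1.exists_tendsto_left (h : IsH1 S F f) (hab : a < b) (hI : Ioo a b ⊆ Ioi 0 \ S) :
    ∃ l, Tendsto F (𝓝[<] b) (𝓝 l) := by
  obtain ⟨Φ, hΦ, he⟩ := h.exists_continuous hab hI
  refine ⟨Φ b, (hΦ.continuousWithinAt (s := Iio b)).tendsto.congr' ?_⟩
  filter_upwards [Ioo_mem_nhdsLT hab] with x hx using (he hx).symm

/-- Square |F x| ≤ |F y| + ∫|f| and average over y. The term 2/(b - a) comes from the averaging, 2(b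
- a) from Cauchy–Schwarz for ∫|f|. -/
lemma IsH1.norm_sq_le (h : IsH1 S F f) (hI : Ioo a b ⊆ Ioi 0 \ S) {x : ℝ} (hx : x ∈ Ioo a b) :
    ‖F x‖ ^ 2 ≤ (2 / (b - a) + 2 * (b - a)) * ∫ s in Ioo a b, ‖F s‖ ^ 2 + ‖f s‖ ^ 2 := by
  have hab : a < b := hx.1.trans hx.2
  have hδ : 0 < b - a := by linarith
  have hmF := memLp_Ioo h.memLp (hI.trans sdiff_subset)
  have hmf := memLp_Ioo h.memLp' (hI.trans sdiff_subset)
  have hiF := integrable_norm_sq hmF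
  have hif := integrable_norm_sq hmf
  have hvol : (volume.restrict (Ioo a b)).real univ = b - a := by
    rw [measureReal_restrict_apply_univ, Real.volume_real_Ioo_of_le hab.le]
  have hB := sq_integral_norm_le hmf
  rw [hvol] at hB
  set B := ∫ s in Ioo a b, ‖f s‖
  have hpt : ∀ y ∈ Ioo a b, ‖F x‖ ^ 2 ≤ 2 * ‖F y‖ ^ 2 + 2 * B ^ 2 := by
    intro y hy
    have hsub : uIcc y x ⊆ Ioo a b := ordConnected_Ioo.uIcc_subset hy hx
    have e : ‖F x - F y‖ ≤ B := by
      have e1 : F x - F y = ∫ s in y..x, f s := by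
        rcases le_total y x with hyx | hyx
        · rw [h.integral_eq y x hyx ((uIcc_of_le hyx ▸ hsub).trans hI)]
        · rw [intervalIntegral.integral_symm,
            h.integral_eq x y hyx ((uIcc_of_ge hyx ▸ hsub).trans hI)]; ring
      rw [e1]
      refine intervalIntegral.norm_integral_le_integral_norm_uIoc.trans ?_
      exact setIntegral_mono_set (hmf.integrable (by norm_num)).norm
        (Eventually.of_forall fun _ => norm_nonneg _)
        (uIoc_subset_uIcc.trans hsub).eventuallyLE
    have e2 : ‖F x‖ ≤ ‖F y‖ + B := by
      calc ‖F x‖ = ‖F y + (F x - F y)‖ := by ring_nf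
        _ ≤ _ := (norm_add_le _ _).trans (by gcongr)
    nlinarith [norm_nonneg (F x), norm_nonneg (F y), sq_nonneg (‖F y‖ - B),
      (norm_nonneg (F x - F y)).trans e]
  have hav : ∫ y in Ioo a b, ‖F x‖ ^ 2 ≤ ∫ y in Ioo a b, (2 * ‖F y‖ ^ 2 + 2 * B ^ 2) :=
    setIntegral_mono_on (integrable_const _) ((hiF.const_mul 2).add (integrable_const _))
      measurableSet_Ioo hpt
  rw [integral_add (hiF.const_mul 2) (integrable_const _), integral_const, integral_const,
    integral_const_mul, hvol, smul_eq_mul, smul_eq_mul] at hav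
  rw [integral_add hiF hif]
  set P := ∫ s in Ioo a b, ‖F s‖ ^ 2
  set Q := ∫ s in Ioo a b, ‖f s‖ ^ 2
  have hP : 0 ≤ P := integral_nonneg fun _ => sq_nonneg _
  have hQ : 0 ≤ Q := integral_nonneg fun _ => sq_nonneg _
  have h1 : ‖F x‖ ^ 2 ≤ 2 / (b - a) * P + 2 * B ^ 2 := by
    rw [← mul_le_mul_iff_right₀ hδ]
    calc (b - a) * ‖F x‖ ^ 2 ≤ _ := hav
      _ = _ := by field_simp
  have h2 : 0 ≤ 2 / (b - a) * Q := by positivity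
  have h3 : 0 ≤ 2 * (b - a) * P := by positivity
  nlinarith

end Interval

/-! ### The points of an atomic measure -/

namespace AtomicMeasure

variable {J : Type*} (μ : AtomicMeasure J)

/-- A lower bound for the distances of the points from each other and from `0`. -/
noncomputable def gap : ℝ := μ.separated.choose

lemma gap_pos : 0 < μ.gap := μ.separated.choose_spec.1

lemma gap_le (n : J) : μ.gap ≤ μ.t n := μ.separated.choose_spec.2.1 n

lemma gap_le_abs_sub {n m : J} (h : n ≠ m) : μ.gap ≤ |μ.t n - μ.t m| :=
  μ.separated.choose_spec.2.2 n m h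

lemma t_pos (n : J) : 0 < μ.t n := μ.gap_pos.trans_le (μ.gap_le n)

/-- A half-open cell of length `gap` contains at most one point. Countability, local finiteness and
the summability of e^{-κ t_n} all follow from this labelling by integers. -/
lemma floor_injective : Function.Injective fun n => ⌊μ.t n / μ.gap⌋ := by
  intro n m he
  by_contra hne
  have h1 := μ.gap_le_abs_sub hne
  have h2 := Int.abs_sub_lt_one_of_floor_eq_floor he
  rw [← sub_div, abs_div, abs_of_pos μ.gap_pos, div_lt_one μ.gap_pos] at h2
  exact absurd h1 h2.not_ge

lemma injective_t : Function.Injective μ.t := fun n m h =>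
  μ.floor_injective (by simp only [h])

lemma countable {J : Type*} (μ : AtomicMeasure J) : Countable J :=
  Function.Injective.countable μ.floor_injective

lemma finite_t_lt (y : ℝ) : {n | μ.t n < y}.Finite := by
  refine Set.Finite.of_finite_image (f := fun n => ⌊μ.t n / μ.gap⌋) ?_ μ.floor_injective.injOn
  refine (Set.finite_Icc 0 ⌊y / μ.gap⌋).subset ?_
  rintro _ ⟨n, hn, rfl⟩
  exact ⟨Int.floor_nonneg.2 (div_nonneg (μ.t_pos n).le μ.gap_pos.le),
    Int.floor_le_floor (div_le_div_of_nonneg_right (le_of_lt hn) μ.gap_pos.le)⟩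

lemma volume_range : volume (range μ.t) = 0 := μ.countable_range.measure_zero _

lemma ae_notMem_range : ∀ᵐ x ∂ν₊, x ∉ range μ.t :=
  ae_restrict_of_ae (measure_eq_zero_iff_ae_notMem.1 μ.volume_range)

lemma ae_regular : ∀ᵐ x ∂ν₊, x ∈ Ioi 0 \ range μ.t := by
  filter_upwards [μ.ae_notMem_range, ae_restrict_mem measurableSet_Ioi] with x h1 h2
    using ⟨h2, h1⟩

lemma Ioo_right_subset (n : J) :
    Ioo (μ.t n) (μ.t n + μ.gap) ⊆ Ioi 0 \ range μ.t := by
  refine fun x hx => ⟨(μ.t_pos n).trans hx.1, ?_⟩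
  rintro ⟨m, rfl⟩
  have hne : m ≠ n := by rintro rfl; exact lt_irrefl _ hx.1
  have := μ.gap_le_abs_sub hne
  rw [abs_of_pos (sub_pos.2 hx.1)] at this
  linarith [hx.2]

lemma Ioo_left_subset (n : J) :
    Ioo (μ.t n - μ.gap) (μ.t n) ⊆ Ioi 0 \ range μ.t := by
  refine fun x hx => ⟨(sub_nonneg.2 (μ.gap_le n)).trans_lt hx.1, ?_⟩
  rintro ⟨m, rfl⟩
  have hne : m ≠ n := by rintro rfl; exact lt_irrefl _ hx.2
  have := μ.gap_le_abs_sub hne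
  rw [abs_of_neg (sub_neg.2 hx.2)] at this
  linarith [hx.1]

lemma Ioo_zero_subset : Ioo 0 μ.gap ⊆ Ioi 0 \ range μ.t := by
  refine fun x hx => ⟨hx.1, ?_⟩
  rintro ⟨m, rfl⟩
  exact absurd (μ.gap_le m) hx.2.not_ge

/-- The shift c = 0 gives the right neighbourhoods of the points, c = `gap` the left ones. -/
lemma pairwise_disjoint_Ioo (c : ℝ) :
    Pairwise (Function.onFun Disjoint fun n => Ioo (μ.t n - c) (μ.t n - c + μ.gap)) := by
  intro n m hne
  rw [Function.onFun, Set.disjoint_left]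
  intro x hx hx'
  have := μ.gap_le_abs_sub hne
  have h2 : |μ.t n - μ.t m| < μ.gap := by
    rw [abs_lt]; constructor <;> linarith [hx.1, hx.2, hx'.1, hx'.2]
  linarith

/-- The constant in the trace estimates. -/
noncomputable def traceConst : ℝ := 2 / μ.gap + 2 * μ.gap

lemma traceConst_pos : 0 < μ.traceConst := by
  have := μ.gap_pos
  unfold traceConst
  positivity

end AtomicMeasure

/-! ### Square summability of one-sided limits, and the fundamental theorem of calculus with jumps
-/

section Traces

variable {J : Type*} {μ : AtomicMeasure J} {F f G g : ℝ → ℂ}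

/-- Each limit is bounded by the energy on its own interval with a constant independent of n, and
the intervals are disjoint, so the local energies add up to at most the total one. -/
lemma IsH1.sum_norm_sq_le_aux (h : IsH1 (range μ.t) F f) (c : ℝ) {l : J → ℂ}
    (hI : ∀ n, Ioo (μ.t n - c) (μ.t n - c + μ.gap) ⊆ Ioi 0 \ range μ.t)
    {N : J → Filter ℝ} [∀ n, (N n).NeBot] (hl : ∀ n, Tendsto F (N n) (𝓝 (l n)))
    (hN : ∀ n, ∀ᶠ x in N n, x ∈ Ioo (μ.t n - c) (μ.t n - c + μ.gap)) (s : Finset J) :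
    ∑ n ∈ s, ‖l n‖ ^ 2 ≤ μ.traceConst * energy F f := by
  have hi := h.integrable_energy
  have h1 : ∀ n, ‖l n‖ ^ 2 ≤ μ.traceConst *
      ∫ x in Ioo (μ.t n - c) (μ.t n - c + μ.gap), ‖F x‖ ^ 2 + ‖f x‖ ^ 2 := by
    intro n
    refine le_of_tendsto ((hl n).norm.pow 2) ?_
    filter_upwards [hN n] with x hx
    have := h.norm_sq_le (hI n) hx
    rwa [add_sub_cancel_left] at this
  calc ∑ n ∈ s, ‖l n‖ ^ 2 ≤ ∑ n ∈ s, μ.traceConst *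
        ∫ x in Ioo (μ.t n - c) (μ.t n - c + μ.gap), ‖F x‖ ^ 2 + ‖f x‖ ^ 2 :=
        Finset.sum_le_sum fun n _ => h1 n
    _ = μ.traceConst * ∫ x in ⋃ n ∈ s, Ioo (μ.t n - c) (μ.t n - c + μ.gap),
          ‖F x‖ ^ 2 + ‖f x‖ ^ 2 := by
        rw [← Finset.mul_sum, integral_biUnion_finset _ (fun _ _ => measurableSet_Ioo)]
        · exact fun i _ j _ hij => μ.pairwise_disjoint_Ioo c hij
        · exact fun n _ => IntegrableOn.mono_set hi ((hI n).trans sdiff_subset)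
    _ ≤ μ.traceConst * energy F f := by
        refine mul_le_mul_of_nonneg_left ?_ μ.traceConst_pos.le
        refine setIntegral_mono_set hi (Eventually.of_forall fun x => ?_)
          (Set.iUnion₂_subset fun n _ => (hI n).trans sdiff_subset).eventuallyLE
        simp only [Pi.zero_apply]; positivity

lemma IsH1.sum_norm_sq_right_le (h : IsH1 (range μ.t) F f) {l : J → ℂ}
    (hl : ∀ n, Tendsto F (𝓝[>] μ.t n) (𝓝 (l n))) (s : Finset J) :
    ∑ n ∈ s, ‖l n‖ ^ 2 ≤ μ.traceConst * energy F f :=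
  h.sum_norm_sq_le_aux 0 (by simpa using μ.Ioo_right_subset) hl
    (fun n => by
      have := μ.gap_pos
      filter_upwards [Ioo_mem_nhdsGT (show μ.t n < μ.t n + μ.gap by linarith)] with x hx
      simpa using hx) s

lemma IsH1.sum_norm_sq_left_le (h : IsH1 (range μ.t) F f) {l : J → ℂ}
    (hl : ∀ n, Tendsto F (𝓝[<] μ.t n) (𝓝 (l n))) (s : Finset J) :
    ∑ n ∈ s, ‖l n‖ ^ 2 ≤ μ.traceConst * energy F f :=
  h.sum_norm_sq_le_aux μ.gap (by simpa using μ.Ioo_left_subset) hl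
    (fun n => by
      have := μ.gap_pos
      filter_upwards [Ioo_mem_nhdsLT (show μ.t n - μ.gap < μ.t n by linarith)] with x hx
      simpa using hx) s

lemma IsH1.exists_traces (h : IsH1 (range μ.t) F f) :
    ∃ FL FR : J → ℂ, (∀ n, Tendsto F (𝓝[<] μ.t n) (𝓝 (FL n))) ∧
      ∀ n, Tendsto F (𝓝[>] μ.t n) (𝓝 (FR n)) := by
  have h1 := fun n => h.exists_tendsto_left (by linarith [μ.gap_pos]) (μ.Ioo_left_subset n)
  have h2 := fun n => h.exists_tendsto_right (by linarith [μ.gap_pos]) (μ.Ioo_right_subset n)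
  choose FL hFL using h1
  choose FR hFR using h2
  exact ⟨FL, FR, hFL, hFR⟩

lemma IsH1.exists_tendsto_zero (h : IsH1 (range μ.t) F f) : ∃ l, Tendsto F (𝓝[>] 0) (𝓝 l) :=
  h.exists_tendsto_right μ.gap_pos μ.Ioo_zero_subset

/-- The fundamental theorem of calculus for a piecewise absolutely continuous function. -/
lemma sub_eq_integral_add_sum_jumps (hf : IntegrableOn f (Ioi 0))
    (hF : ∀ x y, x ≤ y → Icc x y ⊆ Ioi 0 \ range μ.t → ∫ s in x..y, f s = F y - F x)
    {FL FR : J → ℂ} (hL : ∀ n, Tendsto F (𝓝[<] μ.t n) (𝓝 (FL n)))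
    (hR : ∀ n, Tendsto F (𝓝[>] μ.t n) (𝓝 (FR n))) (N : Finset J) :
    ∀ x y, x ≤ y → x ∈ Ioi 0 \ range μ.t → y ∈ Ioi 0 \ range μ.t →
      (∀ n, n ∈ N ↔ μ.t n ∈ Ioo x y) →
      F y - F x = (∫ s in x..y, f s) + ∑ n ∈ N, (FR n - FL n) := by
  classical
  have hii : ∀ x y, 0 < x → 0 < y → IntervalIntegrable f volume x y := fun x y hx hy =>
    intervalIntegrable_iff.2 (hf.mono_set fun s hs => lt_trans (lt_min hx hy) hs.1)
  -- One point t_n of N is isolated in a short interval [a, b]; the points left of a and right of b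
  -- form smaller sets, to which the induction hypothesis applies. On [a, t_n) and (t_n, b] the
  -- formula is jump-free and passes to the one-sided limit.
  induction N using Finset.strongInduction with
  | H N ih =>
  intro x y hxy hx hy hN
  have hx0 : 0 < x := hx.1
  rcases N.eq_empty_or_nonempty with rfl | ⟨n, hn⟩
  · rw [Finset.sum_empty, add_zero, hF x y hxy]
    refine fun s hs => ⟨hx0.trans_le hs.1, ?_⟩
    rintro ⟨m, rfl⟩
    have hm1 : x < μ.t m := lt_of_le_of_ne hs.1 fun e => hx.2 ⟨m, e.symm⟩
    have hm2 : μ.t m < y := lt_of_le_of_ne hs.2 fun e => hy.2 ⟨m, e⟩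
    exact absurd ((hN m).2 ⟨hm1, hm2⟩) (Finset.notMem_empty m)
  · obtain ⟨hxn, hny⟩ := (hN n).1 hn
    have hg := μ.gap_pos
    obtain ⟨a, ha1, ha2⟩ : ∃ a, max x (μ.t n - μ.gap) < a ∧ a < μ.t n :=
      exists_between (max_lt hxn (by linarith))
    obtain ⟨b, hb1, hb2⟩ : ∃ b, μ.t n < b ∧ b < min y (μ.t n + μ.gap) :=
      exists_between (lt_min hny (by linarith))
    obtain ⟨hxa, hga⟩ := max_lt_iff.1 ha1
    obtain ⟨hby, hbg⟩ := lt_min_iff.1 hb2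
    have haI := μ.Ioo_left_subset n ⟨hga, ha2⟩
    have hbI := μ.Ioo_right_subset n ⟨hb1, hbg⟩
    have ha0 : 0 < a := haI.1
    have hb0 : 0 < b := hbI.1
    have hcase : ∀ m, m ≠ n → μ.t m < a ∨ b < μ.t m := by
      intro m hm
      by_contra! hc
      rcases lt_trichotomy (μ.t m) (μ.t n) with h | h | h
      · exact (μ.Ioo_left_subset n ⟨hga.trans_le hc.1, h⟩).2 ⟨m, rfl⟩
      · exact hm (μ.injective_t h)
      · exact (μ.Ioo_right_subset n ⟨h, hc.2.trans_lt hbg⟩).2 ⟨m, rfl⟩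
    set N1 := N.filter fun m => μ.t m < a
    set N2 := N.filter fun m => b < μ.t m
    have hn1 : n ∉ N1 := fun h => by linarith [(Finset.mem_filter.1 h).2]
    have hn2 : n ∉ N2 := fun h => by linarith [(Finset.mem_filter.1 h).2]
    have e1 := ih N1 (Finset.ssubset_iff_subset_ne.2 ⟨Finset.filter_subset _ _,
      fun e => hn1 (e ▸ hn)⟩) x a hxa.le hx haI fun m => by
        simp only [N1, Finset.mem_filter, hN, mem_Ioo]
        exact ⟨fun h => ⟨h.1.1, h.2⟩, fun h => ⟨⟨h.1, by linarith [h.2]⟩, h.2⟩⟩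
    have e2 := ih N2 (Finset.ssubset_iff_subset_ne.2 ⟨Finset.filter_subset _ _,
      fun e => hn2 (e ▸ hn)⟩) b y hby.le hbI hy fun m => by
        simp only [N2, Finset.mem_filter, hN, mem_Ioo]
        exact ⟨fun h => ⟨h.2, h.1.2⟩, fun h => ⟨⟨by linarith [h.1], h.2⟩, h.1⟩⟩
    have e3 : FL n - F a = ∫ s in a..μ.t n, f s := by
      have hc : Tendsto (fun c => ∫ s in a..c, f s) (𝓝[<] μ.t n)
          (𝓝 (∫ s in a..μ.t n, f s)) := by
        have hci : IntegrableOn f (uIcc a (μ.t n)) := hf.mono_set fun s hs =>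
          lt_of_lt_of_le ha0 (uIcc_of_le ha2.le ▸ hs).1
        have := (intervalIntegral.continuousOn_primitive_interval hci) (μ.t n) right_mem_uIcc
        rw [uIcc_of_le ha2.le] at this
        exact (this.mono_left (nhdsWithin_le_of_mem (mem_of_superset (Ioo_mem_nhdsLT ha2)
          Ioo_subset_Icc_self)))
      refine tendsto_nhds_unique ((hL n).sub_const (F a)) (hc.congr' ?_)
      filter_upwards [Ioo_mem_nhdsLT ha2] with c hc
      exact hF a c hc.1.le fun s hs => μ.Ioo_left_subset n
        ⟨hga.trans_le hs.1, hs.2.trans_lt hc.2⟩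
    have e4 : F b - FR n = ∫ s in μ.t n..b, f s := by
      have hc : Tendsto (fun c => ∫ s in c..b, f s) (𝓝[>] μ.t n)
          (𝓝 (∫ s in μ.t n..b, f s)) := by
        have hci : IntegrableOn f (uIcc (μ.t n) b) := hf.mono_set fun s hs =>
          lt_of_lt_of_le (μ.t_pos n) (uIcc_of_le hb1.le ▸ hs).1
        have := (intervalIntegral.continuousOn_primitive_interval_left hci) (μ.t n) left_mem_uIcc
        rw [uIcc_of_le hb1.le] at this
        exact (this.mono_left (nhdsWithin_le_of_mem (mem_of_superset (Ioo_mem_nhdsGT hb1)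
          Ioo_subset_Icc_self)))
      refine tendsto_nhds_unique ((hR n).const_sub (F b)) (hc.congr' ?_)
      filter_upwards [Ioo_mem_nhdsGT hb1] with c hc
      exact hF c b hc.2.le fun s hs => μ.Ioo_right_subset n
        ⟨hc.1.trans_le hs.1, hs.2.trans_lt hbg⟩
    have hsum : ∑ m ∈ N, (FR m - FL m) = (FR n - FL n) + ∑ m ∈ N1, (FR m - FL m) +
        ∑ m ∈ N2, (FR m - FL m) := by
      have hNe : N = insert n (N1 ∪ N2) := by
        ext m
        simp only [N1, N2, Finset.mem_insert, Finset.mem_union, Finset.mem_filter]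
        constructor
        · intro hm
          by_cases hmn : m = n
          · exact Or.inl hmn
          · exact Or.inr ((hcase m hmn).imp (fun h => ⟨hm, h⟩) fun h => ⟨hm, h⟩)
        · rintro (rfl | h | h)
          exacts [hn, h.1, h.1]
      have hd : Disjoint N1 N2 := Finset.disjoint_left.2 fun m h1 h2 => by
        have := (Finset.mem_filter.1 h1).2
        have := (Finset.mem_filter.1 h2).2
        linarith
      rw [hNe, Finset.sum_insert (by simp [hn1, hn2]), Finset.sum_union hd]
      ring
    have ei1 := intervalIntegral.integral_add_adjacent_intervals (hii x a hx0 ha0)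
      (hii a (μ.t n) ha0 (μ.t_pos n))
    have ei2 := intervalIntegral.integral_add_adjacent_intervals (hii x (μ.t n) hx0 (μ.t_pos n))
      (hii (μ.t n) b (μ.t_pos n) hb0)
    have ei3 := intervalIntegral.integral_add_adjacent_intervals (hii x b hx0 hb0)
      (hii b y hb0 hy.1)
    linear_combination e1 + e2 + e3 + e4 - hsum + ei1 + ei2 + ei3

end Traces

/-! ### Integration by parts on the whole half-line -/

section Green

variable {J : Type*} {μ : AtomicMeasure J} {F f G g : ℝ → ℂ}

lemma IsH1.summable_norm_sq_right (h : IsH1 (range μ.t) F f) {l : J → ℂ}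
    (hl : ∀ n, Tendsto F (𝓝[>] μ.t n) (𝓝 (l n))) : Summable fun n => ‖l n‖ ^ 2 :=
  summable_of_sum_le (fun _ => sq_nonneg _) (h.sum_norm_sq_right_le hl)

lemma IsH1.summable_norm_sq_left (h : IsH1 (range μ.t) F f) {l : J → ℂ}
    (hl : ∀ n, Tendsto F (𝓝[<] μ.t n) (𝓝 (l n))) : Summable fun n => ‖l n‖ ^ 2 :=
  summable_of_sum_le (fun _ => sq_nonneg _) (h.sum_norm_sq_left_le hl)

lemma summable_mul_of_summable_norm_sq {ι : Type*} {a b : ι → ℂ}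
    (ha : Summable fun n => ‖a n‖ ^ 2) (hb : Summable fun n => ‖b n‖ ^ 2) :
    Summable fun n => a n * b n := by
  refine Summable.of_norm_bounded (ha.add hb) fun n => ?_
  rw [norm_mul]
  nlinarith [sq_nonneg (‖a n‖ - ‖b n‖), sq_nonneg (‖a n‖), sq_nonneg (‖b n‖)]

/-- If a piecewise absolutely continuous function and its derivative are integrable, then the
jumps, the integral of the derivative and the value at `0` add up to zero. -/
lemma add_integral_add_tsum_jumps_eq_zero (hFi : IntegrableOn F (Ioi 0))
    (hf : IntegrableOn f (Ioi 0))
    (hF : ∀ x y, x ≤ y → Icc x y ⊆ Ioi 0 \ range μ.t → ∫ s in x..y, f s = F y - F x)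
    {FL FR : J → ℂ} {F0 : ℂ} (hL : ∀ n, Tendsto F (𝓝[<] μ.t n) (𝓝 (FL n)))
    (hR : ∀ n, Tendsto F (𝓝[>] μ.t n) (𝓝 (FR n))) (h0 : Tendsto F (𝓝[>] 0) (𝓝 F0))
    (hs : Summable fun n => FR n - FL n) :
    F0 + (∫ s in Ioi 0, f s) + ∑' n, (FR n - FL n) = 0 := by
  classical
  have hg := μ.gap_pos
  -- The starting point x of the finite formula tends to 0; it is kept below `gap`, so no point lies
  -- to its left.
  have hreg : ∀ y ∈ Ioi 0 \ range μ.t, F y = F0 + (∫ s in 0..y, f s) +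
      ∑' n, (if μ.t n < y then FR n - FL n else 0) := by
    intro y hy
    have hy0 : 0 < y := hy.1
    set N := (μ.finite_t_lt y).toFinset with hN
    have hts : ∑' n, (if μ.t n < y then FR n - FL n else 0) = ∑ n ∈ N, (FR n - FL n) := by
      rw [tsum_eq_sum (s := N)]
      · exact Finset.sum_congr rfl fun n hn => if_pos (by simpa [N] using hn)
      · exact fun n hn => if_neg (by simpa [N] using hn)
    rw [hts]
    have hx : ∀ x ∈ Ioo 0 (min μ.gap y), F y - F x = (∫ s in x..y, f s) +
        ∑ n ∈ N, (FR n - FL n) := by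
      intro x hx
      obtain ⟨hx1, hx2⟩ := lt_min_iff.1 hx.2
      refine sub_eq_integral_add_sum_jumps hf hF hL hR N x y hx2.le
        (μ.Ioo_zero_subset ⟨hx.1, hx1⟩) hy fun n => ?_
      simp only [N, Set.Finite.mem_toFinset, mem_ofPred_eq, mem_Ioo]
      exact ⟨fun h => ⟨hx1.trans_le (μ.gap_le n), h⟩, fun h => h.2⟩
    have hc : Tendsto (fun x => ∫ s in x..y, f s) (𝓝[>] 0) (𝓝 (∫ s in 0..y, f s)) := by
      have hci : IntegrableOn f (uIcc 0 y) := by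
        rw [uIcc_of_le hy0.le, integrableOn_Icc_iff_integrableOn_Ioc]
        exact hf.mono_set fun s hs => hs.1
      have := (intervalIntegral.continuousOn_primitive_interval_left hci) 0 left_mem_uIcc
      rw [uIcc_of_le hy0.le] at this
      exact (this.mono_left (nhdsWithin_le_of_mem (mem_of_superset (Ioo_mem_nhdsGT hy0)
        Ioo_subset_Icc_self)))
    have := tendsto_nhds_unique (h0.const_sub (F y)) ((hc.add_const _).congr' (by
      filter_upwards [Ioo_mem_nhdsGT (lt_min hg hy0)] with x hx' using (hx x hx').symm))
    linear_combination this
  set Φ : ℝ → ℂ := fun y => F0 + (∫ s in 0..y, f s) +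
      ∑' n, (if μ.t n < y then FR n - FL n else 0) with hΦ
  set L := F0 + (∫ s in Ioi 0, f s) + ∑' n, (FR n - FL n)
  have hlim : Tendsto Φ atTop (𝓝 L) := by
    refine (tendsto_const_nhds.add (intervalIntegral_tendsto_integral_Ioi 0 hf tendsto_id)).add ?_
    refine tendsto_tsum_of_dominated_convergence hs.norm (fun n => ?_)
      (Eventually.of_forall fun y n => ?_)
    · refine tendsto_const_nhds.congr' ?_
      filter_upwards [eventually_gt_atTop (μ.t n)] with y hy using (if_pos hy).symm
    · split_ifs
      · exact le_rfl
      · simp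
  -- F agrees off the points with Φ, which has the limit L at infinity. If L ≠ 0, then |F| ≥ ‖L‖/2
  -- a.e. on some half-line, contradicting integrability.
  by_contra hne
  have hLpos : 0 < ‖L‖ := norm_pos_iff.2 hne
  have hev : ∀ᶠ y in atTop, ‖L‖ / 2 < ‖Φ y‖ :=
    hlim.norm.eventually (lt_mem_nhds (by linarith))
  obtain ⟨R, hRR⟩ := eventually_atTop.1 hev
  set R' := max R 0
  have hsub : Ioi R' ⊆ Ioi 0 := fun y hy => (le_max_right R 0).trans_lt hy
  have hint : IntegrableOn (fun _ => ‖L‖ / 2) (Ioi R') := by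
    refine Integrable.mono' (hFi.mono_set hsub).norm aestronglyMeasurable_const ?_
    filter_upwards [ae_restrict_of_ae_restrict_of_subset hsub μ.ae_regular,
      ae_restrict_mem measurableSet_Ioi] with y h1 h2
    rw [hreg y h1, Real.norm_of_nonneg (by linarith)]
    exact (hRR y ((le_max_left R 0).trans (le_of_lt h2))).le
  rw [integrableOn_const_iff] at hint
  rcases hint with h | h
  · rw [enorm_eq_zero] at h; linarith
  · simp at h

lemma IsH1.integrable_mul (hF : IsH1 (range μ.t) F f) (hG : IsH1 (range μ.t) G g) :
    IntegrableOn (fun s => f s * G s + F s * g s) (Ioi 0) :=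
  (hF.memLp'.integrable_mul hG.memLp).add (hF.memLp.integrable_mul hG.memLp')

/-- Integration by parts for piecewise `H¹` functions. -/
lemma IsH1.hasSum_jumps (hF : IsH1 (range μ.t) F f) (hG : IsH1 (range μ.t) G g)
    {FL FR Gl Gr : J → ℂ} {F0 G0 : ℂ} (hFL : ∀ n, Tendsto F (𝓝[<] μ.t n) (𝓝 (FL n)))
    (hFR : ∀ n, Tendsto F (𝓝[>] μ.t n) (𝓝 (FR n))) (hF0 : Tendsto F (𝓝[>] 0) (𝓝 F0))
    (hGl : ∀ n, Tendsto G (𝓝[<] μ.t n) (𝓝 (Gl n)))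
    (hGr : ∀ n, Tendsto G (𝓝[>] μ.t n) (𝓝 (Gr n))) (hG0 : Tendsto G (𝓝[>] 0) (𝓝 G0)) :
    HasSum (fun n => FR n * Gr n - FL n * Gl n)
      (-(F0 * G0) - ∫ s in Ioi 0, (f s * G s + F s * g s)) := by
  have hs : Summable fun n => FR n * Gr n - FL n * Gl n :=
    (summable_mul_of_summable_norm_sq (hF.summable_norm_sq_right hFR)
      (hG.summable_norm_sq_right hGr)).sub
    (summable_mul_of_summable_norm_sq (hF.summable_norm_sq_left hFL)
      (hG.summable_norm_sq_left hGl))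
  have key := add_integral_add_tsum_jumps_eq_zero (μ := μ) (F := fun s => F s * G s)
    (hF.memLp.integrable_mul hG.memLp) (hF.integrable_mul hG) (fun x y hxy hI => by
      have hI' : ∀ z ∈ Icc x y, Icc x z ⊆ Ioi 0 \ range μ.t := fun z hz =>
        (Icc_subset_Icc_right hz.2).trans hI
      exact (integral_deriv_mul_eq_sub hxy
        (intervalIntegrable_of_memLp hxy hF.memLp' (hI.trans sdiff_subset))
        (intervalIntegrable_of_memLp hxy hG.memLp' (hI.trans sdiff_subset))
        (fun z hz => hF.integral_eq x z hz.1 (hI' z hz))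
        (fun z hz => hG.integral_eq x z hz.1 (hI' z hz))).2)
    (fun n => (hFL n).mul (hGl n)) (fun n => (hFR n).mul (hGr n)) (hF0.mul hG0) hs
  have := hs.hasSum
  convert! this using 1
  linear_combination -key

end Green

/-! ### The quadratic form -/

/-- The coercivity constant of the quadratic form of `-d²/dt² - k²`. -/
noncomputable def formConst (k : ℂ) : ℝ := ‖k‖ / (k.im * min 1 (‖k‖ ^ 2))

lemma norm_pos_of_im_pos {k : ℂ} (hk : 0 < k.im) : 0 < ‖k‖ :=
  norm_pos_iff.2 fun h => by simp [h] at hk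

lemma formConst_pos {k : ℂ} (hk : 0 < k.im) : 0 < formConst k := by
  have := norm_pos_of_im_pos hk
  unfold formConst
  positivity

/-- Multiplication by the conjugate of k turns q - k²p into a number with imaginary part -Im k · (q
+ |k|²p), which has a sign. The factor min 1 |k|² compares q + |k|²p with p + q. -/
lemma add_le_formConst_mul {k : ℂ} (hk : 0 < k.im) {p q : ℝ} (hp : 0 ≤ p) (hq : 0 ≤ q) :
    p + q ≤ formConst k * ‖(q : ℂ) - k ^ 2 * p‖ := by
  have hn := norm_pos_of_im_pos hk
  have hm : 0 < min 1 (‖k‖ ^ 2) := by positivity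
  have h1 : (starRingEnd ℂ k * ((q : ℂ) - k ^ 2 * p)).im = -(k.im * (q + ‖k‖ ^ 2 * p)) := by
    rw [← Complex.normSq_eq_norm_sq, Complex.normSq_apply, pow_two]
    simp only [Complex.mul_im, Complex.mul_re, Complex.sub_im, Complex.sub_re, Complex.conj_re,
      Complex.conj_im, Complex.ofReal_re, Complex.ofReal_im]
    ring
  have h2 : k.im * (q + ‖k‖ ^ 2 * p) ≤ ‖k‖ * ‖(q : ℂ) - k ^ 2 * p‖ := by
    have := Complex.abs_im_le_norm (starRingEnd ℂ k * ((q : ℂ) - k ^ 2 * p))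
    rw [h1, abs_neg, norm_mul, RCLike.norm_conj] at this
    exact (le_abs_self _).trans this
  have h3 : min 1 (‖k‖ ^ 2) * (p + q) ≤ q + ‖k‖ ^ 2 * p := by
    have a1 := min_le_left 1 (‖k‖ ^ 2)
    have a2 := min_le_right 1 (‖k‖ ^ 2)
    nlinarith
  rw [formConst, div_mul_eq_mul_div, le_div_iff₀ (by positivity)]
  calc (p + q) * (k.im * min 1 (‖k‖ ^ 2)) = k.im * (min 1 (‖k‖ ^ 2) * (p + q)) := by ring
    _ ≤ k.im * (q + ‖k‖ ^ 2 * p) := by gcongr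
    _ ≤ _ := h2

lemma conj_mul_self_eq (c : ℂ) : starRingEnd ℂ c * c = ((‖c‖ ^ 2 : ℝ) : ℂ) := by
  rw [mul_comm, Complex.mul_conj, Complex.normSq_eq_norm_sq]

lemma energy_le_form {k : ℂ} (hk : 0 < k.im) {u v : ℝ → ℂ} (hu : MemLp u 2 ν₊)
    (hv : MemLp v 2 ν₊) :
    energy u v ≤ formConst k *
      ‖∫ s in Ioi 0, (starRingEnd ℂ (v s) * v s + starRingEnd ℂ (u s) * (-k ^ 2 * u s))‖ := by
  have hu2 := integrable_norm_sq hu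
  have hv2 := integrable_norm_sq hv
  have e : ∀ s, starRingEnd ℂ (v s) * v s + starRingEnd ℂ (u s) * (-k ^ 2 * u s) =
      ((‖v s‖ ^ 2 : ℝ) : ℂ) - k ^ 2 * ((‖u s‖ ^ 2 : ℝ) : ℂ) := fun s => by
    rw [← conj_mul_self_eq, ← conj_mul_self_eq]; ring
  simp_rw [e]
  rw [integral_sub hv2.ofReal (hu2.ofReal.const_mul _), integral_const_mul, integral_complex_ofReal,
    integral_complex_ofReal, energy, integral_add hu2 hv2]
  exact add_le_formConst_mul hk (integral_nonneg fun _ => sq_nonneg _)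
    (integral_nonneg fun _ => sq_nonneg _)

/-! ### Jump conditions in terms of jumps and averages -/

lemma one_lt_sqrt_toReal {b : ℝ≥0∞} (hb : 1 < b) (hb' : b ≠ ⊤) : 1 < √b.toReal := by
  rw [Real.lt_sqrt zero_le_one, one_pow]
  exact (ENNReal.ofReal_lt_iff_lt_toReal zero_le_one hb').1 (by simpa using hb)

/-- The mass is the ratio of sum and difference of the one-sided values (√b + 1 to √b - 1). For b =
∞ the ratio 1 encodes uL = 0 and vR = 0, so from here on infinite b needs no special treatment. -/
lemma jumpCondition_iff {b : ℝ≥0∞} (hb : 1 < b) {s : ℝ} {u v : ℝ → ℂ} {uL uR vL vR : ℂ}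
    (huL : Tendsto u (𝓝[<] s) (𝓝 uL)) (huR : Tendsto u (𝓝[>] s) (𝓝 uR))
    (hvL : Tendsto v (𝓝[<] s) (𝓝 vL)) (hvR : Tendsto v (𝓝[>] s) (𝓝 vR)) :
    JumpCondition b s u v ↔
      uL + uR = massOf b * (uR - uL) ∧ vL + vR = -(massOf b * (vR - vL)) := by
  unfold JumpCondition massOf
  split_ifs with h
  · have h1 : Tendsto u (𝓝[<] s) (𝓝 0) ↔ uL = 0 :=
      ⟨fun h => tendsto_nhds_unique huL h, fun h => h ▸ huL⟩
    have h2 : Tendsto v (𝓝[>] s) (𝓝 0) ↔ vR = 0 :=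
      ⟨fun h => tendsto_nhds_unique hvR h, fun h => h ▸ hvR⟩
    rw [h1, h2]
    push_cast
    constructor
    · rintro ⟨rfl, rfl⟩; constructor <;> ring
    · rintro ⟨e1, e2⟩
      exact ⟨by linear_combination e1 / 2, by linear_combination e2 / 2⟩
  · set r := √b.toReal
    have hr : 1 < r := one_lt_sqrt_toReal hb h
    have hr0 : (r : ℂ) ≠ 0 := by exact_mod_cast (by linarith : r ≠ 0)
    have hr1 : (r : ℂ) - 1 ≠ 0 := by
      exact_mod_cast (sub_ne_zero.2 hr.ne' : r - 1 ≠ 0)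
    push_cast
    constructor
    · rintro ⟨a, c, h1, h2, h3, h4⟩
      rw [tendsto_nhds_unique huL h1, tendsto_nhds_unique huR h2, tendsto_nhds_unique hvL h3,
        tendsto_nhds_unique hvR h4]
      constructor <;> (field_simp; ring)
    · rintro ⟨e1, e2⟩
      rw [div_mul_eq_mul_div, eq_div_iff hr1] at e1
      rw [div_mul_eq_mul_div, ← neg_div, eq_div_iff hr1] at e2
      have e3 : uR = r * uL := by linear_combination -e1 / 2
      have e4 : vR = (r : ℂ)⁻¹ * vL := by
        field_simp
        linear_combination e2 / 2
      exact ⟨uL, vL, huL, e3 ▸ huR, hvL, e4 ▸ hvR⟩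

/-! ### Lower bounds for `A_μ⁺ - z` -/

section Lower

variable {J : Type*} {μ : AtomicMeasure J}

lemma norm_toLp_sq {f : L2HalfLine} {u : ℝ → ℂ} (h : f =ᵐ[ν₊] u) :
    ‖f‖ ^ 2 = ∫ x, ‖u x‖ ^ 2 ∂ν₊ := by
  have h1 : ‖f‖ ^ 2 = RCLike.re (inner ℂ f f) := norm_sq_eq_re_inner (𝕜 := ℂ) f
  rw [h1, L2.inner_def]
  have h2 : ∫ a, inner ℂ (f a) (f a) ∂ν₊ = ∫ a, ((‖u a‖ ^ 2 : ℝ) : ℂ) ∂ν₊ := by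
    refine integral_congr_ae ?_
    filter_upwards [h] with a ha
    rw [ha, inner_self_eq_norm_sq_to_K]; norm_cast
  rw [h2, integral_complex_ofReal]
  simp

lemma inner_eq_integral {f g : L2HalfLine} {u w : ℝ → ℂ} (hf : f =ᵐ[ν₊] u) (hg : g =ᵐ[ν₊] w) :
    inner ℂ f g = ∫ x, starRingEnd ℂ (u x) * w x ∂ν₊ := by
  rw [L2.inner_def]
  refine integral_congr_ae ?_
  filter_upwards [hf, hg] with a h1 h2
  rw [h1, h2, RCLike.inner_apply, mul_comm]

lemma norm_sq_le_energy {f : L2HalfLine} {u v : ℝ → ℂ} (hf : f =ᵐ[ν₊] u) (hv : MemLp v 2 ν₊)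
    (hu : MemLp u 2 ν₊) : ‖f‖ ^ 2 ≤ energy u v := by
  rw [norm_toLp_sq hf, energy, integral_add (integrable_norm_sq hu) (integrable_norm_sq hv)]
  linarith [integral_nonneg (μ := ν₊) (f := fun x => ‖v x‖ ^ 2) fun _ => sq_nonneg _]

/-- `∫ (|u'|² + ū u'') + ∑ [ū u'] = 0` for a piecewise `H²` function vanishing at `0`. -/
lemma IsH2.hasSum_form {u v w : ℝ → ℂ} (h : IsH2 (range μ.t) u v w)
    (h0 : Tendsto u (𝓝[>] 0) (𝓝 0)) {uL uR vL vR : J → ℂ}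
    (huL : ∀ n, Tendsto u (𝓝[<] μ.t n) (𝓝 (uL n))) (huR : ∀ n, Tendsto u (𝓝[>] μ.t n) (𝓝 (uR n)))
    (hvL : ∀ n, Tendsto v (𝓝[<] μ.t n) (𝓝 (vL n)))
    (hvR : ∀ n, Tendsto v (𝓝[>] μ.t n) (𝓝 (vR n))) :
    HasSum (fun n => starRingEnd ℂ (uR n) * vR n - starRingEnd ℂ (uL n) * vL n)
      (-∫ s in Ioi 0, (starRingEnd ℂ (v s) * v s + starRingEnd ℂ (u s) * w s)) := by
  obtain ⟨v0, hv0⟩ := h.isH1'.exists_tendsto_zero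
  have hc : ∀ {l : Filter ℝ} {a : ℂ}, Tendsto u l (𝓝 a) →
      Tendsto (fun x => starRingEnd ℂ (u x)) l (𝓝 (starRingEnd ℂ a)) := fun ht =>
    (Complex.continuous_conj.tendsto _).comp ht
  have := h.isH1.conj.hasSum_jumps h.isH1' (fun n => hc (huL n)) (fun n => hc (huR n)) (hc h0)
    hvL hvR hv0
  simpa using this

lemma energy_le_of_mem_laplacianGraph {k : ℂ} (hk : 0 < k.im) {f g h : L2HalfLine}
    {u v w : ℝ → ℂ} (hH : IsH2 (range μ.t) u v w) (hf : f =ᵐ[ν₊] u) (hg : g =ᵐ[ν₊] -w)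
    (h0 : Tendsto u (𝓝[>] 0) (𝓝 0)) (hj : ∀ n, JumpCondition (μ.b n) (μ.t n) u v)
    (hh : h = g - k ^ 2 • f) :
    energy u v ≤ formConst k * (‖f‖ * ‖h‖) := by
  obtain ⟨uL, uR, huL, huR⟩ := hH.isH1.exists_traces
  obtain ⟨vL, vR, hvL, hvR⟩ := hH.isH1'.exists_traces
  have hsum := hH.hasSum_form h0 huL huR hvL hvR
  -- By the product rule for jumps, [ū v] = {ū}[v] + [ū]{v} = (β/2)[ū][v] - (β/2)[ū][v].
  have hz : ∀ n, starRingEnd ℂ (uR n) * vR n - starRingEnd ℂ (uL n) * vL n = 0 := by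
    intro n
    obtain ⟨e1, e2⟩ := (jumpCondition_iff (μ.one_lt_b n) (huL n) (huR n) (hvL n) (hvR n)).1 (hj n)
    have e3 := congrArg (starRingEnd ℂ) e1
    simp only [map_add, map_mul, map_sub, Complex.conj_ofReal] at e3
    linear_combination (vR n - vL n) / 2 * e3 +
      (starRingEnd ℂ (uR n) - starRingEnd ℂ (uL n)) / 2 * e2
  simp_rw [hz] at hsum
  have hI : ∫ s in Ioi 0, (starRingEnd ℂ (v s) * v s + starRingEnd ℂ (u s) * w s) = 0 := by
    have := hsum.unique hasSum_zero
    exact neg_eq_zero.1 this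
  refine (energy_le_form hk hH.memLp_u hH.memLp_v).trans ?_
  refine mul_le_mul_of_nonneg_left ?_ (formConst_pos hk).le
  have hh' : h =ᵐ[ν₊] fun s => -w s - k ^ 2 * u s := by
    rw [hh]
    filter_upwards [Lp.coeFn_sub g (k ^ 2 • f), Lp.coeFn_smul (k ^ 2) f, hf, hg]
      with s h1 h2 h3 h4
    rw [h1, Pi.sub_apply, h2, Pi.smul_apply, h3, h4, Pi.neg_apply, smul_eq_mul]
  have hin := inner_eq_integral hf hh'
  have e : ∫ s in Ioi 0, (starRingEnd ℂ (v s) * v s + starRingEnd ℂ (u s) * (-k ^ 2 * u s)) =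
      inner ℂ f h := by
    rw [hin, ← sub_zero (∫ s in Ioi 0, _), ← hI, ← integral_sub]
    · refine integral_congr_ae (Eventually.of_forall fun s => ?_)
      simp only
      ring
    · exact (hH.memLp_v.star.integrable_mul hH.memLp_v).add
        (hH.memLp_u.star.integrable_mul (hH.memLp_u.const_mul _))
    · exact (hH.memLp_v.star.integrable_mul hH.memLp_v).add
        (hH.memLp_u.star.integrable_mul hH.memLp_w)
  rw [e]
  exact norm_inner_le_norm f h

lemma mem_graph_shift {E : Type*} [AddCommGroup E] [Module ℂ E] {A : E →ₗ.[ℂ] E} {z : ℂ}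
    (f : (shift A z).domain) : ((f : E), shift A z f + z • (f : E)) ∈ A.graph := by
  have e : shift A z f = A f - z • (f : E) := rfl
  rw [e, sub_add_cancel]
  exact A.mem_graph f

lemma exists_shift_eq {E : Type*} [AddCommGroup E] [Module ℂ E] {A : E →ₗ.[ℂ] E} {z : ℂ}
    {f g : E} (h : (f, g + z • f) ∈ A.graph) :
    ∃ f' : (shift A z).domain, shift A z f' = g ∧ (f' : E) = f := by
  obtain ⟨f', h1, h2⟩ := A.mem_graph_iff.1 h
  refine ⟨f', ?_, h1⟩
  have e : shift A z f' = A f' - z • (f' : E) := rfl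
  rw [e]
  simp only at h1 h2
  rw [h2, h1, add_sub_cancel_right]

lemma norm_le_norm_shift_laplacian {k : ℂ} (hk : 0 < k.im)
    (f : (shift μ.laplacian (k ^ 2)).domain) :
    ‖(f : L2HalfLine)‖ ≤ formConst k * ‖shift μ.laplacian (k ^ 2) f‖ := by
  have hmem := mem_graph_shift f
  rw [μ.graph_laplacian] at hmem
  obtain ⟨u, v, w, hH, hf, hg, h0, hj⟩ := hmem
  have h1 := energy_le_of_mem_laplacianGraph hk hH hf hg h0 hj
    (h := shift μ.laplacian (k ^ 2) f) (by simp)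
  have h2 := norm_sq_le_energy hf hH.memLp_v hH.memLp_u
  rcases (norm_nonneg (f : L2HalfLine)).eq_or_lt with h | h
  · rw [← h]; have := formConst_pos hk; positivity
  · have h3 := h2.trans h1
    simp only at h3
    rw [pow_two] at h3
    exact le_of_mul_le_mul_left (by linarith) h

end Lower

/-! ### Exponential kernels -/

/-- The one-sided exponential `e^{-c r}`, `r > 0`. -/
noncomputable def expKernel (c r : ℝ) : ℝ≥0∞ :=
  (Ioi (0 : ℝ)).indicator (fun r => ENNReal.ofReal (Real.exp (-c * r))) r

lemma measurable_expKernel (c : ℝ) : Measurable (expKernel c) :=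
  (ENNReal.measurable_ofReal.comp (by fun_prop)).indicator measurableSet_Ioi

lemma lintegral_expKernel {c : ℝ} (hc : 0 < c) : ∫⁻ r, expKernel c r = ENNReal.ofReal (1 / c) := by
  have hc' : -c < 0 := by linarith
  have := integral_exp_mul_Ioi hc' 0
  unfold expKernel
  rw [lintegral_indicator measurableSet_Ioi, ← ofReal_integral_eq_lintegral_ofReal
    (integrableOn_exp_mul_Ioi hc' 0) (Eventually.of_forall fun _ => (Real.exp_pos _).le), this]
  simp

lemma lintegral_expKernel_sub {c : ℝ} (hc : 0 < c) (s : ℝ) (A : Set ℝ) :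
    ∫⁻ t in A, expKernel c (t - s) ≤ ENNReal.ofReal (1 / c) :=
  (setLIntegral_le_lintegral _ _).trans
    ((lintegral_sub_right_eq_self (expKernel c) s).trans (lintegral_expKernel hc)).le

lemma lintegral_expKernel_sub' {c : ℝ} (hc : 0 < c) (s : ℝ) (A : Set ℝ) :
    ∫⁻ t in A, expKernel c (s - t) ≤ ENNReal.ofReal (1 / c) :=
  (setLIntegral_le_lintegral _ _).trans
    ((lintegral_sub_left_eq_self (expKernel c) s).trans (lintegral_expKernel hc)).le

lemma expKernel_of_pos {c r : ℝ} (hr : 0 < r) :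
    expKernel c r = ENNReal.ofReal (Real.exp (-c * r)) := indicator_of_mem (s := Ioi 0) hr _

lemma norm_exp_I_mul (k : ℂ) (r : ℝ) : ‖Complex.exp (Complex.I * k * r)‖ =
    Real.exp (-k.im * r) := by
  rw [Complex.norm_exp]
  congr 1
  simp [Complex.mul_re, Complex.mul_im]

lemma enorm_exp_I_mul {k : ℂ} {r : ℝ} (hr : 0 < r) :
    ‖Complex.exp (Complex.I * k * r)‖ₑ = expKernel k.im r := by
  rw [expKernel_of_pos hr, ← ofReal_norm, norm_exp_I_mul]

lemma hasDerivAt_exp_mul (c : ℂ) (x : ℝ) :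
    HasDerivAt (fun x : ℝ => Complex.exp (c * x)) (c * Complex.exp (c * x)) x := by
  have h1 : HasDerivAt (fun x : ℝ => c * (x : ℂ)) (c * 1) x :=
    (Complex.ofRealCLM.hasDerivAt (x := x)).const_mul c
  have := h1.cexp
  convert! this using 1
  ring

lemma memLp_exp {k : ℂ} (hk : 0 < k.im) :
    MemLp (fun s : ℝ => Complex.exp (Complex.I * k * s)) 2 ν₊ := by
  have hc : Continuous fun s : ℝ => Complex.exp (Complex.I * k * s) := by fun_prop
  rw [memLp_two_iff_integrable_sq_norm hc.aestronglyMeasurable]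
  have := integrableOn_exp_mul_Ioi (a := -(2 * k.im)) (by linarith) 0
  refine Integrable.congr this (Eventually.of_forall fun s => ?_)
  simp only [norm_exp_I_mul]
  rw [← Real.exp_nat_mul]
  congr 1
  push_cast
  ring

/-! ### The resolvent of the Dirichlet Laplacian -/

/-- Factor d²/ds² + k² = (d/ds + ik)(d/ds - ik). The first factor is inverted by integrating from
infinity, p(s) = ∫_s^∞ e^{ik(t-s)} g(t) dt, the second by integrating from 0, u(s) = ∫_0^s
e^{ik(s-t)} p(t) dt. Both kernels decay exponentially, so Schur's test keeps p and u in L², and u(0)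
= 0. -/
lemma exists_dirichlet_solution {k : ℂ} (hk : 0 < k.im) {g : ℝ → ℂ} (hg : MemLp g 2 ν₊) :
    ∃ u v : ℝ → ℂ, IsH2 ∅ u v (fun s => -k ^ 2 * u s - g s) ∧ Tendsto u (𝓝[>] 0) (𝓝 0) := by
  set e : ℝ → ℂ := fun s => Complex.exp (Complex.I * k * s) with he
  set e' : ℝ → ℂ := fun s => Complex.exp (-(Complex.I * k) * s) with he'
  have hee : ∀ s, e' s * e s = 1 := fun s => by
    simp only [e, e']; rw [← Complex.exp_add]; simp
  have hed : ∀ s, HasDerivAt e (Complex.I * k * e s) s := fun s => hasDerivAt_exp_mul _ s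
  have hed' : ∀ s, HasDerivAt e' (-(Complex.I * k) * e' s) s := fun s => hasDerivAt_exp_mul _ s
  have hec : Continuous e := continuous_iff_continuousAt.2 fun s => (hed s).continuousAt
  have hec' : Continuous e' := continuous_iff_continuousAt.2 fun s => (hed' s).continuousAt
  set φ : ℝ → ℂ := (Ioi 0).indicator fun t => e t * g t with hφ
  have hφi : Integrable φ :=
    (integrable_indicator_iff measurableSet_Ioi).2 ((memLp_exp hk).integrable_mul hg)
  set P : ℝ → ℂ := fun s => ∫ t in Ioi s, φ t with hP
  have hPd : ∀ x y, x ≤ y → ∫ t in x..y, -φ t = P y - P x := fun x y hxy => by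
    rw [intervalIntegral.integral_neg, ← intervalIntegral.integral_Ioi_sub_Ioi hφi.integrableOn hxy]
    simp only [P]; ring
  have hPc : Continuous P := by
    have h1 : P = fun s => P 0 - ∫ t in 0..s, φ t := by
      ext s
      simp only [P]
      rcases le_total 0 s with h | h
      · rw [← intervalIntegral.integral_Ioi_sub_Ioi hφi.integrableOn h]; ring
      · rw [intervalIntegral.integral_symm,
          ← intervalIntegral.integral_Ioi_sub_Ioi hφi.integrableOn h]; ring
    rw [h1]
    exact continuous_const.sub
      (intervalIntegral.continuous_primitive (fun _ _ => hφi.intervalIntegrable) 0)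
  set p : ℝ → ℂ := fun s => e' s * P s with hp
  have hpc : Continuous p := hec'.mul hPc
  set Q : ℝ → ℂ := fun s => ∫ t in 0..s, e' t * p t with hQ
  have hQd : ∀ s, HasDerivAt Q (e' s * p s) s := fun s =>
    (hec'.mul hpc).integral_hasStrictDerivAt 0 s |>.hasDerivAt
  set u : ℝ → ℂ := fun s => e s * Q s with hu
  set v : ℝ → ℂ := fun s => Complex.I * k * u s + p s with hv
  have hud : ∀ s, HasDerivAt u (v s) s := fun s => by
    have := (hed s).mul (hQd s)
    convert! this using 1
    simp only [v, u]
    linear_combination (-p s) * hee s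
  have huc : Continuous u := continuous_iff_continuousAt.2 fun s => (hud s).continuousAt
  have hvc : Continuous v := (continuous_const.mul huc).add hpc
  have hpL : MemLp p 2 ν₊ := by
    refine memLp_two_of_norm_le_lintegral (μ := ν₊) (ν := ν₊)
      (K := fun s t => expKernel k.im (t - s))
      ((measurable_expKernel _).comp (measurable_snd.sub measurable_fst)) hg
      (fun s => lintegral_expKernel_sub hk s _) (fun t => lintegral_expKernel_sub' hk t _)
      ENNReal.ofReal_ne_top ENNReal.ofReal_ne_top hpc.aestronglyMeasurable ?_
    filter_upwards [ae_restrict_mem measurableSet_Ioi] with s hs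
    have e1 : p s = ∫ t in Ioi s, e' s * φ t := by rw [integral_const_mul]
    rw [e1]
    refine (enorm_integral_le_lintegral_enorm _).trans ?_
    calc ∫⁻ t in Ioi s, ‖e' s * φ t‖ₑ = ∫⁻ t in Ioi s, expKernel k.im (t - s) * ‖g t‖ₑ := by
          refine setLIntegral_congr_fun measurableSet_Ioi fun t ht => ?_
          have ht0 : t ∈ Ioi (0 : ℝ) := mem_Ioi.2 ((mem_Ioi.1 hs).trans ht)
          simp only [φ]
          rw [indicator_of_mem ht0, ← mul_assoc, enorm_mul]
          congr 1
          rw [← enorm_exp_I_mul (sub_pos.2 ht)]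
          simp only [e, e']
          rw [← Complex.exp_add]
          congr 2
          push_cast
          ring
      _ ≤ _ := lintegral_mono_set (Ioi_subset_Ioi (le_of_lt hs))
  have huL : MemLp u 2 ν₊ := by
    refine memLp_two_of_norm_le_lintegral (μ := ν₊) (ν := ν₊)
      (K := fun s t => expKernel k.im (s - t))
      ((measurable_expKernel _).comp (measurable_fst.sub measurable_snd)) hpL
      (fun s => lintegral_expKernel_sub' hk s _) (fun t => lintegral_expKernel_sub hk t _)
      ENNReal.ofReal_ne_top ENNReal.ofReal_ne_top huc.aestronglyMeasurable ?_
    filter_upwards [ae_restrict_mem measurableSet_Ioi] with s hs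
    have e1 : u s = ∫ t in Ioo 0 s, e s * (e' t * p t) := by
      simp only [u, Q]
      rw [integral_const_mul, intervalIntegral.integral_of_le (le_of_lt hs),
        integral_Ioc_eq_integral_Ioo]
    rw [e1]
    refine (enorm_integral_le_lintegral_enorm _).trans ?_
    calc ∫⁻ t in Ioo 0 s, ‖e s * (e' t * p t)‖ₑ
          = ∫⁻ t in Ioo 0 s, expKernel k.im (s - t) * ‖p t‖ₑ := by
          refine setLIntegral_congr_fun measurableSet_Ioo fun t ht => ?_
          rw [← mul_assoc, enorm_mul]
          congr 1
          rw [← enorm_exp_I_mul (sub_pos.2 ht.2)]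
          simp only [e, e']
          rw [← Complex.exp_add]
          congr 2
          push_cast
          ring
      _ ≤ _ := lintegral_mono_set fun t ht => ht.1
  have hvL : MemLp v 2 ν₊ := (huL.const_mul _).add hpL
  refine ⟨u, v, ⟨huL, hvL, (huL.const_mul _).sub hg, fun s _ => hud s, ?_⟩, ?_⟩
  · intro x y hxy hI
    have hI0 : ∀ s ∈ Icc x y, 0 < s := fun s hs => (hI hs).1
    have hgi : IntervalIntegrable g volume x y :=
      intervalIntegrable_of_memLp hxy hg (hI.trans sdiff_subset)
    -- The product rule for p = e'P yields p' = -ikp - g in integrated form.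
    have hpp := (integral_deriv_mul_eq_sub (F := e') (G := P) (f := fun s =>
      -(Complex.I * k) * e' s) (g := fun s => -φ s) hxy
      ((continuous_const.mul hec').intervalIntegrable _ _) hφi.neg.intervalIntegrable
      (fun z hz => intervalIntegral.integral_eq_sub_of_hasDerivAt (fun s _ => hed' s)
        ((continuous_const.mul hec').intervalIntegrable _ _))
      (fun z hz => hPd x z hz.1)).2
    have hpp' : ∫ s in x..y, (-(Complex.I * k) * p s - g s) = p y - p x := by
      rw [← hpp]
      refine intervalIntegral.integral_congr fun s hs => ?_
      rw [uIcc_of_le hxy] at hs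
      simp only [φ, p]
      rw [indicator_of_mem (s := Ioi 0) (hI0 s hs)]
      linear_combination (g s) * hee s
    have huu : ∫ s in x..y, v s = u y - u x :=
      intervalIntegral.integral_eq_sub_of_hasDerivAt (fun s _ => hud s)
        (hvc.intervalIntegrable _ _)
    have e1 : ∀ s, -k ^ 2 * u s - g s = Complex.I * k * v s + (-(Complex.I * k) * p s - g s) :=
      fun s => by
        simp only [v]
        linear_combination (-k ^ 2 * u s) * Complex.I_sq
    simp_rw [e1]
    have i1 : IntervalIntegrable (fun s => Complex.I * k * v s) volume x y :=
      (continuous_const.mul hvc).intervalIntegrable _ _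
    have i2 : IntervalIntegrable (fun s => -(Complex.I * k) * p s - g s) volume x y :=
      ((continuous_const.mul hpc).intervalIntegrable _ _).sub hgi
    rw [intervalIntegral.integral_add i1 i2, hpp',
      intervalIntegral.integral_const_mul, huu]
    simp only [v]
    ring
  · have : u 0 = 0 := by simp [u, Q]
    have h := huc.tendsto 0
    rw [this] at h
    exact h.mono_left nhdsWithin_le_nhds

lemma exists_isBoundedInverse_dirichlet {k : ℂ} (hk : 0 < k.im) :
    ∃ R : L2HalfLine →L[ℂ] L2HalfLine,
      IsBoundedInverse (shift dirichletLaplacian (k ^ 2)) R := by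
  refine exists_isBoundedInverse _ (formConst k) (norm_le_norm_shift_laplacian hk) fun g => ?_
  obtain ⟨u, v, hH, h0⟩ := exists_dirichlet_solution hk (Lp.memLp g)
  obtain ⟨f, hf, -⟩ := exists_shift_eq (A := dirichletLaplacian) (z := k ^ 2)
    (f := hH.memLp_u.toLp u) (g := g) (by
    rw [dirichletLaplacian, AtomicMeasure.graph_laplacian]
    refine ⟨u, v, _, by rwa [range_eq_empty], hH.memLp_u.coeFn_toLp, ?_, h0, fun n => n.elim⟩
    filter_upwards [Lp.coeFn_add g (k ^ 2 • hH.memLp_u.toLp u),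
      Lp.coeFn_smul (k ^ 2) (hH.memLp_u.toLp u), hH.memLp_u.coeFn_toLp] with s h1 h2 h3
    simp only [h1, Pi.add_apply, h2, Pi.smul_apply, h3, Pi.neg_apply, smul_eq_mul]
    ring)
  exact ⟨f, hf⟩

lemma IsH2.congr_right {S : Set ℝ} {u v w w' : ℝ → ℂ} (h : IsH2 S u v w) (hw : w =ᵐ[ν₊] w') :
    IsH2 S u v w' where
  memLp_u := h.memLp_u
  memLp_v := h.memLp_v
  memLp_w := h.memLp_w.ae_eq hw
  hasDerivAt := h.hasDerivAt
  integral_eq x y hxy hI := by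
    rw [← h.integral_eq x y hxy hI]
    refine intervalIntegral.integral_congr_ae ?_
    filter_upwards [(ae_restrict_iff' measurableSet_Ioi).1 hw] with s hs hs'
    rw [uIoc_of_le hxy] at hs'
    exact (hs (hI (Ioc_subset_Icc_self hs')).1).symm

/-- The functions in the domain of the inverse of `A_μ⁺ - k²`. -/
lemma exists_isH2_of_shift {J : Type*} {μ : AtomicMeasure J} {k : ℂ} (hk : 0 < k.im)
    (f : (shift μ.laplacian (k ^ 2)).domain) :
    ∃ u v : ℝ → ℂ,
      IsH2 (range μ.t) u v (fun s => -k ^ 2 * u s - shift μ.laplacian (k ^ 2) f s) ∧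
      (f : L2HalfLine) =ᵐ[ν₊] u ∧ Tendsto u (𝓝[>] 0) (𝓝 0) ∧
      (∀ n, JumpCondition (μ.b n) (μ.t n) u v) ∧
      energy u v ≤ formConst k ^ 2 * ‖shift μ.laplacian (k ^ 2) f‖ ^ 2 := by
  have hmem := mem_graph_shift f
  rw [μ.graph_laplacian] at hmem
  obtain ⟨u, v, w, hH, hf, hg, h0, hj⟩ := hmem
  have h1 := energy_le_of_mem_laplacianGraph hk hH hf hg h0 hj
    (h := shift μ.laplacian (k ^ 2) f) (by simp)
  refine ⟨u, v, hH.congr_right ?_, hf, h0, hj, ?_⟩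
  · filter_upwards [hf, hg, Lp.coeFn_add (shift μ.laplacian (k ^ 2) f) (k ^ 2 • (f : L2HalfLine)),
      Lp.coeFn_smul (k ^ 2) (f : L2HalfLine)] with s h2 h3 h4 h5
    simp only [h4, Pi.add_apply, h5, Pi.smul_apply, Pi.neg_apply, smul_eq_mul] at h2 h3
    rw [h2] at h3
    linear_combination h3
  · refine h1.trans ?_
    have h2 := norm_le_norm_shift_laplacian hk f
    have hc := formConst_pos hk
    calc _ ≤ formConst k * ((formConst k * ‖shift μ.laplacian (k ^ 2) f‖) *
          ‖shift μ.laplacian (k ^ 2) f‖) := by gcongr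
      _ = _ := by ring

/-! ### The trace space -/

section TraceSpace

variable {J : Type*}

lemma norm_sq_eq_add (x : EuclideanSpace ℂ (Fin 2)) : ‖x‖ ^ 2 = ‖x 0‖ ^ 2 + ‖x 1‖ ^ 2 := by
  rw [EuclideanSpace.norm_sq_eq, Fin.sum_univ_two]

lemma TraceSpace.hasSum_norm_sq (x : TraceSpace J) : HasSum (fun n => ‖x n‖ ^ 2) (‖x‖ ^ 2) := by
  have := lp.hasSum_norm (p := 2) (by norm_num) x
  simpa using this

lemma TraceSpace.summable_norm_sq (x : TraceSpace J) (i : Fin 2) :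
    Summable fun n => ‖x n i‖ ^ 2 := by
  refine Summable.of_nonneg_of_le (fun _ => sq_nonneg _) (fun n => ?_) x.hasSum_norm_sq.summable
  rw [norm_sq_eq_add]
  fin_cases i <;> simp

/-- The element of the trace space with the given components. -/
noncomputable def traceOf (a c : J → ℂ) (ha : Summable fun n => ‖a n‖ ^ 2)
    (hc : Summable fun n => ‖c n‖ ^ 2) : TraceSpace J :=
  ⟨fun n => !₂[a n, c n], memℓp_gen (by
    refine (ha.add hc).congr fun n => ?_
    simp [norm_sq_eq_add])⟩

lemma traceOf_apply {a c : J → ℂ} (ha : Summable fun n => ‖a n‖ ^ 2)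
    (hc : Summable fun n => ‖c n‖ ^ 2) (n : J) : traceOf a c ha hc n = !₂[a n, c n] := rfl

lemma norm_traceOf_sq_le {a c : J → ℂ} (ha : Summable fun n => ‖a n‖ ^ 2)
    (hc : Summable fun n => ‖c n‖ ^ 2) {A C : ℝ} (hA : ∀ s : Finset J, ∑ n ∈ s, ‖a n‖ ^ 2 ≤ A)
    (hC : ∀ s : Finset J, ∑ n ∈ s, ‖c n‖ ^ 2 ≤ C) : ‖traceOf a c ha hc‖ ^ 2 ≤ A + C := by
  refine hasSum_le_of_sum_le (traceOf a c ha hc).hasSum_norm_sq fun s => ?_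
  simp only [traceOf_apply, norm_sq_eq_add]
  simpa [Finset.sum_add_distrib] using add_le_add (hA s) (hC s)

lemma inner_eq_add (x y : EuclideanSpace ℂ (Fin 2)) :
    inner ℂ x y = starRingEnd ℂ (x 0) * y 0 + starRingEnd ℂ (x 1) * y 1 := by
  rw [PiLp.inner_apply, Fin.sum_univ_two, RCLike.inner_apply, RCLike.inner_apply]
  ring

end TraceSpace

/-! ### The trace operator -/

section Trace

variable {J : Type*} {μ : AtomicMeasure J} {u v w : ℝ → ℂ}

lemma IsH2.continuousAt (h : IsH2 ∅ u v w) {x : ℝ} (hx : 0 < x) :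
    ContinuousAt u x ∧ ContinuousAt v x := by
  refine ⟨(h.hasDerivAt x ⟨hx, notMem_empty _⟩).continuousAt, ?_⟩
  have hI : Ioo (0 : ℝ) (x + 1) ⊆ Ioi 0 \ ∅ := fun s hs => ⟨hs.1, notMem_empty _⟩
  exact (h.isH1'.continuousOn_Ioo (by linarith) hI).continuousAt
    (Ioo_mem_nhds hx (by linarith))

lemma IsH2.mono {S S' : Set ℝ} (h : IsH2 S u v w) (hS : S ⊆ S') : IsH2 S' u v w where
  memLp_u := h.memLp_u
  memLp_v := h.memLp_v
  memLp_w := h.memLp_w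
  hasDerivAt x hx := h.hasDerivAt x ⟨hx.1, fun h => hx.2 (hS h)⟩
  integral_eq x y hxy hI := h.integral_eq x y hxy (hI.trans (sdiff_subset_sdiff_right hS))

/-- The values u(t_n) are controlled by the H¹ energy of u and the values u'(t_n) by that of u', so
every function in the domain of the Dirichlet Laplacian has a square summable trace. -/
lemma exists_mem_traceGraph (h : IsH2 ∅ u v w) (h0 : Tendsto u (𝓝[>] 0) (𝓝 0)) {f : L2HalfLine}
    (hf : f =ᵐ[ν₊] u) :
    ∃ y : TraceSpace J, (f, y) ∈ μ.traceGraph ∧ (∀ n, y n = !₂[u (μ.t n), v (μ.t n)]) ∧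
      ‖y‖ ^ 2 ≤ μ.traceConst * (energy u v + energy v w) := by
  have h' := h.mono (empty_subset (range μ.t))
  have hu : ∀ n, Tendsto u (𝓝[>] μ.t n) (𝓝 (u (μ.t n))) := fun n =>
    (h.continuousAt (μ.t_pos n)).1.tendsto.mono_left nhdsWithin_le_nhds
  have hv : ∀ n, Tendsto v (𝓝[>] μ.t n) (𝓝 (v (μ.t n))) := fun n =>
    (h.continuousAt (μ.t_pos n)).2.tendsto.mono_left nhdsWithin_le_nhds
  refine ⟨traceOf _ _ (h'.isH1.summable_norm_sq_right hu) (h'.isH1'.summable_norm_sq_right hv),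
    ⟨u, v, w, h, hf, h0, fun n => rfl⟩, fun n => rfl, ?_⟩
  rw [mul_add]
  exact norm_traceOf_sq_le _ _ (h'.isH1.sum_norm_sq_right_le hu) (h'.isH1'.sum_norm_sq_right_le hv)

/-- The differential equation replaces u'': |k²u + g|² ≤ 2|k|⁴|u|² + 2|g|². Thus coercivity, which
controls only u and u', suffices for traces of u' too. -/
lemma energy_deriv_le {k : ℂ} {g : ℝ → ℂ} (hu : MemLp u 2 ν₊) (hv : MemLp v 2 ν₊)
    (hg : MemLp g 2 ν₊) :
    energy v (fun s => -k ^ 2 * u s - g s) ≤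
      (1 + 2 * ‖k‖ ^ 4) * energy u v + 2 * ∫ s, ‖g s‖ ^ 2 ∂ν₊ := by
  have hu2 := integrable_norm_sq hu
  have hv2 := integrable_norm_sq hv
  have hg2 := integrable_norm_sq hg
  have hw2 := integrable_norm_sq ((hu.const_mul (-k ^ 2)).sub hg)
  have i1 : Integrable (fun s => (1 + 2 * ‖k‖ ^ 4) * (‖u s‖ ^ 2 + ‖v s‖ ^ 2)) ν₊ :=
    (hu2.add hv2).const_mul _
  rw [energy, energy, ← integral_const_mul, ← integral_const_mul,
    ← integral_add i1 (hg2.const_mul _)]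
  refine integral_mono (hv2.add hw2) (i1.add (hg2.const_mul _)) fun s => ?_
  simp only
  have h1 : ‖-k ^ 2 * u s - g s‖ ≤ ‖k‖ ^ 2 * ‖u s‖ + ‖g s‖ := by
    refine (norm_sub_le _ _).trans_eq ?_
    rw [norm_mul, norm_neg, norm_pow]
  have h2 : ‖-k ^ 2 * u s - g s‖ ^ 2 ≤ (‖k‖ ^ 2 * ‖u s‖ + ‖g s‖) ^ 2 := by gcongr
  nlinarith [sq_nonneg (‖k‖ ^ 2 * ‖u s‖ - ‖g s‖), sq_nonneg (‖u s‖),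
    mul_nonneg (pow_nonneg (norm_nonneg k) 4) (sq_nonneg (‖v s‖))]

lemma mem_dirichletLaplacian_graph {f g : L2HalfLine} :
    (f, g) ∈ dirichletLaplacian.graph ↔ ∃ u v w : ℝ → ℂ, IsH2 ∅ u v w ∧ f =ᵐ[ν₊] u ∧
      g =ᵐ[ν₊] -w ∧ Tendsto u (𝓝[>] 0) (𝓝 0) := by
  rw [dirichletLaplacian, AtomicMeasure.graph_laplacian]
  constructor
  · rintro ⟨u, v, w, h, h1, h2, h3, -⟩
    exact ⟨u, v, w, by rwa [range_eq_empty] at h, h1, h2, h3⟩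
  · rintro ⟨u, v, w, h, h1, h2, h3⟩
    exact ⟨u, v, w, by rwa [range_eq_empty], h1, h2, h3, fun n => n.elim⟩

lemma trace_domain_eq (μ : AtomicMeasure J) : μ.trace.domain = dirichletLaplacian.domain := by
  ext f
  rw [LinearPMap.mem_domain_iff, LinearPMap.mem_domain_iff]
  constructor
  · rintro ⟨y, hy⟩
    rw [μ.graph_trace] at hy
    obtain ⟨u, v, w, h, h1, h2, -⟩ := hy
    refine ⟨h.memLp_w.neg.toLp (-w), mem_dirichletLaplacian_graph.2
      ⟨u, v, w, h, h1, h.memLp_w.neg.coeFn_toLp, h2⟩⟩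
  · rintro ⟨g, hg⟩
    obtain ⟨u, v, w, h, h1, -, h2⟩ := mem_dirichletLaplacian_graph.1 hg
    obtain ⟨y, hy, -⟩ := exists_mem_traceGraph (μ := μ) h h2 h1
    exact ⟨y, by rwa [μ.graph_trace]⟩

/-- The functions in the range of the resolvent of the Dirichlet Laplacian. -/
lemma IsBoundedInverse.exists_isH2 {k : ℂ} (hk : 0 < k.im) {R : L2HalfLine →L[ℂ] L2HalfLine}
    (hR : IsBoundedInverse (shift dirichletLaplacian (k ^ 2)) R) (g : L2HalfLine) :
    ∃ u v : ℝ → ℂ, IsH2 ∅ u v (fun s => -k ^ 2 * u s - g s) ∧ R g =ᵐ[ν₊] u ∧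
      Tendsto u (𝓝[>] 0) (𝓝 0) ∧ energy u v ≤ formConst k ^ 2 * ‖g‖ ^ 2 := by
  obtain ⟨f, hf, hfR⟩ := hR.2 g
  obtain ⟨u, v, h1, h2, h3, -, h4⟩ := exists_isH2_of_shift hk f
  rw [show shift AtomicMeasure.empty.laplacian (k ^ 2) f = g from hf] at h1 h4
  rw [range_eq_empty] at h1
  exact ⟨u, v, h1, hfR ▸ h2, h3, h4⟩

lemma exists_isComp_trace (μ : AtomicMeasure J) {k : ℂ} (hk : 0 < k.im)
    {R : L2HalfLine →L[ℂ] L2HalfLine}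
    (hR : IsBoundedInverse (shift dirichletLaplacian (k ^ 2)) R) :
    ∃ Γ : L2HalfLine →L[ℂ] TraceSpace J, IsComp μ.trace R Γ := by
  -- The first summand bounds the energy of u, the bracket that of u', both relative to ‖g‖².
  set C := μ.traceConst * (formConst k ^ 2 + ((1 + 2 * ‖k‖ ^ 4) * formConst k ^ 2 + 2))
  have hC0 : 0 ≤ C := by have := μ.traceConst_pos; positivity
  have hy : ∀ g, ∃ y : TraceSpace J, (R g, y) ∈ μ.trace.graph ∧ ‖y‖ ≤ √C * ‖g‖ := by
    intro g
    obtain ⟨u, v, h1, h2, h3, h4⟩ := hR.exists_isH2 hk g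
    obtain ⟨y, hy, -, hyn⟩ := exists_mem_traceGraph (μ := μ) h1 h3 h2
    refine ⟨y, by rwa [μ.graph_trace], ?_⟩
    have h5 := energy_deriv_le (k := k) h1.memLp_u h1.memLp_v (Lp.memLp g)
    rw [← norm_toLp_sq (f := g) (EventuallyEq.refl _ _)] at h5
    have h6 : ‖y‖ ^ 2 ≤ C * ‖g‖ ^ 2 := by
      refine hyn.trans ?_
      simp only [C]
      rw [mul_assoc]
      refine mul_le_mul_of_nonneg_left ?_ μ.traceConst_pos.le
      have : (1 + 2 * ‖k‖ ^ 4) * energy u v ≤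
          (1 + 2 * ‖k‖ ^ 4) * (formConst k ^ 2 * ‖g‖ ^ 2) := by gcongr
      linarith
    refine abs_le_of_sq_le_sq' ?_ (by positivity) |>.2
    rwa [mul_pow, Real.sq_sqrt hC0]
  have hmem : ∀ g, R g ∈ μ.trace.domain := fun g => by
    obtain ⟨y, hy, -⟩ := hy g
    exact LinearPMap.mem_domain_of_mem_graph hy
  refine ⟨(μ.trace.toFun ∘ₗ (R : L2HalfLine →ₗ[ℂ] L2HalfLine).codRestrict μ.trace.domain
    hmem).mkContinuous (√C) fun g => ?_, fun g => ⟨⟨R g, hmem g⟩, rfl, rfl⟩⟩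
  obtain ⟨y, hy, hyn⟩ := hy g
  obtain ⟨f, hf1, hf2⟩ := (LinearPMap.mem_graph_iff _).1 hy
  have e : (R : L2HalfLine →ₗ[ℂ] L2HalfLine).codRestrict μ.trace.domain hmem g = f :=
    Subtype.ext hf1.symm
  simp only at hf2
  rw [LinearMap.comp_apply, e, LinearPMap.toFun_eq_coe, hf2]
  exact hyn

/-- The trace relation is single-valued, so any H² representative of R g may be used to evaluate Γ
g. -/
lemma IsComp.trace_apply {R : L2HalfLine →L[ℂ] L2HalfLine}
    {Γ : L2HalfLine →L[ℂ] TraceSpace J} (hΓ : IsComp μ.trace R Γ) {g : L2HalfLine}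
    (h : IsH2 ∅ u v w) (h0 : Tendsto u (𝓝[>] 0) (𝓝 0)) (hu : R g =ᵐ[ν₊] u) (n : J) :
    Γ g n = !₂[u (μ.t n), v (μ.t n)] := by
  obtain ⟨f, hf1, hf2⟩ := hΓ g
  obtain ⟨y, hy, hyn, -⟩ := exists_mem_traceGraph (μ := μ) h h0 hu
  rw [← μ.graph_trace] at hy
  have hfg := μ.trace.mem_graph f
  rw [hf1, hf2] at hfg
  rw [LinearPMap.mem_graph_snd_inj _ hfg hy rfl, hyn]

end Trace

/-! ### Sums of one-sided exponentials -/

section DecaySum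

variable {J : Type*} (μ : AtomicMeasure J) {c : ℂ} {y : J → ℂ}

/-- The function `∑ n, e^{ic(s - t n)} y n`, the sum being over all `n` with `t n < s`. -/
noncomputable def decaySum (c : ℂ) (y : J → ℂ) (s : ℝ) : ℂ :=
  ∑' n, (Ioi (μ.t n)).indicator (fun s => Complex.exp (Complex.I * c * (s - μ.t n : ℝ)) * y n) s

/-- Only the finitely many points left of s contribute; using forward waves alone avoids any
question of pointwise convergence. -/
lemma summable_decaySum (c : ℂ) (y : J → ℂ) (s : ℝ) : Summable fun n =>
    (Ioi (μ.t n)).indicator (fun s => Complex.exp (Complex.I * c * (s - μ.t n : ℝ)) * y n) s := by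
  refine summable_of_hasFiniteSupport ((μ.finite_t_lt s).subset fun n hn => ?_)
  by_contra h
  exact hn (indicator_of_notMem (s := Ioi (μ.t n)) h _)

lemma decaySum_eq_exp_mul {s₀ s : ℝ} (hs : s₀ ≤ s) (h : ∀ n, μ.t n < s → μ.t n < s₀) :
    decaySum μ c y s = Complex.exp (Complex.I * c * (s - s₀ : ℝ)) * decaySum μ c y s₀ := by
  rw [decaySum, decaySum, ← tsum_mul_left]
  refine tsum_congr fun n => ?_
  by_cases hn : μ.t n < s
  · rw [indicator_of_mem (s := Ioi _) hn, indicator_of_mem (s := Ioi _) (h n hn), ← mul_assoc,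
      ← Complex.exp_add]
    congr 2
    push_cast
    ring
  · rw [indicator_of_notMem (s := Ioi _) hn,
      indicator_of_notMem (s := Ioi _) fun h' => hn (lt_of_lt_of_le h' hs), mul_zero]

lemma decaySum_eq_exp_mul_add (n : J) {s : ℝ} (hs : s ∈ Ioo (μ.t n) (μ.t n + μ.gap)) :
    decaySum μ c y s =
      Complex.exp (Complex.I * c * (s - μ.t n : ℝ)) * (decaySum μ c y (μ.t n) + y n) := by
  classical
  have h1 := (((summable_decaySum μ c y (μ.t n)).hasSum).add (hasSum_ite_eq n (y n))).mul_left
    (Complex.exp (Complex.I * c * (s - μ.t n : ℝ)))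
  rw [decaySum]
  rw [← decaySum] at h1
  refine HasSum.tsum_eq (h1.congr_fun ?_)
  intro m
  by_cases hmn : m = n
  · subst hmn
    rw [indicator_of_mem (s := Ioi _) hs.1, indicator_of_notMem (s := Ioi _) (lt_irrefl _)]
    simp
  · rw [if_neg hmn, add_zero]
    by_cases hm : μ.t m < μ.t n
    · rw [indicator_of_mem (s := Ioi (μ.t m)) (a := μ.t n) hm,
        indicator_of_mem (s := Ioi _) (mem_Ioi.2 (hm.trans hs.1)), ← mul_assoc, ← Complex.exp_add]
      congr 2
      push_cast
      ring
    · rw [indicator_of_notMem (s := Ioi (μ.t m)) (a := μ.t n) hm, mul_zero, indicator_of_notMem]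
      intro hms
      have hlt : μ.t n < μ.t m := lt_of_le_of_ne (not_lt.1 hm) fun e => hmn (μ.injective_t e.symm)
      exact (μ.Ioo_right_subset n ⟨hlt, (mem_Ioi.1 hms).trans hs.2⟩).2 ⟨m, rfl⟩

lemma decaySum_of_lt_gap {s : ℝ} (hs : s < μ.gap) : decaySum μ c y s = 0 := by
  rw [decaySum]
  refine (tsum_congr fun n => indicator_of_notMem (fun h => ?_) _).trans tsum_zero
  have := μ.gap_le n
  have := mem_Ioi.1 h
  linarith

lemma tendsto_decaySum_zero : Tendsto (decaySum μ c y) (𝓝[>] 0) (𝓝 0) := by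
  refine tendsto_const_nhds.congr' ?_
  filter_upwards [Ioo_mem_nhdsGT μ.gap_pos] with s hs using (decaySum_of_lt_gap μ hs.2).symm

/-- The strict inequality t_n < s leaves out the term of t_n at t_n itself, so the sum is
left-continuous there and jumps by y n to the right. -/
lemma tendsto_decaySum_left (n : J) :
    Tendsto (decaySum μ c y) (𝓝[<] μ.t n) (𝓝 (decaySum μ c y (μ.t n))) := by
  have hg := μ.gap_pos
  set a := μ.t n - μ.gap / 2
  have ha : a < μ.t n := by simp only [a]; linarith
  have h : ∀ s ∈ Ioc a (μ.t n), decaySum μ c y s =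
      Complex.exp (Complex.I * c * (s - a : ℝ)) * decaySum μ c y a := by
    intro s hs
    refine decaySum_eq_exp_mul μ hs.1.le fun m hm => ?_
    by_contra! hc
    exact (μ.Ioo_left_subset n ⟨by simp only [a] at hc; linarith, hm.trans_le hs.2⟩).2 ⟨m, rfl⟩
  rw [h (μ.t n) ⟨ha, le_rfl⟩]
  have hcont : Continuous fun s : ℝ => Complex.exp (Complex.I * c * (s - a : ℝ)) *
    decaySum μ c y a := by fun_prop
  refine ((hcont.tendsto (μ.t n)).mono_left nhdsWithin_le_nhds).congr' ?_
  filter_upwards [Ioo_mem_nhdsLT ha] with s hs using (h s ⟨hs.1, hs.2.le⟩).symm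

lemma tendsto_decaySum_right (n : J) :
    Tendsto (decaySum μ c y) (𝓝[>] μ.t n) (𝓝 (decaySum μ c y (μ.t n) + y n)) := by
  have hcont : Continuous fun s : ℝ => Complex.exp (Complex.I * c * (s - μ.t n : ℝ)) *
    (decaySum μ c y (μ.t n) + y n) := by fun_prop
  have h := (hcont.tendsto (μ.t n)).mono_left (nhdsWithin_le_nhds (s := Ioi (μ.t n)))
  simp only [sub_self, Complex.ofReal_zero, mul_zero, Complex.exp_zero, one_mul] at h
  refine h.congr' ?_
  filter_upwards [Ioo_mem_nhdsGT (show μ.t n < μ.t n + μ.gap by linarith [μ.gap_pos])] with s hs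
    using (decaySum_eq_exp_mul_add μ n hs).symm

lemma hasDerivAt_decaySum {x : ℝ} (hx : x ∉ range μ.t) :
    HasDerivAt (decaySum μ c y) (Complex.I * c * decaySum μ c y x) x := by
  obtain ⟨δ, hδ, hball⟩ := Metric.isOpen_iff.1 μ.isClosed_range.isOpen_compl x hx
  set a := x - δ / 2
  have ha : a < x := by simp only [a]; linarith
  have h : ∀ s ∈ Ioo a (x + δ / 2), decaySum μ c y s =
      Complex.exp (Complex.I * c * (s - a : ℝ)) * decaySum μ c y a := by
    intro s hs
    refine decaySum_eq_exp_mul μ hs.1.le fun m hm => ?_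
    by_contra! hc
    refine hball ?_ ⟨m, rfl⟩
    rw [Metric.mem_ball, Real.dist_eq, abs_lt]
    simp only [a] at hc
    constructor <;> linarith [hs.2]
  have hd : HasDerivAt (fun s : ℝ => Complex.exp (Complex.I * c * (s - a : ℝ)) * decaySum μ c y a)
      (Complex.I * c * decaySum μ c y x) x := by
    have := ((hasDerivAt_exp_mul (Complex.I * c) (x - a)).comp_sub_const x a).mul_const
      (decaySum μ c y a)
    convert! this using 1
    rw [h x ⟨ha, by linarith⟩]
    ring
  refine hd.congr_of_eventuallyEq ?_
  filter_upwards [Ioo_mem_nhds ha (show x < x + δ / 2 by linarith)] with s hs using h s hs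

lemma aestronglyMeasurable_of_continuousOn {F : ℝ → ℂ} (h : ContinuousOn F (Ioi 0 \ range μ.t)) :
    AEStronglyMeasurable F ν₊ := by
  have hm : MeasurableSet (Ioi 0 \ range μ.t) :=
    measurableSet_Ioi.diff μ.isClosed_range.measurableSet
  have h1 := h.aestronglyMeasurable (μ := volume) hm
  have h2 : volume.restrict (Ioi 0 \ range μ.t) = ν₊ :=
    Measure.restrict_congr_set (sdiff_null_ae_eq_self μ.volume_range)
  rwa [h2] at h1

/-- Each term is compared with the integral of the kernel over the interval of length `gap` to the
left of t_n. Moving within that interval costs at most e^{κ·gap}, and the intervals are disjoint. -/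
lemma exists_tsum_expKernel_le {κ : ℝ} (hκ : 0 < κ) :
    ∃ C : ℝ≥0∞, C ≠ ⊤ ∧ ∀ s, ∑' n, expKernel κ (s - μ.t n) ≤ C := by
  have hg := μ.gap_pos
  have := μ.countable
  set e := ENNReal.ofReal (Real.exp (κ * μ.gap))
  have hg0 : ENNReal.ofReal μ.gap ≠ 0 := by simpa using hg
  refine ⟨e * ENNReal.ofReal (1 / κ) / ENNReal.ofReal μ.gap,
    ENNReal.div_ne_top (ENNReal.mul_ne_top ENNReal.ofReal_ne_top ENNReal.ofReal_ne_top) hg0,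
    fun s => ?_⟩
  rw [ENNReal.le_div_iff_mul_le (Or.inl hg0) (Or.inl ENNReal.ofReal_ne_top),
    ← ENNReal.tsum_mul_right]
  have hpt : ∀ n, ∀ r ∈ Ioo (μ.t n - μ.gap) (μ.t n - μ.gap + μ.gap),
      expKernel κ (s - μ.t n) ≤ e * expKernel κ (s - r) := by
    intro n r hr
    rw [sub_add_cancel] at hr
    by_cases hs : μ.t n < s
    · rw [expKernel_of_pos (sub_pos.2 hs), expKernel_of_pos (sub_pos.2 (hr.2.trans hs)),
        ← ENNReal.ofReal_mul (Real.exp_pos _).le, ← Real.exp_add]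
      refine ENNReal.ofReal_le_ofReal (Real.exp_le_exp.2 ?_)
      nlinarith [hr.1]
    · rw [expKernel, indicator_of_notMem]
      · exact zero_le
      · simpa using hs
  calc ∑' n, expKernel κ (s - μ.t n) * ENNReal.ofReal μ.gap
      = ∑' n, ∫⁻ _ in Ioo (μ.t n - μ.gap) (μ.t n - μ.gap + μ.gap), expKernel κ (s - μ.t n) := by
        refine tsum_congr fun n => ?_
        rw [setLIntegral_const, Real.volume_Ioo, add_sub_cancel_left]
    _ ≤ ∑' n, ∫⁻ r in Ioo (μ.t n - μ.gap) (μ.t n - μ.gap + μ.gap), e * expKernel κ (s - r) :=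
        ENNReal.tsum_le_tsum fun n => setLIntegral_mono' measurableSet_Ioo (hpt n)
    _ = ∫⁻ r in ⋃ n, Ioo (μ.t n - μ.gap) (μ.t n - μ.gap + μ.gap), e * expKernel κ (s - r) :=
        (lintegral_iUnion (fun n => measurableSet_Ioo) (μ.pairwise_disjoint_Ioo μ.gap) _).symm
    _ ≤ e * ENNReal.ofReal (1 / κ) := by
        rw [lintegral_const_mul' _ _ ENNReal.ofReal_ne_top]
        gcongr
        exact lintegral_expKernel_sub' hκ s _

/-- Schur's test between L²(0, ∞) and ℓ²(J), with counting measure on the countable set J. -/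
lemma memLp_decaySum (hc : 0 < c.im) (hy : Summable fun n => ‖y n‖ ^ 2) :
    MemLp (decaySum μ c y) 2 ν₊ := by
  have := μ.countable
  let _ : MeasurableSpace J := ⊤
  have : MeasurableSingletonClass J := ⟨fun _ => trivial⟩
  obtain ⟨C, hC, hCs⟩ := exists_tsum_expKernel_le μ hc
  have hyL : MemLp y 2 (Measure.count : Measure J) := by
    refine ⟨(measurable_of_countable y).aestronglyMeasurable, ?_⟩
    rw [eLpNorm_lt_top_iff_lintegral_rpow_enorm_lt_top (by norm_num) (by norm_num),
      lintegral_count]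
    have h := hy.tsum_ofReal_lt_top
    convert! h using 3 with n
    rw [ENNReal.toReal_ofNat, ENNReal.rpow_two, ENNReal.ofReal_pow (norm_nonneg _), ofReal_norm]
  refine memLp_two_of_norm_le_lintegral (μ := ν₊) (ν := (Measure.count : Measure J))
    (K := fun s n => expKernel c.im (s - μ.t n)) ?_ hyL (C := C) (D := ENNReal.ofReal (1 / c.im))
    (fun s => by rw [lintegral_count]; exact hCs s) (fun n => lintegral_expKernel_sub hc _ _)
    hC ENNReal.ofReal_ne_top ?_ (Eventually.of_forall fun s => ?_)
  · exact (measurable_expKernel _).comp (measurable_fst.sub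
      ((measurable_of_countable μ.t).comp measurable_snd))
  · exact aestronglyMeasurable_of_continuousOn μ fun x hx =>
      (hasDerivAt_decaySum μ hx.2).continuousAt.continuousWithinAt
  · rw [lintegral_count, decaySum]
    refine enorm_tsum_le_tsum_enorm.trans (ENNReal.tsum_le_tsum fun n => ?_)
    by_cases hn : μ.t n < s
    · rw [indicator_of_mem (s := Ioi _) hn, enorm_mul, enorm_exp_I_mul (sub_pos.2 hn)]
    · rw [indicator_of_notMem (s := Ioi _) hn]; simp

lemma isH2_decaySum (hc : 0 < c.im) (hy : Summable fun n => ‖y n‖ ^ 2) :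
    IsH2 (range μ.t) (decaySum μ c y) (fun s => Complex.I * c * decaySum μ c y s)
      (fun s => -c ^ 2 * decaySum μ c y s) where
  memLp_u := memLp_decaySum μ hc hy
  memLp_v := (memLp_decaySum μ hc hy).const_mul _
  memLp_w := (memLp_decaySum μ hc hy).const_mul _
  hasDerivAt x hx := hasDerivAt_decaySum μ hx.2
  integral_eq x z hxz hI := by
    refine intervalIntegral.integral_eq_sub_of_hasDerivAt
      (f := fun s => Complex.I * c * decaySum μ c y s) (fun s hs => ?_)
      (intervalIntegrable_of_memLp hxz ((memLp_decaySum μ hc hy).const_mul (-c ^ 2))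
        (hI.trans sdiff_subset))
    rw [uIcc_of_le hxz] at hs
    have := (hasDerivAt_decaySum μ (c := c) (y := y) (hI hs).2).const_mul (Complex.I * c)
    convert! this using 1
    linear_combination (-c ^ 2 * decaySum μ c y s) * Complex.I_sq

end DecaySum

/-! ### Solutions with prescribed jumps -/

/-- `u`, with `u' = v`, solves `-u'' = k² u` on `(0, ∞) \ {t n}` with `u(0) = 0`, has the jumps
`x` in the sense that `[u'] = -x₀` and `[u] = x₁` at `t n`, and the averages `a`. -/
structure JumpSolution {J : Type*} (μ : AtomicMeasure J) (k : ℂ) (x a : TraceSpace J)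
    (u v : ℝ → ℂ) : Prop where
  isH2 : IsH2 (range μ.t) u v (fun s => -k ^ 2 * u s)
  zero : Tendsto u (𝓝[>] 0) (𝓝 0)
  u_left : ∀ n, Tendsto u (𝓝[<] μ.t n) (𝓝 (a n 0 - x n 1 / 2))
  u_right : ∀ n, Tendsto u (𝓝[>] μ.t n) (𝓝 (a n 0 + x n 1 / 2))
  v_left : ∀ n, Tendsto v (𝓝[<] μ.t n) (𝓝 (a n 1 + x n 0 / 2))
  v_right : ∀ n, Tendsto v (𝓝[>] μ.t n) (𝓝 (a n 1 - x n 0 / 2))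

section JumpSolution

variable {J : Type*} {μ : AtomicMeasure J} {k : ℂ}

/-- Averages are the left limits plus half the jumps; they are square summable because the left
limits are, by the trace estimates. -/
lemma JumpSolution.of_traces {x : TraceSpace J} {u v : ℝ → ℂ}
    (hH : IsH2 (range μ.t) u v (fun s => -k ^ 2 * u s)) (h0 : Tendsto u (𝓝[>] 0) (𝓝 0))
    {A B : J → ℂ} (huL : ∀ n, Tendsto u (𝓝[<] μ.t n) (𝓝 (A n)))
    (huR : ∀ n, Tendsto u (𝓝[>] μ.t n) (𝓝 (A n + x n 1)))
    (hvL : ∀ n, Tendsto v (𝓝[<] μ.t n) (𝓝 (B n)))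
    (hvR : ∀ n, Tendsto v (𝓝[>] μ.t n) (𝓝 (B n - x n 0))) :
    ∃ a, JumpSolution μ k x a u v := by
  have hA := hH.isH1.summable_norm_sq_left huL
  have hB := hH.isH1'.summable_norm_sq_left hvL
  have hx0 : Summable fun n => ‖-x n 0‖ ^ 2 := by simpa using x.summable_norm_sq 0
  set a : TraceSpace J := traceOf A B hA hB + (1 / 2 : ℂ) • traceOf _ _ (x.summable_norm_sq 1) hx0
  have ha0 : ∀ n, a n 0 = A n + x n 1 / 2 := fun n => by
    have : a n = traceOf A B hA hB n + (1 / 2 : ℂ) •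
      traceOf _ _ (x.summable_norm_sq 1) hx0 n := rfl
    rw [this, traceOf_apply, traceOf_apply]
    simp
    ring
  have ha1 : ∀ n, a n 1 = B n - x n 0 / 2 := fun n => by
    have : a n = traceOf A B hA hB n + (1 / 2 : ℂ) •
      traceOf _ _ (x.summable_norm_sq 1) hx0 n := rfl
    rw [this, traceOf_apply, traceOf_apply]
    simp
    ring
  refine ⟨a, hH, h0, fun n => ?_, fun n => ?_, fun n => ?_, fun n => ?_⟩
  · rw [ha0]; convert huL n using 2; ring
  · rw [ha0]; convert huR n using 2; ring
  · rw [ha1]; convert hvL n using 2; ring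
  · rw [ha1]; convert hvR n using 2; ring

/-- Forward waves of the two different wave numbers k and 2k can produce arbitrary jumps of u and u'
simultaneously. The waves with 2k solve the wrong equation; the error is removed by a Dirichlet
solution that is smooth across the points. -/
lemma exists_jumpSolution (μ : AtomicMeasure J) (hk : 0 < k.im) (x : TraceSpace J) :
    ∃ a u v, JumpSolution μ k x a u v := by
  have hk0 : k ≠ 0 := norm_pos_iff.1 (norm_pos_of_im_pos hk)
  have h2k : 0 < (2 * k).im := by simpa using hk
  set α : ℂ := (Complex.I * k)⁻¹
  have hα : Complex.I * k * α = 1 := mul_inv_cancel₀ (mul_ne_zero Complex.I_ne_zero hk0)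
  -- y and y' solve y + y' = x₁ and ik·y + 2ik·y' = -x₀.
  set y : J → ℂ := fun n => 2 * x n 1 + α * x n 0
  set y' : J → ℂ := fun n => -(α * x n 0) - x n 1
  have hsum : ∀ (p q : ℂ), Summable fun n => ‖p * x n 1 + q * x n 0‖ ^ 2 := fun p q => by
    refine Summable.of_nonneg_of_le (fun _ => sq_nonneg _) (fun n => ?_)
      (((x.summable_norm_sq 1).mul_left (2 * ‖p‖ ^ 2)).add
        ((x.summable_norm_sq 0).mul_left (2 * ‖q‖ ^ 2)))
    have h1 : ‖p * x n 1 + q * x n 0‖ ≤ ‖p‖ * ‖x n 1‖ + ‖q‖ * ‖x n 0‖ :=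
      (norm_add_le _ _).trans_eq (by rw [norm_mul, norm_mul])
    have h2 : ‖p * x n 1 + q * x n 0‖ ^ 2 ≤ (‖p‖ * ‖x n 1‖ + ‖q‖ * ‖x n 0‖) ^ 2 := by gcongr
    nlinarith [sq_nonneg (‖p‖ * ‖x n 1‖ - ‖q‖ * ‖x n 0‖)]
  have hy : Summable fun n => ‖y n‖ ^ 2 := hsum 2 α
  have hy' : Summable fun n => ‖y' n‖ ^ 2 :=
    (hsum (-1) (-α)).congr fun n => by simp only [y']; congr 2; ring
  set D := decaySum μ k y
  set D' := decaySum μ (2 * k) y'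
  have hD := isH2_decaySum μ hk hy
  have hD' := isH2_decaySum μ h2k hy'
  -- D'' has -(2k)²D' in place of -k²D' on its right-hand side (D' being the 2k sum); the difference
  -- is -3k²D'.
  obtain ⟨u₀, v₀, hH, h0⟩ := exists_dirichlet_solution hk (hD'.memLp_u.const_mul (-3 * k ^ 2))
  have hHS := hH.mono (empty_subset (range μ.t))
  have hc : ∀ n, ContinuousAt u₀ (μ.t n) ∧ ContinuousAt v₀ (μ.t n) := fun n =>
    hH.continuousAt (μ.t_pos n)
  have hL : ∀ n, 𝓝[<] μ.t n ≤ 𝓝 (μ.t n) := fun n => nhdsWithin_le_nhds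
  have hR : ∀ n, 𝓝[>] μ.t n ≤ 𝓝 (μ.t n) := fun n => nhdsWithin_le_nhds
  obtain ⟨a, ha⟩ := JumpSolution.of_traces (μ := μ) (k := k) (x := x)
    (((hD.add hD').add hHS).congr_right (Eventually.of_forall fun s => by
      simp only [Pi.add_apply]; ring))
    (tendsto_add_zero (tendsto_add_zero (tendsto_decaySum_zero μ) (tendsto_decaySum_zero μ)) h0)
    (fun n => ((tendsto_decaySum_left μ n).add (tendsto_decaySum_left μ n)).add
      ((hc n).1.tendsto.mono_left (hL n)))
    (fun n => by
      have := ((tendsto_decaySum_right μ (c := k) (y := y) n).add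
        (tendsto_decaySum_right μ (c := 2 * k) (y := y') n)).add
          ((hc n).1.tendsto.mono_left (hR n))
      refine this.mono_right (le_of_eq (congrArg _ ?_))
      simp only [y, y']
      ring)
    (fun n => (((tendsto_decaySum_left μ n).const_mul _).add
      ((tendsto_decaySum_left μ n).const_mul _)).add ((hc n).2.tendsto.mono_left (hL n)))
    (fun n => by
      have := (((tendsto_decaySum_right μ (c := k) (y := y) n).const_mul (Complex.I * k)).add
        ((tendsto_decaySum_right μ (c := 2 * k) (y := y') n).const_mul (Complex.I * (2 * k)))).add
          ((hc n).2.tendsto.mono_left (hR n))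
      refine this.mono_right (le_of_eq (congrArg _ ?_))
      simp only [y, y']
      linear_combination (-x n 0) * hα)
  exact ⟨a, _, _, ha⟩

end JumpSolution

/-! ### Jumps controlled by the quadratic form, and reciprocity of solutions -/

section Bounds

variable {J : Type*} {μ : AtomicMeasure J} {k : ℂ} {x a x' a' : TraceSpace J}
  {u v u' v' : ℝ → ℂ}

lemma norm_tsum_le_norm_mul_norm {c : J → ℂ} (x y : TraceSpace J)
    (h : ∀ n, ‖c n‖ ≤ ‖x n‖ * ‖y n‖) : ‖∑' n, c n‖ ≤ ‖x‖ * ‖y‖ := by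
  have h2 : (2 : ℝ≥0∞).toReal.HolderConjugate (2 : ℝ≥0∞).toReal := by
    rw [Real.holderConjugate_iff]; norm_num
  have hs := lp.summable_mul h2 x y
  have hs' : Summable fun n => ‖c n‖ := Summable.of_nonneg_of_le (fun _ => norm_nonneg _) h hs
  exact (norm_tsum_le_tsum_norm hs').trans
    ((hs'.tsum_le_tsum h hs).trans (lp.tsum_mul_le_mul_norm' h2 x y))

lemma norm_conj_mul_sub_le (x y : EuclideanSpace ℂ (Fin 2)) :
    ‖starRingEnd ℂ (x 1) * y 1 - starRingEnd ℂ (y 0) * x 0‖ ≤ ‖x‖ * ‖y‖ := by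
  have h1 : ‖starRingEnd ℂ (x 1) * y 1 - starRingEnd ℂ (y 0) * x 0‖ ≤
      ‖x 1‖ * ‖y 1‖ + ‖y 0‖ * ‖x 0‖ :=
    (norm_sub_le _ _).trans_eq (by simp)
  refine h1.trans (abs_le_of_sq_le_sq' ?_ (by positivity)).2
  rw [mul_pow, norm_sq_eq_add, norm_sq_eq_add]
  nlinarith [sq_nonneg (‖x 1‖ * ‖y 0‖ - ‖y 1‖ * ‖x 0‖)]

/-- The constant bounding the jumps and the averages of a solution by the quadratic form. -/
noncomputable def jumpConst (μ : AtomicMeasure J) (k : ℂ) : ℝ :=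
  4 * μ.traceConst * (2 + 2 * ‖k‖ ^ 4) * formConst k

lemma jumpConst_pos (μ : AtomicMeasure J) (hk : 0 < k.im) : 0 < jumpConst μ k := by
  have := μ.traceConst_pos
  have := formConst_pos hk
  unfold jumpConst
  positivity

/-- The boundary terms [ū u'], expressed through jumps and averages, are the terms of this series.
-/
lemma JumpSolution.energy_le (h : JumpSolution μ k x a u v) (hk : 0 < k.im) :
    energy u v ≤ formConst k *
      ‖∑' n, (starRingEnd ℂ (x n 1) * a n 1 - starRingEnd ℂ (a n 0) * x n 0)‖ := by
  have h1 := (h.isH2.hasSum_form h.zero h.u_left h.u_right h.v_left h.v_right).tsum_eq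
  have h2 := energy_le_form hk h.isH2.memLp_u h.isH2.memLp_v
  rw [← norm_neg, ← h1] at h2
  refine h2.trans_eq ?_
  congr 3
  ext n
  have h3 : starRingEnd ℂ (2 : ℂ) = 2 := Complex.conj_ofNat 2
  simp only [map_add, map_sub, map_div₀, h3]
  ring

/-- The jumps are differences of one-sided limits, whose square sums the trace estimates bound by
the energies of u and u'. The energy of u' reduces to that of u by the differential equation, and
the latter to the boundary terms. -/
lemma JumpSolution.norm_sq_le (h : JumpSolution μ k x a u v) (hk : 0 < k.im) :
    ‖x‖ ^ 2 ≤ jumpConst μ k *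
      ‖∑' n, (starRingEnd ℂ (x n 1) * a n 1 - starRingEnd ℂ (a n 0) * x n 0)‖ := by
  set D := ‖∑' n, (starRingEnd ℂ (x n 1) * a n 1 - starRingEnd ℂ (a n 0) * x n 0)‖
  have hE : energy u v ≤ formConst k * D := h.energy_le hk
  have hE' : energy v (fun s => -k ^ 2 * u s) ≤ (1 + 2 * ‖k‖ ^ 4) * energy u v := by
    have := energy_deriv_le (k := k) (g := 0) h.isH2.memLp_u h.isH2.memLp_v MemLp.zero
    simpa using this
  have ht := μ.traceConst_pos
  set E := energy u v
  set E' := energy v (fun s => -k ^ 2 * u s)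
  have hC : 4 * μ.traceConst * (E + E') ≤ jumpConst μ k * D := by
    calc 4 * μ.traceConst * (E + E') ≤ 4 * μ.traceConst * ((2 + 2 * ‖k‖ ^ 4) * E) := by
          gcongr; linarith
      _ ≤ 4 * μ.traceConst * ((2 + 2 * ‖k‖ ^ 4) * (formConst k * D)) := by gcongr
      _ = _ := by rw [jumpConst]; ring
  have b1 := h.isH2.isH1.sum_norm_sq_left_le h.u_left
  have b2 := h.isH2.isH1.sum_norm_sq_right_le h.u_right
  have b3 := h.isH2.isH1'.sum_norm_sq_left_le h.v_left
  have b4 := h.isH2.isH1'.sum_norm_sq_right_le h.v_right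
  -- The parallelogram law turns the sum over both sides of a point into averages and jumps;
  -- dropping the averages leaves half of ‖x‖², whence the 4 in `jumpConst`.
  have hpar : ∀ c d : ℂ, ‖c - d / 2‖ ^ 2 + ‖c + d / 2‖ ^ 2 = 2 * ‖c‖ ^ 2 + ‖d‖ ^ 2 / 2 := by
    intro c d
    simp only [← Complex.normSq_eq_norm_sq, Complex.normSq_apply, Complex.sub_re, Complex.sub_im,
      Complex.add_re, Complex.add_im, Complex.div_ofNat_re, Complex.div_ofNat_im]
    ring
  have key : ∀ s : Finset J, ∑ n ∈ s, (2 * ‖a n‖ ^ 2 + ‖x n‖ ^ 2 / 2) ≤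
      2 * μ.traceConst * (E + E') := by
    intro s
    have e : ∀ n, 2 * ‖a n‖ ^ 2 + ‖x n‖ ^ 2 / 2 = (‖a n 0 - x n 1 / 2‖ ^ 2 +
        ‖a n 0 + x n 1 / 2‖ ^ 2) + (‖a n 1 + x n 0 / 2‖ ^ 2 + ‖a n 1 - x n 0 / 2‖ ^ 2) := by
      intro n
      rw [hpar, add_comm (‖a n 1 + x n 0 / 2‖ ^ 2), hpar, norm_sq_eq_add, norm_sq_eq_add]
      ring
    simp_rw [e, Finset.sum_add_distrib]
    linarith [b1 s, b2 s, b3 s, b4 s]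
  refine hasSum_le_of_sum_le x.hasSum_norm_sq fun s => le_trans ?_ hC
  have := key s
  rw [Finset.sum_add_distrib, ← Finset.mul_sum, ← Finset.sum_div] at this
  have h0 : 0 ≤ ∑ n ∈ s, ‖a n‖ ^ 2 := Finset.sum_nonneg fun _ _ => sq_nonneg _
  linarith

/-- Green's formula for two piecewise `H²` functions. -/
lemma IsH2.hasSum_wronskian {w w' : ℝ → ℂ} (h : IsH2 (range μ.t) u v w)
    (h' : IsH2 (range μ.t) u' v' w') {u0 v0 u0' v0' : ℂ}
    (hu0 : Tendsto u (𝓝[>] 0) (𝓝 u0)) (hv0 : Tendsto v (𝓝[>] 0) (𝓝 v0))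
    (hu0' : Tendsto u' (𝓝[>] 0) (𝓝 u0')) (hv0' : Tendsto v' (𝓝[>] 0) (𝓝 v0'))
    {uL uR vL vR uL' uR' vL' vR' : J → ℂ}
    (huL : ∀ n, Tendsto u (𝓝[<] μ.t n) (𝓝 (uL n))) (huR : ∀ n, Tendsto u (𝓝[>] μ.t n) (𝓝 (uR n)))
    (hvL : ∀ n, Tendsto v (𝓝[<] μ.t n) (𝓝 (vL n))) (hvR : ∀ n, Tendsto v (𝓝[>] μ.t n) (𝓝 (vR n)))
    (huL' : ∀ n, Tendsto u' (𝓝[<] μ.t n) (𝓝 (uL' n)))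
    (huR' : ∀ n, Tendsto u' (𝓝[>] μ.t n) (𝓝 (uR' n)))
    (hvL' : ∀ n, Tendsto v' (𝓝[<] μ.t n) (𝓝 (vL' n)))
    (hvR' : ∀ n, Tendsto v' (𝓝[>] μ.t n) (𝓝 (vR' n))) :
    HasSum (fun n => (uR n * vR' n - uL n * vL' n) - (vR n * uR' n - vL n * uL' n))
      (-(u0 * v0' - v0 * u0') - ∫ s in Ioi 0, (u s * w' s - w s * u' s)) := by
  have h1 := h.isH1.hasSum_jumps h'.isH1' huL huR hu0 hvL' hvR' hv0'
  have h2 := h.isH1'.hasSum_jumps h'.isH1 hvL hvR hv0 huL' huR' hu0'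
  have := h1.sub h2
  convert! this using 1
  have e : ∫ s in Ioi 0, (u s * w' s - w s * u' s) = (∫ s in Ioi 0, (v s * v' s + u s * w' s)) -
      ∫ s in Ioi 0, (w s * u' s + v s * v' s) := by
    rw [← integral_sub (h.isH1.integrable_mul h'.isH1') (h.isH1'.integrable_mul h'.isH1)]
    refine integral_congr_ae (Eventually.of_forall fun s => ?_)
    simp only
    ring
  rw [e]
  ring

/-- The relation between the jumps and averages of two solutions. -/
lemma JumpSolution.hasSum_reciprocity (h : JumpSolution μ k x a u v)
    (h' : JumpSolution μ k x' a' u' v') :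
    HasSum (fun n => (x n 0 * a' n 0 + x n 1 * a' n 1) - (x' n 0 * a n 0 + x' n 1 * a n 1)) 0 := by
  obtain ⟨v0, hv0⟩ := h.isH2.isH1'.exists_tendsto_zero
  obtain ⟨v0', hv0'⟩ := h'.isH2.isH1'.exists_tendsto_zero
  have := h.isH2.hasSum_wronskian h'.isH2 h.zero hv0 h'.zero hv0' h.u_left h.u_right h.v_left
    h.v_right h'.u_left h'.u_right h'.v_left h'.v_right
  convert! this using 1
  · ext n; ring
  -- Both functions solve the same equation, so the Wronskian has no bulk term; the boundary term at
  -- 0 vanishes by the Dirichlet condition.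
  · have e : ∀ s, u s * (-k ^ 2 * u' s) - -k ^ 2 * u s * u' s = 0 := fun s => by ring
    simp_rw [e]
    simp

end Bounds

/-! ### Green's function -/

lemma isH2_exp {k : ℂ} (hk : 0 < k.im) :
    IsH2 ∅ (fun s : ℝ => Complex.exp (Complex.I * k * s))
      (fun s => Complex.I * k * Complex.exp (Complex.I * k * s))
      (fun s => -k ^ 2 * Complex.exp (Complex.I * k * s)) where
  memLp_u := memLp_exp hk
  memLp_v := (memLp_exp hk).const_mul _
  memLp_w := (memLp_exp hk).const_mul _
  hasDerivAt x _ := hasDerivAt_exp_mul _ x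
  integral_eq x y _ _ := by
    refine intervalIntegral.integral_eq_sub_of_hasDerivAt
      (f := fun s : ℝ => Complex.I * k * Complex.exp (Complex.I * k * s)) (fun s _ => ?_)
      (Continuous.intervalIntegrable (by fun_prop) _ _)
    have := (hasDerivAt_exp_mul (Complex.I * k) s).const_mul (Complex.I * k)
    convert! this using 1
    linear_combination (-k ^ 2 * Complex.exp (Complex.I * k * s)) * Complex.I_sq

/-- The function equal to `α e^{ik(p - s)}` for `s < p` and to `β e^{ik(s - p)}` for `s ≥ p`. -/
noncomputable def tent (k : ℂ) (p : ℝ) (α β : ℂ) (s : ℝ) : ℂ :=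
  if s < p then α * Complex.exp (Complex.I * k * (p - s : ℝ))
  else β * Complex.exp (Complex.I * k * (s - p : ℝ))

/-- The left limits of `tent`. -/
noncomputable def tentLeft (k : ℂ) (p : ℝ) (α β : ℂ) (s : ℝ) : ℂ :=
  if s ≤ p then α * Complex.exp (Complex.I * k * (p - s : ℝ))
  else β * Complex.exp (Complex.I * k * (s - p : ℝ))

section Tent

variable {k α β : ℂ} {p : ℝ}

lemma tendsto_tent_left (s : ℝ) :
    Tendsto (tent k p α β) (𝓝[<] s) (𝓝 (tentLeft k p α β s)) := by
  have c1 : Continuous fun s : ℝ => α * Complex.exp (Complex.I * k * (p - s : ℝ)) := by fun_prop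
  have c2 : Continuous fun s : ℝ => β * Complex.exp (Complex.I * k * (s - p : ℝ)) := by fun_prop
  unfold tentLeft
  split_ifs with h
  · refine ((c1.tendsto s).mono_left nhdsWithin_le_nhds).congr' ?_
    filter_upwards [self_mem_nhdsWithin] with r hr
    exact (if_pos (lt_of_lt_of_le hr h)).symm
  · refine ((c2.tendsto s).mono_left nhdsWithin_le_nhds).congr' ?_
    filter_upwards [Ioo_mem_nhdsLT (not_le.1 h)] with r hr
    exact (if_neg hr.1.le.not_gt).symm

lemma tendsto_tent_right (s : ℝ) :
    Tendsto (tent k p α β) (𝓝[>] s) (𝓝 (tent k p α β s)) := by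
  have c1 : Continuous fun s : ℝ => α * Complex.exp (Complex.I * k * (p - s : ℝ)) := by fun_prop
  have c2 : Continuous fun s : ℝ => β * Complex.exp (Complex.I * k * (s - p : ℝ)) := by fun_prop
  unfold tent
  split_ifs with h
  · refine ((c1.tendsto s).mono_left nhdsWithin_le_nhds).congr' ?_
    filter_upwards [Ioo_mem_nhdsGT h] with r hr
    exact (if_pos hr.2).symm
  · refine ((c2.tendsto s).mono_left nhdsWithin_le_nhds).congr' ?_
    filter_upwards [self_mem_nhdsWithin] with r hr
    exact (if_neg (fun h' => h (lt_trans hr h'))).symm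

lemma hasDerivAt_tent {s : ℝ} (hs : s ≠ p) :
    HasDerivAt (tent k p α β) (tent k p (-(Complex.I * k * α)) (Complex.I * k * β) s) s := by
  have d1 : HasDerivAt (fun s : ℝ => α * Complex.exp (Complex.I * k * (p - s : ℝ)))
      (-(Complex.I * k * α) * Complex.exp (Complex.I * k * (p - s : ℝ))) s := by
    have := (((hasDerivAt_exp_mul (Complex.I * k) (p - s)).comp_const_sub p s)).const_mul α
    convert! this using 1
    ring
  have d2 : HasDerivAt (fun s : ℝ => β * Complex.exp (Complex.I * k * (s - p : ℝ)))
      (Complex.I * k * β * Complex.exp (Complex.I * k * (s - p : ℝ))) s := by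
    have := (((hasDerivAt_exp_mul (Complex.I * k) (s - p)).comp_sub_const s p)).const_mul β
    convert! this using 1
    ring
  rcases lt_or_gt_of_ne hs with h | h
  · rw [tent, if_pos h]
    refine d1.congr_of_eventuallyEq ?_
    filter_upwards [Iio_mem_nhds h] with r hr using if_pos hr
  · rw [tent, if_neg h.not_gt]
    refine d2.congr_of_eventuallyEq ?_
    filter_upwards [Ioi_mem_nhds h] with r hr using if_neg (not_lt.2 (le_of_lt hr))

lemma memLp_tent (hk : 0 < k.im) : MemLp (tent k p α β) 2 ν₊ := by
  have hm : Measurable (tent k p α β) :=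
    Measurable.ite measurableSet_Iio (by fun_prop) (by fun_prop)
  refine ((memLp_exp hk).const_mul
    (((‖α‖ * Real.exp (|k.im * p| + |k.im * p|) + ‖β‖ * Real.exp (k.im * p) : ℝ)) : ℂ)).mono
    hm.aestronglyMeasurable ?_
  filter_upwards [ae_restrict_mem measurableSet_Ioi] with s hs
  rw [norm_mul, norm_exp_I_mul, Complex.norm_real, Real.norm_of_nonneg (by positivity), add_mul]
  unfold tent
  split_ifs with h
  · rw [norm_mul, norm_exp_I_mul]
    refine le_add_of_le_of_nonneg ?_ (by positivity)
    rw [mul_assoc, ← Real.exp_add]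
    refine mul_le_mul_of_nonneg_left (Real.exp_le_exp.2 ?_) (norm_nonneg _)
    linarith [le_abs_self (k.im * p), mul_lt_mul_of_pos_left h hk, abs_nonneg (k.im * p)]
  · rw [norm_mul, norm_exp_I_mul]
    refine le_add_of_nonneg_of_le (by positivity) ?_
    rw [mul_assoc, ← Real.exp_add]
    refine mul_le_mul_of_nonneg_left (Real.exp_le_exp.2 ?_) (norm_nonneg _)
    linarith

lemma const_mul_tent (c : ℂ) (s : ℝ) : c * tent k p α β s = tent k p (c * α) (c * β) s := by
  unfold tent
  split_ifs <;> ring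

lemma isH2_tent (hk : 0 < k.im) : IsH2 {p} (tent k p α β)
    (tent k p (-(Complex.I * k * α)) (Complex.I * k * β)) (fun s => -k ^ 2 * tent k p α β s) where
  memLp_u := memLp_tent hk
  memLp_v := memLp_tent hk
  memLp_w := (memLp_tent hk).const_mul _
  hasDerivAt x hx := hasDerivAt_tent hx.2
  integral_eq x y hxy hI := by
    refine intervalIntegral.integral_eq_sub_of_hasDerivAt (fun s hs => ?_)
      (intervalIntegrable_of_memLp hxy ((memLp_tent hk).const_mul (-k ^ 2))
        (hI.trans sdiff_subset))
    rw [uIcc_of_le hxy] at hs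
    have := hasDerivAt_tent (k := k) (α := -(Complex.I * k * α)) (β := Complex.I * k * β)
      (hI hs).2
    convert! this using 1
    rw [const_mul_tent]
    congr 1
    · linear_combination (-k ^ 2 * α) * Complex.I_sq
    · linear_combination (-k ^ 2 * β) * Complex.I_sq

end Tent

/-! ### Green's function and the entries of T(z) -/

section TMatrix

variable {J : Type*} {μ : AtomicMeasure J} {k : ℂ}

lemma tent_eq_tentLeft_add (k : ℂ) (p : ℝ) (α β : ℂ) (s : ℝ) :
    tent k p α β s = tentLeft k p α β s + if s = p then β - α else 0 := by
  unfold tent tentLeft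
  rcases lt_trichotomy s p with h | h | h
  · rw [if_pos h, if_pos h.le, if_neg h.ne, add_zero]
  · subst h; simp
  · rw [if_neg h.not_gt, if_neg h.not_ge, if_neg h.ne', add_zero]

/-- The tent carries the jumps β - α of u and ik(α + β) of u' at t_m. The term with γ is the wave
reflected at 0, with amplitude chosen to make the sum vanish there. -/
lemma exists_jumpSolution_tent (hk : 0 < k.im) (m : J) (α β γ : ℂ) (x : TraceSpace J)
    (hγ : γ = -(α * Complex.exp (Complex.I * k * μ.t m)))
    (hxm : x m = !₂[-(Complex.I * k * (α + β)), β - α]) (hx : ∀ n, n ≠ m → x n = 0) :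
    ∃ a u v, JumpSolution μ k x a u v ∧ ∀ n,
      a n 0 = (tentLeft k (μ.t m) α β (μ.t n) + tent k (μ.t m) α β (μ.t n)) / 2 +
        γ * Complex.exp (Complex.I * k * μ.t n) ∧
      a n 1 = (tentLeft k (μ.t m) (-(Complex.I * k * α)) (Complex.I * k * β) (μ.t n) +
        tent k (μ.t m) (-(Complex.I * k * α)) (Complex.I * k * β) (μ.t n)) / 2 +
        γ * (Complex.I * k * Complex.exp (Complex.I * k * μ.t n)) := by
  have hH : IsH2 (range μ.t) _ _ _ :=
    ((isH2_tent (α := α) (β := β) (p := μ.t m) hk).mono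
      (singleton_subset_iff.2 (mem_range_self m))).add
    (((isH2_exp hk).mono (empty_subset _)).smul γ)
  have hc : ∀ s (l : Filter ℝ), l ≤ 𝓝 s → Tendsto (γ • fun s : ℝ => Complex.exp (Complex.I * k * s))
      l (𝓝 (γ * Complex.exp (Complex.I * k * s))) := fun s l hl =>
    (Continuous.tendsto (f := fun s : ℝ => γ * Complex.exp (Complex.I * k * s))
      (by fun_prop) s).mono_left hl
  have hc' : ∀ s (l : Filter ℝ), l ≤ 𝓝 s →
      Tendsto (γ • fun s : ℝ => Complex.I * k * Complex.exp (Complex.I * k * s))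
      l (𝓝 (γ * (Complex.I * k * Complex.exp (Complex.I * k * s)))) := fun s l hl =>
    (Continuous.tendsto (f := fun s : ℝ => γ * (Complex.I * k * Complex.exp (Complex.I * k * s)))
      (by fun_prop) s).mono_left hl
  have hL : ∀ n, 𝓝[<] μ.t n ≤ 𝓝 (μ.t n) := fun n => nhdsWithin_le_nhds
  have hR : ∀ n, 𝓝[>] μ.t n ≤ 𝓝 (μ.t n) := fun n => nhdsWithin_le_nhds
  obtain ⟨a, ha⟩ := JumpSolution.of_traces (μ := μ) (k := k) (x := x)
    (hH.congr_right (Eventually.of_forall fun s => by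
      simp only [Pi.add_apply, Pi.smul_apply, smul_eq_mul]; ring))
    (by
      have := (tendsto_tent_right (k := k) (p := μ.t m) (α := α) (β := β) 0).add
        (hc 0 (𝓝[>] 0) nhdsWithin_le_nhds)
      refine this.mono_right (le_of_eq (congrArg _ ?_))
      rw [tent, if_pos (μ.t_pos m), hγ]
      simp)
    (fun n => (tendsto_tent_left (μ.t n)).add (hc _ _ (hL n)))
    (fun n => by
      refine ((tendsto_tent_right (μ.t n)).add (hc _ _ (hR n))).mono_right
        (le_of_eq (congrArg _ ?_))
      rw [tent_eq_tentLeft_add]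
      by_cases h : n = m
      · subst h; rw [hxm, if_pos rfl]; simp; ring
      · rw [hx n h, if_neg fun e => h (μ.injective_t e)]; simp)
    (fun n => (tendsto_tent_left (μ.t n)).add (hc' _ _ (hL n)))
    (fun n => by
      refine ((tendsto_tent_right (μ.t n)).add (hc' _ _ (hR n))).mono_right
        (le_of_eq (congrArg _ ?_))
      rw [tent_eq_tentLeft_add]
      by_cases h : n = m
      · subst h; rw [hxm, if_pos rfl]; simp; ring
      · rw [hx n h, if_neg fun e => h (μ.injective_t e)]; simp)
  refine ⟨a, _, _, ha, fun n => ⟨?_, ?_⟩⟩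
  · have e1 := tendsto_nhds_unique (ha.u_left n) ((tendsto_tent_left (μ.t n)).add (hc _ _ (hL n)))
    have e2 := tendsto_nhds_unique (ha.u_right n)
      ((tendsto_tent_right (μ.t n)).add (hc _ _ (hR n)))
    linear_combination (e1 + e2) / 2
  · have e1 := tendsto_nhds_unique (ha.v_left n) ((tendsto_tent_left (μ.t n)).add (hc' _ _ (hL n)))
    have e2 := tendsto_nhds_unique (ha.v_right n)
      ((tendsto_tent_right (μ.t n)).add (hc' _ _ (hR n)))
    linear_combination (e1 + e2) / 2

/-- The mean of the one-sided limits of `tent`. -/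
lemma tentLeft_add_tent (k : ℂ) (p : ℝ) (α β : ℂ) (s : ℝ) :
    (tentLeft k p α β s + tent k p α β s) / 2 = ((α + β) / 2 +
      ((SignType.sign (s - p) : ℝ) : ℂ) * ((β - α) / 2)) *
        Complex.exp (Complex.I * k * (|s - p| : ℝ)) := by
  unfold tent tentLeft
  rcases lt_trichotomy s p with h | h | h
  · rw [if_pos h, if_pos h.le, sign_neg (sub_neg.2 h), abs_of_neg (sub_neg.2 h), neg_sub]
    simp only [SignType.coe_one, SignType.coe_neg]
    push_cast
    ring
  · subst h; simp
  · rw [if_neg h.not_gt, if_neg h.not_ge, sign_pos (sub_pos.2 h), abs_of_pos (sub_pos.2 h)]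
    simp only [SignType.coe_one]
    push_cast
    ring

open Classical in
/-- The solution with a unit jump at one point is given by Green's function. -/
lemma exists_jumpSolution_single (μ : AtomicMeasure J) {z : ℂ} (hk : 0 < (momentum z).im) (m : J)
    (j : Fin 2) :
    ∃ a u v, JumpSolution μ (momentum z)
      (lp.single (E := fun _ : J => EuclideanSpace ℂ (Fin 2)) 2 m (EuclideanSpace.single j 1)) a u v ∧
      ∀ n i, a n i = -μ.tMatrix z n m i j := by
  set k := momentum z with hkz
  have hk0 : k ≠ 0 := norm_pos_iff.1 (norm_pos_of_im_pos hk)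
  have hI := Complex.I_ne_zero
  have hsum : ∀ n, Complex.exp (Complex.I * k * (μ.t n + μ.t m : ℝ)) =
      Complex.exp (Complex.I * k * μ.t m) * Complex.exp (Complex.I * k * μ.t n) := fun n => by
    rw [← Complex.exp_add]; congr 1; push_cast; ring
  fin_cases j
  -- Equal one-sided amplitudes make u continuous, and -1/(2ik) gives [u'] = -1.
  · obtain ⟨a, u, v, h, ha⟩ := exists_jumpSolution_tent (μ := μ) hk m (-(2 * Complex.I * k)⁻¹)
      (-(2 * Complex.I * k)⁻¹) _ (lp.single (E := fun _ : J => EuclideanSpace ℂ (Fin 2)) 2 m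
        (EuclideanSpace.single 0 1)) rfl
      (by rw [lp.single_apply_self]; ext i; fin_cases i <;> simp; field_simp; norm_num)
      (fun n hn => lp.single_apply_ne _ _ _ hn)
    refine ⟨a, u, v, h, fun n i => ?_⟩
    fin_cases i
    · refine (ha n).1.trans ?_
      rw [tentLeft_add_tent]
      simp only [AtomicMeasure.tMatrix, ← hkz, hsum]
      simp
      field_simp
      ring
    · refine (ha n).2.trans ?_
      rw [tentLeft_add_tent]
      simp only [AtomicMeasure.tMatrix, ← hkz, hsum]
      simp
      field_simp
      rw [Complex.I_sq]
      ring
  -- Opposite amplitudes make u' continuous, and ±1/2 gives [u] = 1.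
  · obtain ⟨a, u, v, h, ha⟩ := exists_jumpSolution_tent (μ := μ) hk m (-(1 / 2)) (1 / 2) _
      (lp.single (E := fun _ : J => EuclideanSpace ℂ (Fin 2)) 2 m
        (EuclideanSpace.single 1 1)) rfl
      (by rw [lp.single_apply_self]; ext i; fin_cases i <;> simp; norm_num)
      (fun n hn => lp.single_apply_ne _ _ _ hn)
    refine ⟨a, u, v, h, fun n i => ?_⟩
    fin_cases i
    · refine (ha n).1.trans ?_
      rw [tentLeft_add_tent]
      simp only [AtomicMeasure.tMatrix, ← hkz, hsum]
      simp
      ring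
    · refine (ha n).2.trans ?_
      rw [tentLeft_add_tent]
      simp only [AtomicMeasure.tMatrix, ← hkz, hsum]
      simp
      ring

end TMatrix

/-! ### The operators `T(z)` and `B` -/

section Matrices

variable {J : Type*} {μ : AtomicMeasure J} {z : ℂ} {x a y : TraceSpace J} {u v : ℝ → ℂ}

lemma toEuclideanLin_apply_two (M : Matrix (Fin 2) (Fin 2) ℂ) (w : EuclideanSpace ℂ (Fin 2))
    (i : Fin 2) : Matrix.toEuclideanLin M w i = M i 0 * w 0 + M i 1 * w 1 := by
  have h : Matrix.toEuclideanLin M w = WithLp.toLp 2 (M.mulVec w.ofLp) := rfl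
  rw [h, PiLp.toLp_apply, Matrix.mulVec, dotProduct, Fin.sum_univ_two]

lemma hasSum_euclidean_iff {ι : Type*} {f : ι → EuclideanSpace ℂ (Fin 2)}
    {b : EuclideanSpace ℂ (Fin 2)} : HasSum f b ↔ ∀ i, HasSum (fun n => f n i) (b i) := by
  have h := (EuclideanSpace.equiv (Fin 2) ℂ).hasSum (f := f)
    (L := .unconditional _) (y := EuclideanSpace.equiv (Fin 2) ℂ b)
  rw [ContinuousLinearEquiv.symm_apply_apply] at h
  rw [← h, Pi.hasSum]
  rfl

/-- T(z) is symmetric without conjugation, so pairing x with a column is applying a row to x. -/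
lemma tMatrix_transpose (μ : AtomicMeasure J) (z : ℂ) (n m : J) (i j : Fin 2) :
    μ.tMatrix z n m i j = μ.tMatrix z m n j i := by
  have h : SignType.sign (μ.t n - μ.t m) = -SignType.sign (μ.t m - μ.t n) := by
    rw [← Left.sign_neg, neg_sub]
  simp only [AtomicMeasure.tMatrix, abs_sub_comm (μ.t n), add_comm (μ.t n), h, SignType.coe_neg]
  fin_cases i <;> fin_cases j <;> simp

open Classical in
lemma single_single_apply (m n : J) (j i : Fin 2) :
    lp.single (E := fun _ : J => EuclideanSpace ℂ (Fin 2)) 2 m (EuclideanSpace.single j 1) n i =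
      if n = m ∧ i = j then 1 else 0 := by
  rw [lp.single_apply]
  by_cases h : n = m
  · subst h; simp [Pi.single_eq_same, PiLp.single_apply]
  · simp [h]

open Classical in
lemma JumpSolution.hasSum_reciprocity_single {k : ℂ} {a' : TraceSpace J} {u' v' : ℝ → ℂ} {m : J}
    {j : Fin 2} (h : JumpSolution μ k x a u v) (h' : JumpSolution μ k
      (lp.single (E := fun _ : J => EuclideanSpace ℂ (Fin 2)) 2 m (EuclideanSpace.single j 1))
      a' u' v') :
    HasSum (fun n => x n 0 * a' n 0 + x n 1 * a' n 1) (a m j) := by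
  have h1 := (h.hasSum_reciprocity h').add (hasSum_ite_eq m (a m j))
  rw [zero_add] at h1
  refine h1.congr_fun fun n => ?_
  rw [single_single_apply, single_single_apply]
  by_cases hn : n = m
  · subst hn
    fin_cases j <;> simp
  · simp [hn]

/-- Reciprocity with the unit-jump solutions both proves convergence of the series for T(z)x and
evaluates it. No estimate of the matrix entries is needed, and T(z) is everywhere defined since
every x has a jump solution. -/
lemma JumpSolution.hasSum_tMatrix (hk : 0 < (momentum z).im)
    (h : JumpSolution μ (momentum z) x a u v) (m : J) :
    HasSum (fun n => Matrix.toEuclideanLin (μ.tMatrix z m n) (x n)) (-(a m)) := by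
  classical
  refine hasSum_euclidean_iff.2 fun j => ?_
  obtain ⟨a', u', v', h', ha'⟩ := exists_jumpSolution_single μ hk m j
  have h1 := (h.hasSum_reciprocity_single h').neg
  refine h1.congr_fun fun n => ?_
  rw [toEuclideanLin_apply_two, ha', ha', tMatrix_transpose μ z m n, tMatrix_transpose μ z m n]
  ring

lemma JumpSolution.mem_graph_T (hk : 0 < (momentum z).im)
    (h : JumpSolution μ (momentum z) x a u v) : (x, -a) ∈ (μ.T z).graph := by
  rw [AtomicMeasure.T, graph_blockOperator]
  exact fun m => h.hasSum_tMatrix hk m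

lemma T_domain_eq_top (μ : AtomicMeasure J) (hk : 0 < (momentum z).im) : (μ.T z).domain = ⊤ := by
  refine eq_top_iff.2 fun x _ => ?_
  obtain ⟨a, u, v, h⟩ := exists_jumpSolution μ hk x
  exact LinearPMap.mem_domain_of_mem_graph (h.mem_graph_T hk)

lemma mem_graph_B : (x, y) ∈ μ.B.graph ↔
    ∀ n, y n 0 = massOf (μ.b n) / 2 * x n 1 ∧ y n 1 = massOf (μ.b n) / 2 * x n 0 := by
  classical
  rw [AtomicMeasure.B, graph_blockOperator]
  refine forall_congr' fun n => ?_
  simp only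
  have h1 : HasSum (fun m => Matrix.toEuclideanLin (μ.bMatrix n m) (x m))
      (Matrix.toEuclideanLin (μ.bMatrix n n) (x n)) := by
    refine hasSum_single n fun m hm => ?_
    rw [AtomicMeasure.bMatrix, if_neg (Ne.symm hm)]
    simp
  have h2 : HasSum (fun m => Matrix.toEuclideanLin (μ.bMatrix n m) (x m)) (y n) ↔
      y n = Matrix.toEuclideanLin (μ.bMatrix n n) (x n) :=
    ⟨fun h => h.unique h1, fun h => h ▸ h1⟩
  rw [h2]
  have h3 : ∀ i, Matrix.toEuclideanLin (μ.bMatrix n n) (x n) i =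
      if i = 0 then massOf (μ.b n) / 2 * x n 1 else massOf (μ.b n) / 2 * x n 0 := by
    intro i
    rw [toEuclideanLin_apply_two, AtomicMeasure.bMatrix, if_pos rfl]
    fin_cases i <;> simp [div_eq_inv_mul]
  constructor
  · intro h
    exact ⟨by rw [h, h3]; simp, by rw [h, h3]; simp⟩
  · rintro ⟨h4, h5⟩
    ext i
    rw [h3]
    fin_cases i
    · simpa using h4
    · simpa using h5

lemma JumpSolution.mem_graph_T_add_B_iff (hk : 0 < (momentum z).im)
    (h : JumpSolution μ (momentum z) x a u v) : (x, y) ∈ (μ.T z + μ.B).graph ↔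
      ∀ n, y n 0 = massOf (μ.b n) / 2 * x n 1 - a n 0 ∧
        y n 1 = massOf (μ.b n) / 2 * x n 0 - a n 1 := by
  -- T(z) is defined at every x with value -a, so only the domain of B restricts the sum.
  have key : (x, y) ∈ (μ.T z + μ.B).graph ↔ (x, y + a) ∈ μ.B.graph := by
    constructor
    · intro hxy
      obtain ⟨f, hf1, hf2⟩ := (LinearPMap.mem_graph_iff _).1 hxy
      have e : (μ.T z + μ.B) f = μ.T z ⟨f, f.2.1⟩ + μ.B ⟨f, f.2.2⟩ := LinearPMap.add_apply _ _ _
      have h1 := (μ.T z).mem_graph ⟨f, f.2.1⟩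
      have h2 := μ.B.mem_graph ⟨f, f.2.2⟩
      simp only at hf1 hf2 h1 h2
      have h3 := LinearPMap.mem_graph_snd_inj _ h1 (h.mem_graph_T hk) hf1
      have h4 : y + a = μ.B ⟨f, f.2.2⟩ := by rw [← hf2, e, h3]; abel
      rw [h4]
      exact (congrArg (fun s => (s, μ.B ⟨f, f.2.2⟩) ∈ μ.B.graph) hf1).mp h2
    · intro hxy
      obtain ⟨f, hf1, hf2⟩ := (LinearPMap.mem_graph_iff _).1 hxy
      obtain ⟨f', hf1', hf2'⟩ := (LinearPMap.mem_graph_iff _).1 (h.mem_graph_T hk)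
      simp only at hf1 hf2 hf1' hf2'
      refine (LinearPMap.mem_graph_iff _).2 ⟨⟨x, hf1' ▸ f'.2, hf1 ▸ f.2⟩, rfl, ?_⟩
      rw [LinearPMap.add_apply]
      have e1 : μ.T z ⟨x, hf1' ▸ f'.2⟩ = -a := by
        rw [← hf2']; congr 1; exact Subtype.ext hf1'.symm
      have e2 : μ.B ⟨x, hf1 ▸ f.2⟩ = y + a := by
        rw [← hf2]; congr 1; exact Subtype.ext hf1.symm
      simp only [e1, e2]
      abel
  rw [key, mem_graph_B]
  refine forall_congr' fun n => ?_
  have e : ∀ i, (y + a) n i = y n i + a n i := fun i => rfl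
  rw [e, e, ← eq_sub_iff_add_eq, ← eq_sub_iff_add_eq]

/-- Substituting a = Bx - y into the boundary series, the two contributions of B cancel because the
mass is real. What remains pairs x with y, so the bound does not see the size of the masses. -/
lemma norm_le_of_mem_graph_T_add_B (hk : 0 < (momentum z).im)
    (hxy : (x, y) ∈ (μ.T z + μ.B).graph) : ‖x‖ ≤ jumpConst μ (momentum z) * ‖y‖ := by
  obtain ⟨a, u, v, h⟩ := exists_jumpSolution μ hk x
  have hy := (h.mem_graph_T_add_B_iff hk).1 hxy
  have h1 := h.norm_sq_le hk
  have h2 : ‖∑' n, (starRingEnd ℂ (x n 1) * a n 1 - starRingEnd ℂ (a n 0) * x n 0)‖ ≤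
      ‖x‖ * ‖y‖ := by
    refine norm_tsum_le_norm_mul_norm x y fun n => ?_
    obtain ⟨e1, e2⟩ := hy n
    have e3 := congrArg (starRingEnd ℂ) e1
    have h3 : starRingEnd ℂ (2 : ℂ) = 2 := Complex.conj_ofNat 2
    simp only [map_sub, map_mul, map_div₀, Complex.conj_ofReal, h3] at e3
    have e4 : -(starRingEnd ℂ (x n 1) * a n 1 - starRingEnd ℂ (a n 0) * x n 0) =
        starRingEnd ℂ (x n 1) * y n 1 - starRingEnd ℂ (y n 0) * x n 0 := by
      linear_combination (-starRingEnd ℂ (x n 1)) * e2 + x n 0 * e3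
    rw [← norm_neg, e4]
    exact norm_conj_mul_sub_le (x n) (y n)
  have hc := jumpConst_pos μ hk
  rcases (norm_nonneg x).eq_or_lt with h0 | h0
  · rw [← h0]; positivity
  · refine le_of_mul_le_mul_right ?_ h0
    calc ‖x‖ * ‖x‖ = ‖x‖ ^ 2 := (pow_two _).symm
      _ ≤ jumpConst μ (momentum z) * (‖x‖ * ‖y‖) := h1.trans (by gcongr)
      _ = _ := by ring

end Matrices

/-! ### Inversion of `T(z) + B` -/

section Inversion

variable {J : Type*} {μ : AtomicMeasure J} {z : ℂ}

lemma TraceSpace.exists_conj (x : TraceSpace J) :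
    ∃ x' : TraceSpace J, ∀ n i, x' n i = starRingEnd ℂ (x n i) := by
  refine ⟨traceOf (fun n => starRingEnd ℂ (x n 0)) (fun n => starRingEnd ℂ (x n 1))
    (by simpa using TraceSpace.summable_norm_sq x 0)
    (by simpa using TraceSpace.summable_norm_sq x 1), fun n i => ?_⟩
  rw [traceOf_apply]
  fin_cases i <;> simp

lemma TraceSpace.hasSum_inner (x y : TraceSpace J) :
    HasSum (fun n => starRingEnd ℂ (x n 0) * y n 0 + starRingEnd ℂ (x n 1) * y n 1)
      (inner ℂ x y) :=
  (lp.hasSum_inner x y).congr_fun fun _ => (inner_eq_add _ _).symm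

-- The vectors b m j are the columns of T(z) + B; by symmetry they are also its rows. Thus T(z) + B,
-- although defined as a sum of two operators, has the maximal domain of its matrix: its graph is
-- cut out by scalar equations.
open Classical in
lemma exists_columns (μ : AtomicMeasure J) (hk : 0 < (momentum z).im) :
    ∃ b : J → Fin 2 → TraceSpace J,
      (∀ m j, (lp.single (E := fun _ : J => EuclideanSpace ℂ (Fin 2)) 2 m
        (EuclideanSpace.single j 1), b m j) ∈ (μ.T z + μ.B).graph) ∧
      ∀ x y : TraceSpace J, (x, y) ∈ (μ.T z + μ.B).graph ↔
        ∀ m j, HasSum (fun n => x n 0 * b m j n 0 + x n 1 * b m j n 1) (y m j) := by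
  choose a u v h using fun m (j : Fin 2) => exists_jumpSolution μ hk
    (lp.single (E := fun _ : J => EuclideanSpace ℂ (Fin 2)) 2 m (EuclideanSpace.single j 1))
  -- In `Fin 2` the index 1 - j is the other component, as B swaps the two.
  let b : J → Fin 2 → TraceSpace J := fun m j => (massOf (μ.b m) / 2 : ℂ) •
    lp.single (E := fun _ : J => EuclideanSpace ℂ (Fin 2)) 2 m (EuclideanSpace.single (1 - j) 1) -
      a m j
  have hb : ∀ m j n i, b m j n i =
      (massOf (μ.b m) / 2 : ℂ) * (if n = m ∧ i = 1 - j then 1 else 0) - a m j n i := by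
    intro m j n i
    rw [← single_single_apply]
    rfl
  refine ⟨b, fun m j => ((h m j).mem_graph_T_add_B_iff hk).2 fun n => ?_, fun x y => ?_⟩
  · rw [hb, hb, single_single_apply, single_single_apply]
    by_cases hn : n = m
    · subst hn
      fin_cases j <;> simp
    · simp [hn]
  · obtain ⟨a', u', v', h'⟩ := exists_jumpSolution μ hk x
    have key : ∀ m j, HasSum (fun n => x n 0 * b m j n 0 + x n 1 * b m j n 1)
        ((massOf (μ.b m) / 2 : ℂ) * x m (1 - j) - a' m j) := by
      intro m j
      refine ((hasSum_ite_eq m ((massOf (μ.b m) / 2 : ℂ) * x m (1 - j))).sub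
        (h'.hasSum_reciprocity_single (h m j))).congr_fun fun n => ?_
      rw [hb, hb]
      by_cases hn : n = m
      · subst hn
        fin_cases j <;> simp <;> ring
      · simp [hn]; ring
    rw [h'.mem_graph_T_add_B_iff hk]
    constructor
    · intro hy m j
      have e : y m j = (massOf (μ.b m) / 2 : ℂ) * x m (1 - j) - a' m j := by
        fin_cases j
        · simpa using (hy m).1
        · simpa using (hy m).2
      rw [e]
      exact key m j
    · intro hy n
      exact ⟨by simpa using (hy n 0).unique (key n 0), by simpa using (hy n 1).unique (key n 1)⟩

/-- Each row is an ℓ² vector, so each defining equation of the graph compares two continuous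
functionals. -/
lemma isClosed_graph_T_add_B (μ : AtomicMeasure J) (hk : 0 < (momentum z).im) :
    IsClosed ((μ.T z + μ.B).graph : Set (TraceSpace J × TraceSpace J)) := by
  obtain ⟨b, -, hb⟩ := exists_columns μ hk
  choose b' hb' using fun m j => TraceSpace.exists_conj (b m j)
  have e : ((μ.T z + μ.B).graph : Set (TraceSpace J × TraceSpace J)) =
      ⋂ m, ⋂ j, {p | inner ℂ (b' m j) p.1 = p.2 m j} := by
    ext ⟨x, y⟩
    simp only [SetLike.mem_coe, mem_iInter, mem_ofPred_eq, hb]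
    refine forall₂_congr fun m j => ?_
    have h : HasSum (fun n => x n 0 * b m j n 0 + x n 1 * b m j n 1) (inner ℂ (b' m j) x) := by
      refine (TraceSpace.hasSum_inner (b' m j) x).congr_fun fun n => ?_
      rw [hb', hb', Complex.conj_conj, Complex.conj_conj]
      ring
    exact ⟨fun h' => h.unique h', fun h' => h' ▸ h⟩
  rw [e]
  refine isClosed_iInter fun m => isClosed_iInter fun j => isClosed_eq (by fun_prop) ?_
  have h1 : Continuous fun p : TraceSpace J × TraceSpace J => p.2 m :=
    (lp.evalCLM ℂ (fun _ : J => EuclideanSpace ℂ (Fin 2)) 2 m).continuous.comp continuous_snd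
  fun_prop

/-- Orthogonality to the columns says, by symmetry, that the conjugate of w lies in the kernel,
which is trivial by the lower bound. -/
lemma eq_zero_of_inner_range_eq_zero (hk : 0 < (momentum z).im) {w : TraceSpace J}
    (hw : ∀ f : (μ.T z + μ.B).domain, inner ℂ w ((μ.T z + μ.B) f) = 0) : w = 0 := by
  obtain ⟨b, hb1, hb⟩ := exists_columns μ hk
  obtain ⟨w', hw'⟩ := TraceSpace.exists_conj w
  have h0 : (w', (0 : TraceSpace J)) ∈ (μ.T z + μ.B).graph := by
    refine (hb _ _).2 fun m j => ?_
    obtain ⟨f, -, hf⟩ := (LinearPMap.mem_graph_iff _).1 (hb1 m j)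
    have h1 := hw f
    simp only at hf
    rw [hf] at h1
    have h2 := TraceSpace.hasSum_inner w (b m j)
    rw [h1] at h2
    refine h2.congr_fun fun n => ?_
    rw [hw', hw']
  have h3 := norm_le_of_mem_graph_T_add_B hk h0
  rw [norm_zero, mul_zero] at h3
  have h4 : w' = 0 := norm_le_zero_iff.1 h3
  ext n i
  have h5 := hw' n i
  rw [h4] at h5
  simpa using h5.symm

end Inversion

/-- An operator with closed graph and dense range that is bounded below is onto. -/
lemma exists_eq_of_isClosed_graph {E F : Type*} [NormedAddCommGroup E] [InnerProductSpace ℂ E]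
    [NormedAddCommGroup F] [InnerProductSpace ℂ F] [CompleteSpace E] [CompleteSpace F]
    (A : E →ₗ.[ℂ] F) (C : ℝ)
    (hb : ∀ f : A.domain, ‖(f : E)‖ ≤ C * ‖A f‖) (hcl : IsClosed (A.graph : Set (E × F)))
    (hd : ∀ w : F, (∀ f : A.domain, inner ℂ w (A f) = 0) → w = 0) (g : F) :
    ∃ f : A.domain, A f = g := by
  let S : Submodule ℂ F := A.graph.map (LinearMap.snd ℂ E F)
  have hmem : ∀ y, y ∈ S ↔ ∃ f : A.domain, A f = y := by
    intro y
    simp only [S, Submodule.mem_map, LinearMap.snd_apply, Prod.exists, exists_eq_right]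
    constructor
    · rintro ⟨x, hx⟩
      obtain ⟨f, -, hf⟩ := (LinearPMap.mem_graph_iff _).1 hx
      exact ⟨f, hf⟩
    · rintro ⟨f, rfl⟩
      exact ⟨f, A.mem_graph f⟩
  have hcomp : IsClosed (S : Set F) := by
    refine isClosed_of_closure_subset fun y hy => ?_
    obtain ⟨s, hs, hlim⟩ := mem_closure_iff_seq_limit.1 hy
    choose f hf using fun n => (hmem _).1 (hs n)
    have hcau : CauchySeq fun n => (f n : E) := by
      have h1 := hlim.cauchySeq
      rw [Metric.cauchySeq_iff] at h1 ⊢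
      intro ε hε
      -- C may be zero or negative; |C| + 1 keeps the divisor positive.
      obtain ⟨N, hN⟩ := h1 (ε / (|C| + 1)) (by positivity)
      refine ⟨N, fun m hm n hn => ?_⟩
      have h2 := hN m hm n hn
      rw [dist_eq_norm] at h2 ⊢
      have h3 := hb (f m - f n)
      rw [LinearPMap.map_sub, hf, hf] at h3
      refine h3.trans_lt ?_
      rw [lt_div_iff₀ (by positivity)] at h2
      have h4 : C * ‖s m - s n‖ ≤ |C| * ‖s m - s n‖ := by gcongr; exact le_abs_self C
      nlinarith [norm_nonneg (s m - s n)]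
    obtain ⟨x, hx⟩ := cauchySeq_tendsto_of_complete hcau
    have h5 : (x, y) ∈ A.graph := by
      refine hcl.mem_of_tendsto (hx.prodMk_nhds hlim) (Eventually.of_forall fun n => ?_)
      rw [← hf n]
      exact A.mem_graph (f n)
    obtain ⟨f', -, hf'⟩ := (LinearPMap.mem_graph_iff _).1 h5
    exact (hmem y).2 ⟨f', hf'⟩
  have : CompleteSpace S := hcomp.completeSpace_coe
  have h6 : S = ⊤ := by
    rw [← Submodule.orthogonal_eq_bot_iff, Submodule.eq_bot_iff]
    intro w hw
    refine hd w fun f => ?_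
    have := (Submodule.mem_orthogonal' S w).1 hw (A f) ((hmem _).2 ⟨f, rfl⟩)
    exact this
  exact (hmem g).1 (h6 ▸ Submodule.mem_top)

lemma exists_isBoundedInverse_T_add_B {J : Type*} (μ : AtomicMeasure J) {z : ℂ}
    (hk : 0 < (momentum z).im) : ∃ K, IsBoundedInverse (μ.T z + μ.B) K := by
  have hb : ∀ f : (μ.T z + μ.B).domain,
      ‖(f : TraceSpace J)‖ ≤ jumpConst μ (momentum z) * ‖(μ.T z + μ.B) f‖ := fun f =>
    norm_le_of_mem_graph_T_add_B hk ((μ.T z + μ.B).mem_graph f)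
  exact exists_isBoundedInverse _ _ hb (exists_eq_of_isClosed_graph _ _ hb
    (isClosed_graph_T_add_B μ hk) fun _ => eq_zero_of_inner_range_eq_zero hk)

/-! ### The resolvent formula -/

section Resolvent

variable {J : Type*} {μ : AtomicMeasure J} {z : ℂ} {k : ℂ} {x a : TraceSpace J} {u v : ℝ → ℂ}

lemma IsH2.conj {S : Set ℝ} {w : ℝ → ℂ} (h : IsH2 S u v w) :
    IsH2 S (fun s => starRingEnd ℂ (u s)) (fun s => starRingEnd ℂ (v s))
      (fun s => starRingEnd ℂ (w s)) where
  memLp_u := h.isH1.conj.memLp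
  memLp_v := h.isH1.conj.memLp'
  memLp_w := h.isH1'.conj.memLp'
  hasDerivAt s hs := (h.hasDerivAt s hs).star
  integral_eq := h.isH1'.conj.integral_eq

lemma IsH2.tendsto (h : ∃ w, IsH2 ∅ u v w) (n : J) :
    (Tendsto u (𝓝[<] μ.t n) (𝓝 (u (μ.t n))) ∧ Tendsto u (𝓝[>] μ.t n) (𝓝 (u (μ.t n)))) ∧
      Tendsto v (𝓝[<] μ.t n) (𝓝 (v (μ.t n))) ∧ Tendsto v (𝓝[>] μ.t n) (𝓝 (v (μ.t n))) := by
  obtain ⟨w, h⟩ := h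
  have hc := h.continuousAt (μ.t_pos n)
  exact ⟨⟨hc.1.tendsto.mono_left nhdsWithin_le_nhds, hc.1.tendsto.mono_left nhdsWithin_le_nhds⟩,
    hc.2.tendsto.mono_left nhdsWithin_le_nhds, hc.2.tendsto.mono_left nhdsWithin_le_nhds⟩

lemma tendsto_conj {l : Filter ℝ} {F : ℝ → ℂ} {c : ℂ} (h : Tendsto F l (𝓝 c)) :
    Tendsto (fun s => starRingEnd ℂ (F s)) l (𝓝 (starRingEnd ℂ c)) :=
  (Complex.continuous_conj.tendsto c).comp h

/-- Test against g and put φ = R g. In Green's formula for ū and φ the jumps of ū meet the trace of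
φ, giving ⟨x, Γ g⟩. As k'² is the conjugate of k², the bulk terms reduce to ∫ ū g. -/
lemma JumpSolution.adjoint_ae_eq {k' : ℂ} (hk' : 0 < k'.im) (hkk : k' ^ 2 = starRingEnd ℂ (k ^ 2))
    (h : JumpSolution μ k x a u v) {R : L2HalfLine →L[ℂ] L2HalfLine}
    (hR : IsBoundedInverse (shift dirichletLaplacian (k' ^ 2)) R)
    {Γ : L2HalfLine →L[ℂ] TraceSpace J} (hΓ : IsComp μ.trace R Γ) :
    ContinuousLinearMap.adjoint Γ x =ᵐ[ν₊] u := by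
  have hu := h.isH2.memLp_u.coeFn_toLp
  suffices e : ContinuousLinearMap.adjoint Γ x = h.isH2.memLp_u.toLp u by rwa [e]
  refine ext_inner_right ℂ fun g => ?_
  rw [ContinuousLinearMap.adjoint_inner_left]
  obtain ⟨φ, ψ, hφ, hφR, hφ0, -⟩ := hR.exists_isH2 hk' g
  obtain ⟨v0, hv0⟩ := h.isH2.isH1'.exists_tendsto_zero
  have hφ' := hφ.mono (empty_subset (range μ.t))
  obtain ⟨ψ0, hψ0⟩ := hφ'.isH1'.exists_tendsto_zero
  have ht := fun n => IsH2.tendsto (μ := μ) ⟨_, hφ⟩ n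
  have h1 := h.isH2.conj.hasSum_wronskian hφ' (tendsto_conj h.zero) (tendsto_conj hv0) hφ0 hψ0
    (fun n => tendsto_conj (h.u_left n)) (fun n => tendsto_conj (h.u_right n))
    (fun n => tendsto_conj (h.v_left n)) (fun n => tendsto_conj (h.v_right n))
    (fun n => (ht n).1.1) (fun n => (ht n).1.2) (fun n => (ht n).2.1) (fun n => (ht n).2.2)
  have h2 := TraceSpace.hasSum_inner x (Γ g)
  have h3 : ∀ n, starRingEnd ℂ (x n 0) * Γ g n 0 + starRingEnd ℂ (x n 1) * Γ g n 1 =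
      (starRingEnd ℂ (a n 0 + x n 1 / 2) * ψ (μ.t n) -
        starRingEnd ℂ (a n 0 - x n 1 / 2) * ψ (μ.t n)) -
      (starRingEnd ℂ (a n 1 - x n 0 / 2) * φ (μ.t n) -
        starRingEnd ℂ (a n 1 + x n 0 / 2) * φ (μ.t n)) := by
    intro n
    rw [hΓ.trace_apply hφ hφ0 hφR n]
    have h3 : starRingEnd ℂ (2 : ℂ) = 2 := Complex.conj_ofNat 2
    simp only [map_sub, map_add, map_div₀, h3, Matrix.cons_val_zero, Matrix.cons_val_one]
    ring
  rw [(h2.congr_fun fun n => (h3 n).symm).unique h1, inner_eq_integral hu (EventuallyEq.refl _ _),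
    map_zero, zero_mul, mul_zero, sub_zero, neg_zero, zero_sub, ← integral_neg]
  refine integral_congr_ae (Eventually.of_forall fun s => ?_)
  simp only [map_mul, map_neg, hkk]
  ring

/-- By the adjoint formula, R g is the Dirichlet solution φ plus the jump solution u with jumps x =
K(Γ g). It solves the equation with source g, and the rows of (T(z) + B)x = Γ g are its jump
conditions. -/
lemma isBoundedInverse_krein (hk : 0 < (momentum z).im) {k' : ℂ} (hk' : 0 < k'.im)
    (hkk : k' ^ 2 = starRingEnd ℂ z) {R₀ R₀' : L2HalfLine →L[ℂ] L2HalfLine}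
    {Γ Γ' : L2HalfLine →L[ℂ] TraceSpace J} {K : TraceSpace J →L[ℂ] TraceSpace J}
    (hR₀ : IsBoundedInverse (shift dirichletLaplacian z) R₀)
    (hR₀' : IsBoundedInverse (shift dirichletLaplacian (starRingEnd ℂ z)) R₀')
    (hΓ : IsComp μ.trace R₀ Γ) (hΓ' : IsComp μ.trace R₀' Γ')
    (hK : IsBoundedInverse (μ.T z + μ.B) K) :
    IsBoundedInverse (shift μ.laplacian z) (R₀ + ContinuousLinearMap.adjoint Γ' ∘L K ∘L Γ) := by
  have hz := momentum_sq z
  set k := momentum z with hkdef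
  set R := R₀ + ContinuousLinearMap.adjoint Γ' ∘L K ∘L Γ
  have hgraph : ∀ g, ∃ f : (shift μ.laplacian z).domain,
      shift μ.laplacian z f = g ∧ R g = f := by
    intro g
    obtain ⟨f, hf1, hf2⟩ := hK.2 (Γ g)
    have hx := (μ.T z + μ.B).mem_graph f
    rw [hf1, ← hf2] at hx
    obtain ⟨a, u, v, h⟩ := exists_jumpSolution μ hk (K (Γ g))
    have hrel := (h.mem_graph_T_add_B_iff hk).1 hx
    rw [← hkk] at hR₀'
    rw [← hz] at hR₀
    have hu := h.adjoint_ae_eq hk' (by rw [hkk, hz]) hR₀' hΓ'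
    obtain ⟨φ, ψ, hφ, hφR, hφ0, -⟩ := hR₀.exists_isH2 hk g
    have hφ' := hφ.mono (empty_subset (range μ.t))
    have ht := fun n => IsH2.tendsto (μ := μ) ⟨_, hφ⟩ n
    have hsum := hφ'.add h.isH2
    have hRg : R g =ᵐ[ν₊] φ + u := by
      filter_upwards [Lp.coeFn_add (R₀ g) (ContinuousLinearMap.adjoint Γ' (K (Γ g))), hu, hφR]
        with s h1 h2 h3
      change (R₀ g + ContinuousLinearMap.adjoint Γ' (K (Γ g)) : L2HalfLine) s = _
      rw [h1, Pi.add_apply, Pi.add_apply, h2, h3]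
    have hmem : (R g, g + z • R g) ∈ μ.laplacian.graph := by
      rw [μ.graph_laplacian]
      refine ⟨_, _, _, hsum, hRg, ?_, tendsto_add_zero hφ0 h.zero, fun n => ?_⟩
      · filter_upwards [Lp.coeFn_add g (z • R g), Lp.coeFn_smul z (R g), hRg] with s h1 h2 h3
        rw [Pi.add_apply, h2, Pi.smul_apply, h3, smul_eq_mul, Pi.add_apply] at h1
        rw [h1, Pi.neg_apply, Pi.add_apply, ← hz]
        ring
      · refine (jumpCondition_iff (μ.one_lt_b n) ((ht n).1.1.add (h.u_left n))
          ((ht n).1.2.add (h.u_right n)) ((ht n).2.1.add (h.v_left n))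
          ((ht n).2.2.add (h.v_right n))).2 ?_
        obtain ⟨e1, e2⟩ := hrel n
        rw [hΓ.trace_apply hφ hφ0 hφR n] at e1 e2
        simp only [Matrix.cons_val_zero, Matrix.cons_val_one] at e1 e2
        constructor
        · linear_combination 2 * e1
        · linear_combination 2 * e2
    obtain ⟨f', h1, h2⟩ := exists_shift_eq hmem
    exact ⟨f', h1, h2.symm⟩
  refine ⟨fun f => ?_, hgraph⟩
  obtain ⟨f', h1, h2⟩ := hgraph (shift μ.laplacian z f)
  -- R is a right inverse so far; the lower bound for A⁺ - z makes it a left inverse.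
  have hb : ‖((f' - f : (shift μ.laplacian z).domain) : L2HalfLine)‖ ≤
      formConst k * ‖shift μ.laplacian z (f' - f)‖ := by
    have := norm_le_norm_shift_laplacian (μ := μ) hk
    rw [hz] at this
    exact this _
  rw [LinearPMap.map_sub, h1, sub_self, norm_zero, mul_zero] at hb
  rw [h2]
  exact sub_eq_zero.1 (norm_le_zero_iff.1 hb)

end Resolvent

/-! ### Solutions of `-f'' = k² f` on an interval -/

/-- The solution of `-f'' = k² f` with `f(0) = p` and `f'(0) = q`. -/
noncomputable def wave (k p q : ℂ) (s : ℝ) : ℂ :=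
  (Complex.exp (Complex.I * k * s) * (q + Complex.I * k * p) -
    Complex.exp (-(Complex.I * k) * s) * (q - Complex.I * k * p)) / (2 * Complex.I * k)

/-- The derivative of `wave k p q`. -/
noncomputable def waveDeriv (k p q : ℂ) (s : ℝ) : ℂ :=
  (Complex.exp (Complex.I * k * s) * (q + Complex.I * k * p) +
    Complex.exp (-(Complex.I * k) * s) * (q - Complex.I * k * p)) / 2

section Wave

variable {k : ℂ}

lemma two_mul_I_mul_ne_zero (hk0 : k ≠ 0) : 2 * Complex.I * k ≠ 0 :=
  mul_ne_zero (mul_ne_zero two_ne_zero Complex.I_ne_zero) hk0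

lemma wave_zero (hk0 : k ≠ 0) (p q : ℂ) : wave k p q 0 = p := by
  rw [wave, div_eq_iff (two_mul_I_mul_ne_zero hk0)]
  simp
  ring

lemma hasDerivAt_wave (hk0 : k ≠ 0) (p q : ℂ) (x : ℝ) :
    HasDerivAt (wave k p q) (waveDeriv k p q x) x := by
  have h := (((hasDerivAt_exp_mul (Complex.I * k) x).mul_const (q + Complex.I * k * p)).sub
    ((hasDerivAt_exp_mul (-(Complex.I * k)) x).mul_const
      (q - Complex.I * k * p))).div_const (2 * Complex.I * k)
  convert! h using 1
  rw [waveDeriv, eq_div_iff (two_mul_I_mul_ne_zero hk0)]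
  ring

lemma hasDerivAt_waveDeriv (hk0 : k ≠ 0) (p q : ℂ) (x : ℝ) :
    HasDerivAt (waveDeriv k p q) (-k ^ 2 * wave k p q x) x := by
  have h := (((hasDerivAt_exp_mul (Complex.I * k) x).mul_const (q + Complex.I * k * p)).add
    ((hasDerivAt_exp_mul (-(Complex.I * k)) x).mul_const
      (q - Complex.I * k * p))).div_const 2
  convert! h using 1
  have h2 := two_mul_I_mul_ne_zero hk0
  rw [wave, mul_div_assoc', div_eq_iff h2]
  linear_combination (-k ^ 2 * (Complex.exp (Complex.I * k * x) * (q + Complex.I * k * p) -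
    Complex.exp (-(Complex.I * k) * x) * (q - Complex.I * k * p))) * Complex.I_mul_I

variable {f f' : ℝ → ℂ} {x y : ℝ}

lemma exp_mul_eq_of_hasDerivAt {c : ℂ} {e : ℝ → ℂ}
    (h : ∀ s ∈ uIcc x y, HasDerivAt e (c * e s) s) :
    e y = Complex.exp (c * (y - x : ℝ)) * e x := by
  have h1 : ∀ s ∈ uIcc x y, HasDerivWithinAt (fun s : ℝ => Complex.exp (-c * s) * e s) 0
      (uIcc x y) s := by
    intro s hs
    have := ((hasDerivAt_exp_mul (-c) s).mul (h s hs)).hasDerivWithinAt (s := uIcc x y)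
    convert! this using 1
    ring
  have h2 := (convex_uIcc x y).norm_image_sub_le_of_norm_hasDerivWithin_le h1 (C := 0)
    (fun _ _ => by simp) left_mem_uIcc right_mem_uIcc
  rw [zero_mul] at h2
  have h3 := sub_eq_zero.1 (norm_le_zero_iff.1 h2)
  have h4 : Complex.exp (c * (y - x : ℝ)) = Complex.exp (c * y) * Complex.exp (-c * x) := by
    rw [← Complex.exp_add]; congr 1; push_cast; ring
  have h5 : Complex.exp (c * y) * Complex.exp (-c * y) = 1 := by
    rw [← Complex.exp_add]; simp
  rw [h4, mul_assoc, ← h3, ← mul_assoc, h5, one_mul]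

/-- A solution on an interval is determined by its values at one point. -/
lemma eq_wave (hk0 : k ≠ 0) (h : ∀ s ∈ uIcc x y, HasDerivAt f (f' s) s)
    (h' : ∀ s ∈ uIcc x y, HasDerivAt f' (-k ^ 2 * f s) s) :
    f y = wave k (f x) (f' x) (y - x) ∧ f' y = waveDeriv k (f x) (f' x) (y - x) := by
  -- The combinations f' ± ikf decouple the equation into two first-order ones.
  have h1 := exp_mul_eq_of_hasDerivAt (c := Complex.I * k) (x := x) (y := y)
    (e := fun s => f' s + Complex.I * k * f s) (fun s hs => by
      convert! (h' s hs).add ((h s hs).const_mul (Complex.I * k)) using 1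
      linear_combination (k ^ 2 * f s) * Complex.I_mul_I)
  have h2 := exp_mul_eq_of_hasDerivAt (c := -(Complex.I * k)) (x := x) (y := y)
    (e := fun s => f' s - Complex.I * k * f s) (fun s hs => by
      convert! (h' s hs).sub ((h s hs).const_mul (Complex.I * k)) using 1
      linear_combination (k ^ 2 * f s) * Complex.I_mul_I)
  constructor
  · rw [wave, eq_div_iff (two_mul_I_mul_ne_zero hk0), ← h1, ← h2]
    ring
  · rw [waveDeriv, ← h1, ← h2]
    ring

/-- The two exponentials have different moduli, as Im k > 0 and h > 0. -/
lemma exp_sub_exp_neg_ne_zero (hk : 0 < k.im) {h : ℝ} (hh : 0 < h) :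
    Complex.exp (Complex.I * k * h) - Complex.exp (-(Complex.I * k) * h) ≠ 0 := by
  intro e
  have e1 := congrArg norm (sub_eq_zero.1 e)
  have e2 : -(Complex.I * k) * h = Complex.I * k * (-h : ℝ) := by push_cast; ring
  rw [e2, norm_exp_I_mul, norm_exp_I_mul, Real.exp_eq_exp] at e1
  have := mul_pos hk hh
  linarith

end Wave

/-! ### Weyl solutions -/

section Weyl

variable {J : Type*} {μ : AtomicMeasure J} {k : ℂ} {f f' u v : ℝ → ℂ}

lemma IsH2.hasDerivAt_deriv {S : Set ℝ} (hS : IsClosed S) {c : ℂ}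
    (h : IsH2 S u v (fun s => c * u s)) {x : ℝ} (hx : x ∈ Ioi 0 \ S) :
    HasDerivAt v (c * u x) x := by
  have hO : IsOpen (Ioi (0 : ℝ) \ S) := isOpen_Ioi.sdiff hS
  obtain ⟨δ, hδ, hball⟩ := Metric.isOpen_iff.1 hO x hx
  have hsub : ∀ y ∈ Icc (x - δ / 2) (x + δ / 2), y ∈ Ioi (0 : ℝ) \ S := fun y hy => hball (by
    rw [Metric.mem_ball, Real.dist_eq, abs_lt]; constructor <;> linarith [hy.1, hy.2])
  have hcont : ContinuousOn (fun s => c * u s) (Icc (x - δ / 2) (x + δ / 2)) := fun y hy =>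
    ((h.hasDerivAt y (hsub y hy)).continuousAt.const_mul c).continuousWithinAt
  have hle : x - δ / 2 ≤ x + δ / 2 := by linarith
  have hn : Ioo (x - δ / 2) (x + δ / 2) ∈ 𝓝 x := isOpen_Ioo.mem_nhds ⟨by linarith, by linarith⟩
  have hint : IntervalIntegrable (fun s => c * u s) volume (x - δ / 2) x :=
    (hcont.mono (Icc_subset_Icc_right (by linarith))).intervalIntegrable_of_Icc (by linarith)
  have hd := intervalIntegral.integral_hasDerivAt_right hint
    ((hcont.mono Ioo_subset_Icc_self).stronglyMeasurableAtFilter isOpen_Ioo x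
      ⟨by linarith, by linarith⟩)
    (hcont.continuousAt (Filter.mem_of_superset hn Ioo_subset_Icc_self))
  refine (hd.add_const (v (x - δ / 2))).congr_of_eventuallyEq ?_
  filter_upwards [hn] with y hy
  rw [h.integral_eq _ _ hy.1.le fun s hs => hsub s ⟨hs.1, hs.2.trans hy.2.le⟩]
  ring

/-- Points on both sides within gap/4 would be closer than `gap` to each other. If the right side is
blocked, x ≥ 3·gap/4, so the left segment stays clear of 0. -/
lemma exists_regular_segment (μ : AtomicMeasure J) {x : ℝ} (hx : x ∈ Ioi 0 \ range μ.t) :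
    uIcc x (x + μ.gap / 4) ⊆ Ioi 0 \ range μ.t ∨ uIcc x (x - μ.gap / 4) ⊆ Ioi 0 \ range μ.t := by
  have hg := μ.gap_pos
  have hx0 : 0 < x := hx.1
  by_contra! hcon
  obtain ⟨h1, h2⟩ := hcon
  rw [uIcc_of_le (by linarith), not_subset] at h1
  rw [uIcc_of_ge (by linarith), not_subset] at h2
  obtain ⟨s, hs, hs'⟩ := h1
  obtain ⟨r, hr, hr'⟩ := h2
  have hs2 : s ∈ range μ.t := by
    by_contra hc
    exact hs' ⟨hx0.trans_le hs.1, hc⟩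
  obtain ⟨n, rfl⟩ := hs2
  have hn := μ.gap_le n
  have hr2 : r ∈ range μ.t := by
    by_contra hc
    exact hr' ⟨show 0 < r by linarith [hr.1, hs.2], hc⟩
  obtain ⟨m, rfl⟩ := hr2
  by_cases hnm : n = m
  · subst hnm
    exact hx.2 ⟨n, le_antisymm hr.2 hs.1⟩
  · have h3 := μ.gap_le_abs_sub hnm
    rw [abs_of_nonneg (by linarith [hr.2, hs.1])] at h3
    linarith [hs.2, hr.1]

/-- Solve the propagation formula from x to x + h for f'(x). The coefficient e^{ikh} - e^{-ikh} does
not vanish. -/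
lemma norm_deriv_le (hk : 0 < k.im) {x h : ℝ} (hh : 0 < |h|)
    (hf : ∀ s ∈ uIcc x (x + h), HasDerivAt f (f' s) s)
    (hf' : ∀ s ∈ uIcc x (x + h), HasDerivAt f' (-k ^ 2 * f s) s) :
    ‖f' x‖ ≤ (2 * ‖k‖ + ‖k‖ * ‖Complex.exp (Complex.I * k * |h|) +
        Complex.exp (-(Complex.I * k) * |h|)‖) / ‖Complex.exp (Complex.I * k * |h|) -
        Complex.exp (-(Complex.I * k) * |h|)‖ * (‖f (x + h)‖ + ‖f x‖) := by
  have hk0 : k ≠ 0 := norm_pos_iff.1 (norm_pos_of_im_pos hk)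
  have h1 := (eq_wave hk0 hf hf').1
  have hD := exp_sub_exp_neg_ne_zero hk hh
  rw [add_sub_cancel_left, wave, eq_div_iff (two_mul_I_mul_ne_zero hk0)] at h1
  set D := Complex.exp (Complex.I * k * |h|) - Complex.exp (-(Complex.I * k) * |h|)
  set P := Complex.exp (Complex.I * k * |h|) + Complex.exp (-(Complex.I * k) * |h|)
  have h2 : ‖D * f' x‖ = ‖f (x + h) * (2 * Complex.I * k) - Complex.I * k * f x * P‖ := by
    rcases abs_choice h with e | e
    · congr 1
      simp only [D, P, e]
      linear_combination -h1
    · rw [← norm_neg]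
      congr 1
      simp only [D, P, e]
      have e1 : Complex.I * k * (-h : ℝ) = -(Complex.I * k) * h := by push_cast; ring
      have e2 : -(Complex.I * k) * (-h : ℝ) = Complex.I * k * h := by push_cast; ring
      rw [e1, e2]
      linear_combination -h1
  rw [div_mul_eq_mul_div, le_div_iff₀ (norm_pos_iff.2 hD), mul_comm, ← norm_mul, h2]
  refine (norm_sub_le _ _).trans ?_
  simp only [norm_mul, Complex.norm_I, Complex.norm_ofNat]
  have := mul_nonneg (norm_nonneg k) (norm_nonneg P)
  nlinarith [norm_nonneg k, norm_nonneg (f (x + h)), norm_nonneg (f x),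
    mul_nonneg this (norm_nonneg (f (x + h))), mul_nonneg (norm_nonneg k) (norm_nonneg (f x))]

/-- Square integrability is assumed of f only. That of f' follows since f'(x) is bounded by values
of f at x and at distance gap/4 on a regular side, uniformly in x. -/
lemma AtomicMeasure.IsWeylSolution.isH2 (hk : 0 < k.im) (h : μ.IsWeylSolution (k ^ 2) f f') :
    IsH2 (range μ.t) f f' (fun s => -k ^ 2 * f s) := by
  have hg := μ.gap_pos
  set d := μ.gap / 4 with hd
  have hd0 : 0 < d := by positivity
  set C := (2 * ‖k‖ + ‖k‖ * ‖Complex.exp (Complex.I * k * d) +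
        Complex.exp (-(Complex.I * k) * d)‖) / ‖Complex.exp (Complex.I * k * d) -
        Complex.exp (-(Complex.I * k) * d)‖
  have hC : 0 ≤ C := by positivity
  set f0 : ℝ → ℂ := (Ioi (0 : ℝ)).indicator f
  have hf0 : MemLp f0 2 volume := (memLp_indicator_iff_restrict measurableSet_Ioi).2 h.memLp
  have hshift : ∀ c : ℝ, MemLp (fun s => f0 (s + c)) 2 ν₊ := fun c =>
    (hf0.comp_measurePreserving (measurePreserving_add_right volume c)).restrict _
  have hcont : ContinuousOn f' (Ioi 0 \ range μ.t) := fun s hs =>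
    (h.hasDerivAt' s hs.2).continuousAt.continuousWithinAt
  -- Which side is regular depends on x, so both translates enter; extension of f by zero makes them
  -- square integrable.
  have hsum : MemLp (fun s => ‖f0 (s + d)‖ + ‖f0 (s + -d)‖ + ‖f0 (s + 0)‖) 2 ν₊ :=
    ((hshift d).norm.add (hshift (-d)).norm).add (hshift 0).norm
  have hf' : MemLp f' 2 ν₊ := by
    refine hsum.of_le_mul (c := C) (aestronglyMeasurable_of_continuousOn μ hcont) ?_
    filter_upwards [μ.ae_regular] with x hx
    have e0 : ∀ s : ℝ, 0 < s → f0 s = f s := fun s hs => indicator_of_mem (mem_Ioi.2 hs) f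
    rw [Real.norm_of_nonneg (by positivity), add_zero, e0 x hx.1]
    rcases exists_regular_segment μ hx with hs | hs
    · have h1 := norm_deriv_le hk (h := d) (by rwa [abs_of_pos hd0])
        (fun s hs' => h.hasDerivAt s (hs hs').2) (fun s hs' => h.hasDerivAt' s (hs hs').2)
      rw [abs_of_pos hd0] at h1
      rw [e0 (x + d) (hs right_mem_uIcc).1]
      refine h1.trans (mul_le_mul_of_nonneg_left ?_ hC)
      linarith [norm_nonneg (f0 (x + -d))]
    · rw [sub_eq_add_neg] at hs
      have h1 := norm_deriv_le hk (h := -d) (by rwa [abs_neg, abs_of_pos hd0])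
        (fun s hs' => h.hasDerivAt s (hs hs').2) (fun s hs' => h.hasDerivAt' s (hs hs').2)
      rw [abs_neg, abs_of_pos hd0] at h1
      rw [e0 (x + -d) (hs right_mem_uIcc).1]
      refine h1.trans (mul_le_mul_of_nonneg_left ?_ hC)
      linarith [norm_nonneg (f0 (x + d))]
  refine ⟨h.memLp, hf', h.memLp.const_mul _, fun x hx => h.hasDerivAt x hx.2,
    fun x y hxy hI => ?_⟩
  exact intervalIntegral.integral_eq_sub_of_hasDerivAt
    (fun s hs => h.hasDerivAt' s (hI (uIcc_of_le hxy ▸ hs)).2)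
    (intervalIntegrable_of_memLp hxy (h.memLp.const_mul _) (hI.trans sdiff_subset))

lemma IsH2.eq_zero_of_jumpCondition (hk : 0 < k.im)
    (h : IsH2 (range μ.t) u v (fun s => -k ^ 2 * u s)) (h0 : Tendsto u (𝓝[>] 0) (𝓝 0))
    (hj : ∀ n, JumpCondition (μ.b n) (μ.t n) u v) :
    ∀ x ∈ Ioi 0 \ range μ.t, u x = 0 ∧ v x = 0 := by
  have hu := h.memLp_u.coeFn_toLp
  set f := h.memLp_u.toLp u
  have h1 := energy_le_of_mem_laplacianGraph hk h hu (g := k ^ 2 • f) (h := 0) (by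
    filter_upwards [Lp.coeFn_smul (k ^ 2) f, hu] with s h2 h3
    rw [h2, Pi.smul_apply, h3, smul_eq_mul, Pi.neg_apply]
    ring) h0 hj (by simp)
  rw [norm_zero, mul_zero, mul_zero] at h1
  have h2 := (norm_sq_le_energy hu h.memLp_v h.memLp_u).trans h1
  have h3 : f = 0 := norm_eq_zero.1
    (pow_eq_zero_iff two_ne_zero |>.1 (le_antisymm h2 (sq_nonneg _)))
  refine h.eq_zero μ.isClosed_range (hu.symm.trans ?_)
  rw [h3]
  exact Lp.coeFn_zero _ _ _

lemma AtomicMeasure.notMem_range_of_lt_gap (μ : AtomicMeasure J) {x : ℝ} (hx : x < μ.gap) :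
    x ∉ range μ.t := by
  rintro ⟨n, rfl⟩
  exact absurd (μ.gap_le n) hx.not_ge

/-- A solution on the half-line that is normalized at `0` determines the `m`-function. -/
lemma IsH2.isMPlus (hk : 0 < k.im) {m : ℂ}
    (h : IsH2 (range μ.t) u v (fun s => -k ^ 2 * u s)) (hu0 : Tendsto u (𝓝[>] 0) (𝓝 1))
    (hv0 : Tendsto v (𝓝[>] 0) (𝓝 m)) (hj : ∀ n, JumpCondition (μ.b n) (μ.t n) u v) :
    μ.IsMPlus (k ^ 2) 0 m := by
  have hk0 : k ≠ 0 := norm_pos_iff.1 (norm_pos_of_im_pos hk)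
  have hg := μ.gap_pos
  have hd : ∀ x ∈ Ioi 0 \ range μ.t, HasDerivAt v (-k ^ 2 * u x) x := fun x hx =>
    h.hasDerivAt_deriv μ.isClosed_range hx
  refine ⟨?_, fun f f' hf => ?_⟩
  -- A Weyl solution lives on all of ℝ. On (0, gap) the given u is the free wave with its limiting
  -- data at 0, and this wave continues it to the left.
  · have hwave : ∀ y, 0 < y → y < μ.gap → u y = wave k 1 m y ∧ v y = waveDeriv k 1 m y := by
      intro y hy hyg
      have hreg : ∀ x ∈ Ioo 0 y, ∀ s ∈ uIcc x y, s ∈ Ioi 0 \ range μ.t := fun x hx s hs => by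
        rw [uIcc_of_le hx.2.le] at hs
        exact ⟨hx.1.trans_le hs.1, μ.notMem_range_of_lt_gap (hs.2.trans_lt hyg)⟩
      have hev : ∀ᶠ x in 𝓝[>] (0 : ℝ), x ∈ Ioo 0 y := Ioo_mem_nhdsGT hy
      have hsub : Tendsto (fun x : ℝ => ((y - x : ℝ) : ℂ)) (𝓝[>] 0) (𝓝 ((y : ℝ) : ℂ)) := by
        have : Tendsto (fun x : ℝ => ((y - x : ℝ) : ℂ)) (𝓝 0) (𝓝 ((y - 0 : ℝ) : ℂ)) :=
          Continuous.tendsto (by fun_prop) 0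
        rw [sub_zero] at this
        exact this.mono_left nhdsWithin_le_nhds
      have he : ∀ c : ℂ, Tendsto (fun x : ℝ => Complex.exp (c * (y - x : ℝ))) (𝓝[>] 0)
          (𝓝 (Complex.exp (c * y))) := fun c =>
        (Complex.continuous_exp.tendsto _).comp (hsub.const_mul c)
      have hp := hv0.add (hu0.const_mul (Complex.I * k))
      have hm := hv0.sub (hu0.const_mul (Complex.I * k))
      constructor
      · refine tendsto_nhds_unique (tendsto_const_nhds.congr' ?_)
          ((((he (Complex.I * k)).mul hp).sub ((he (-(Complex.I * k))).mul hm)).div_const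
            (2 * Complex.I * k))
        filter_upwards [hev] with x hx
        exact (eq_wave hk0 (fun s hs => h.hasDerivAt s (hreg x hx s hs))
          (fun s hs => hd s (hreg x hx s hs))).1
      · refine tendsto_nhds_unique (tendsto_const_nhds.congr' ?_)
          ((((he (Complex.I * k)).mul hp).add ((he (-(Complex.I * k))).mul hm)).div_const 2)
        filter_upwards [hev] with x hx
        exact (eq_wave hk0 (fun s hs => h.hasDerivAt s (hreg x hx s hs))
          (fun s hs => hd s (hreg x hx s hs))).2
    set F : ℝ → ℂ := fun s => if s ≤ 0 then wave k 1 m s else u s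
    set G : ℝ → ℂ := fun s => if s ≤ 0 then waveDeriv k 1 m s else v s
    have hF : ∀ s, 0 < s → F s = u s := fun s hs => if_neg hs.not_ge
    have hG : ∀ s, 0 < s → G s = v s := fun s hs => if_neg hs.not_ge
    have hF' : ∀ s, s < μ.gap → F s = wave k 1 m s := fun s hs => by
      rcases le_or_gt s 0 with h0 | h0
      · exact if_pos h0
      · rw [hF s h0, (hwave s h0 hs).1]
    have hG' : ∀ s, s < μ.gap → G s = waveDeriv k 1 m s := fun s hs => by
      rcases le_or_gt s 0 with h0 | h0
      · exact if_pos h0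
      · rw [hG s h0, (hwave s h0 hs).2]
    have hFe : ∀ {x}, 0 < x → F =ᶠ[𝓝 x] u := fun {x} hx => by
      filter_upwards [isOpen_Ioi.mem_nhds hx] with s hs using hF s hs
    have hGe : ∀ {x}, 0 < x → G =ᶠ[𝓝 x] v := fun {x} hx => by
      filter_upwards [isOpen_Ioi.mem_nhds hx] with s hs using hG s hs
    have hFe' : ∀ {x}, x < μ.gap → F =ᶠ[𝓝 x] wave k 1 m := fun {x} hx => by
      filter_upwards [isOpen_Iio.mem_nhds hx] with s hs using hF' s hs
    have hGe' : ∀ {x}, x < μ.gap → G =ᶠ[𝓝 x] waveDeriv k 1 m := fun {x} hx => by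
      filter_upwards [isOpen_Iio.mem_nhds hx] with s hs using hG' s hs
    refine ⟨F, G, fun x hx => ?_, fun x hx => ?_, fun n => ?_, ?_, 0,
      μ.notMem_range_of_lt_gap hg, ?_⟩
    · rcases lt_or_ge x μ.gap with h0 | h0
      · rw [hG' x h0]
        exact (hasDerivAt_wave hk0 1 m x).congr_of_eventuallyEq (hFe' h0)
      · have hx0 := hg.trans_le h0
        rw [hG x hx0]
        exact (h.hasDerivAt x ⟨hx0, hx⟩).congr_of_eventuallyEq (hFe hx0)
    · rcases lt_or_ge x μ.gap with h0 | h0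
      · rw [hF' x h0]
        exact (hasDerivAt_waveDeriv hk0 1 m x).congr_of_eventuallyEq (hGe' h0)
      · have hx0 := hg.trans_le h0
        rw [hF x hx0]
        exact (hd x ⟨hx0, hx⟩).congr_of_eventuallyEq (hGe hx0)
    · obtain ⟨uL, uR, huL, huR⟩ := h.isH1.exists_traces
      obtain ⟨vL, vR, hvL, hvR⟩ := h.isH1'.exists_traces
      have h1 := (jumpCondition_iff (μ.one_lt_b n) (huL n) (huR n) (hvL n) (hvR n)).1 (hj n)
      have h2 := (hFe (μ.t_pos n)).symm
      have h3 := (hGe (μ.t_pos n)).symm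
      exact (jumpCondition_iff (μ.one_lt_b n)
        ((huL n).congr' (h2.filter_mono nhdsWithin_le_nhds))
        ((huR n).congr' (h2.filter_mono nhdsWithin_le_nhds))
        ((hvL n).congr' (h3.filter_mono nhdsWithin_le_nhds))
        ((hvR n).congr' (h3.filter_mono nhdsWithin_le_nhds))).2 h1
    · refine h.memLp_u.ae_eq ?_
      filter_upwards [ae_restrict_mem measurableSet_Ioi] with s hs using (hF s hs).symm
    · rw [hF' 0 hg, wave_zero hk0]
      exact one_ne_zero
  · have h0 : (0 : ℝ) ∉ range μ.t := μ.notMem_range_of_lt_gap hg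
    have hf0 : Tendsto f (𝓝[>] 0) (𝓝 (f 0)) :=
      (hf.hasDerivAt 0 h0).continuousAt.tendsto.mono_left nhdsWithin_le_nhds
    have hf0' : Tendsto f' (𝓝[>] 0) (𝓝 (f' 0)) :=
      (hf.hasDerivAt' 0 h0).continuousAt.tendsto.mono_left nhdsWithin_le_nhds
    -- f - f(0)u satisfies the jump conditions and vanishes at 0, so it is an eigenfunction of A⁺
    -- for z or zero; the lower bound excludes the former.
    have hz := IsH2.eq_zero_of_jumpCondition (μ := μ) (u := f + (-f 0) • u)
      (v := f' + (-f 0) • v) hk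
      (by
        refine ((hf.isH2 hk).add (h.smul (-f 0))).congr_right (Eventually.of_forall fun s => ?_)
        simp only [Pi.add_apply, Pi.smul_apply, smul_eq_mul]
        ring)
      (by
        have := hf0.add (hu0.const_smul (-f 0))
        rw [smul_eq_mul, mul_one, add_neg_cancel] at this
        exact this)
      (fun n => (hf.jump n).add ((hj n).smul _))
    have hz1 : ∀ x ∈ Ioi 0 \ range μ.t, f x = f 0 * u x ∧ f' x = f 0 * v x := fun x hx => by
      obtain ⟨e1, e2⟩ := hz x hx
      simp only [Pi.add_apply, Pi.smul_apply, smul_eq_mul] at e1 e2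
      exact ⟨by linear_combination e1, by linear_combination e2⟩
    have hm : f' 0 = f 0 * m := by
      refine tendsto_nhds_unique hf0' ((hv0.const_mul (f 0)).congr' ?_)
      filter_upwards [Ioo_mem_nhdsGT hg] with x hx
      exact (hz1 x (μ.Ioo_zero_subset hx)).2.symm
    -- If f(0) = 0 then f'(0) = f(0)m = 0 as well, so f vanishes left of `gap` by uniqueness and on
    -- the half-line by proportionality to u.
    have hne : f 0 ≠ 0 := by
      intro e
      obtain ⟨x, hx, hfx⟩ := hf.nontrivial
      rcases lt_or_ge x μ.gap with hxg | hxg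
      · have hreg : ∀ s ∈ uIcc 0 x, s ∉ range μ.t := fun s hs =>
          μ.notMem_range_of_lt_gap (lt_of_le_of_lt hs.2 (max_lt hg hxg))
        have := (eq_wave hk0 (fun s hs => hf.hasDerivAt s (hreg s hs))
          (fun s hs => hf.hasDerivAt' s (hreg s hs))).1
        rw [hm, e] at this
        exact hfx (by simpa [wave] using this)
      · exact hfx (by rw [(hz1 x ⟨hg.trans_le hxg, hx⟩).1, e, zero_mul])
    exact ⟨hne, by rw [hm, mul_div_cancel_left₀ _ hne]⟩

end Weyl

/-! ### The series for the `m`-function -/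

section Series

variable {J : Type*} {μ : AtomicMeasure J} {z : ℂ} {k : ℂ} {ξ : TraceSpace J}

lemma summable_exp_neg_mul (μ : AtomicMeasure J) {κ : ℝ} (hκ : 0 < κ) :
    Summable fun n => Real.exp (-κ * μ.t n) := by
  have hg := μ.gap_pos
  have hr : Real.exp (-(κ * μ.gap)) < 1 :=
    Real.exp_lt_one_iff.2 (by have := mul_pos hκ hg; linarith)
  have hinj : Function.Injective fun n => ⌊μ.t n / μ.gap⌋.toNat := by
    intro n m h
    have h0 : ∀ n, 0 ≤ ⌊μ.t n / μ.gap⌋ := fun n =>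
      Int.floor_nonneg.2 (div_nonneg (μ.t_pos n).le hg.le)
    refine μ.floor_injective ?_
    have := congrArg (fun i : ℕ => (i : ℤ)) h
    simpa only [Int.toNat_of_nonneg (h0 _)] using this
  refine Summable.of_nonneg_of_le (fun _ => (Real.exp_pos _).le) (fun n => ?_)
    ((summable_geometric_of_lt_one (Real.exp_pos _).le hr).comp_injective hinj)
  rw [Function.comp_apply, ← Real.exp_nat_mul, Real.exp_le_exp]
  have h1 : ((⌊μ.t n / μ.gap⌋.toNat : ℕ) : ℝ) ≤ μ.t n / μ.gap := by
    rw [Int.floor_toNat]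
    exact Nat.floor_le (div_nonneg (μ.t_pos n).le hg.le)
  rw [le_div_iff₀ hg] at h1
  nlinarith

lemma exists_exp_trace (μ : AtomicMeasure J) (hk : 0 < k.im) :
    ∃ ξ : TraceSpace J, ∀ n, ξ n = !₂[Complex.exp (Complex.I * k * μ.t n),
      Complex.I * k * Complex.exp (Complex.I * k * μ.t n)] := by
  have h := (isH2_exp hk).mono (empty_subset (range μ.t))
  have ht := fun n => IsH2.tendsto (μ := μ) ⟨_, isH2_exp hk⟩ n
  exact ⟨traceOf _ _ (h.isH1.summable_norm_sq_right fun n => (ht n).1.2)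
    (h.isH1'.summable_norm_sq_right fun n => (ht n).2.2), fun n => rfl⟩

/-- The normalized Weyl solution on the half-line. -/
lemma exists_halfLine_solution (hk : 0 < (momentum z).im)
    (hξ : ∀ n, ξ n = !₂[Complex.exp (Complex.I * momentum z * μ.t n),
      Complex.I * momentum z * Complex.exp (Complex.I * momentum z * μ.t n)])
    {x : TraceSpace J} (hx : (x, ξ) ∈ (μ.T z + μ.B).graph) :
    ∃ m, μ.IsMPlus z 0 m ∧
      HasSum (fun n => ξ n 0 * x n 0 + ξ n 1 * x n 1) (m - Complex.I * momentum z) := by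
  obtain ⟨a, u, v, h⟩ := exists_jumpSolution μ hk x
  have hrel := (h.mem_graph_T_add_B_iff hk).1 hx
  obtain ⟨v0, hv0⟩ := h.isH2.isH1'.exists_tendsto_zero
  have he := (isH2_exp hk).mono (empty_subset (range μ.t))
  have ht := fun n => IsH2.tendsto (μ := μ) ⟨_, isH2_exp hk⟩ n
  have hexp : Tendsto (fun s : ℝ => Complex.exp (Complex.I * momentum z * s)) (𝓝[>] 0) (𝓝 1) := by
    have : Tendsto (fun s : ℝ => Complex.exp (Complex.I * momentum z * s)) (𝓝 0)
        (𝓝 (Complex.exp (Complex.I * momentum z * (0 : ℝ)))) := Continuous.tendsto (by fun_prop) 0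
    rw [Complex.ofReal_zero, mul_zero, Complex.exp_zero] at this
    exact this.mono_left nhdsWithin_le_nhds
  have hexp' := hexp.const_mul (Complex.I * momentum z)
  refine ⟨Complex.I * momentum z * 1 + v0, ?_, ?_⟩
  · have key := IsH2.isMPlus (μ := μ) hk (he.add h.isH2 |>.congr_right
      (Eventually.of_forall fun s => by simp only [Pi.add_apply]; ring))
      (by have := hexp.add h.zero; rw [add_zero] at this; exact this) (hexp'.add hv0) fun n => by
        refine (jumpCondition_iff (μ.one_lt_b n) ((ht n).1.1.add (h.u_left n))
          ((ht n).1.2.add (h.u_right n)) ((ht n).2.1.add (h.v_left n))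
          ((ht n).2.2.add (h.v_right n))).2 ?_
        obtain ⟨e1, e2⟩ := hrel n
        rw [hξ n] at e1 e2
        simp only [Matrix.cons_val_zero, Matrix.cons_val_one] at e1 e2
        constructor
        · linear_combination 2 * e1
        · linear_combination 2 * e2
    rwa [momentum_sq] at key
  -- The Wronskian of u and e^{iks} at 0 is -u'(0), since u(0) = 0. The exponential is continuous,
  -- so its trace ξ meets only the jumps x of u.
  · have h1 := h.isH2.hasSum_wronskian he h.zero hv0 hexp hexp' h.u_left h.u_right h.v_left
      h.v_right (fun n => (ht n).1.1) (fun n => (ht n).1.2) (fun n => (ht n).2.1)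
      (fun n => (ht n).2.2)
    convert! h1 using 1
    · ext n
      rw [hξ n]
      simp only [Matrix.cons_val_zero, Matrix.cons_val_one]
      ring
    · have e : ∀ s : ℝ, u s * (-momentum z ^ 2 * Complex.exp (Complex.I * momentum z * s)) -
          -momentum z ^ 2 * u s * Complex.exp (Complex.I * momentum z * s) = 0 := fun s => by ring
      simp_rw [e]
      simp

open Classical in
lemma blockEntry_mulVec (K : TraceSpace J →L[ℂ] TraceSpace J) (n m : J)
    (w : EuclideanSpace ℂ (Fin 2)) (i : Fin 2) :
    K (lp.single (E := fun _ : J => EuclideanSpace ℂ (Fin 2)) 2 m w) n i =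
      blockEntry K n m i 0 * w 0 + blockEntry K n m i 1 * w 1 := by
  have hw : w = w 0 • EuclideanSpace.single 0 1 + w 1 • EuclideanSpace.single 1 1 := by
    ext i
    fin_cases i <;> simp
  have hs : lp.single (E := fun _ : J => EuclideanSpace ℂ (Fin 2)) 2 m w =
      w 0 • lp.single (E := fun _ : J => EuclideanSpace ℂ (Fin 2)) 2 m (EuclideanSpace.single 0 1) +
      w 1 • lp.single (E := fun _ : J => EuclideanSpace ℂ (Fin 2)) 2 m
        (EuclideanSpace.single 1 1) := by
    rw [← lp.single_smul, ← lp.single_smul, ← lp.single_add, ← hw]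
  rw [hs, map_add, map_smul, map_smul]
  simp only [blockEntry, Matrix.of_apply]
  rw [mul_comm _ (w 0), mul_comm _ (w 1)]
  rfl

lemma norm_mul_add_mul_le (x y : EuclideanSpace ℂ (Fin 2)) :
    ‖x 0 * y 0 + x 1 * y 1‖ ≤ 2 * (‖x‖ * ‖y‖) := by
  have h : ∀ i, ‖x i * y i‖ ≤ ‖x‖ * ‖y‖ := fun i => by
    rw [norm_mul]
    exact mul_le_mul (PiLp.norm_apply_le x i) (PiLp.norm_apply_le y i) (norm_nonneg _)
      (norm_nonneg _)
  exact (norm_add_le _ _).trans (by linarith [h 0, h 1])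

open Classical in
/-- A quadratic form with absolutely summable coefficients as a double series. -/
lemma hasSum_double (K : TraceSpace J →L[ℂ] TraceSpace J) (hs : Summable fun n => ‖ξ n‖) {s : ℂ}
    (h : HasSum (fun n => ξ n 0 * K ξ n 0 + ξ n 1 * K ξ n 1) s) :
    HasSum (fun p : J × J => ξ p.1 0 *
      K (lp.single (E := fun _ : J => EuclideanSpace ℂ (Fin 2)) 2 p.2 (ξ p.2)) p.1 0 + ξ p.1 1 *
      K (lp.single (E := fun _ : J => EuclideanSpace ℂ (Fin 2)) 2 p.2 (ξ p.2)) p.1 1) s := by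
  have hsum : Summable (fun p : J × J => ξ p.1 0 *
      K (lp.single (E := fun _ : J => EuclideanSpace ℂ (Fin 2)) 2 p.2 (ξ p.2)) p.1 0 + ξ p.1 1 *
      K (lp.single (E := fun _ : J => EuclideanSpace ℂ (Fin 2)) 2 p.2 (ξ p.2)) p.1 1) := by
    refine Summable.of_norm_bounded ((hs.mul_of_nonneg hs (fun _ => norm_nonneg _)
      fun _ => norm_nonneg _).mul_left (2 * ‖K‖)) fun p => ?_
    refine (norm_mul_add_mul_le _ _).trans ?_
    have h1 := lp.norm_apply_le_norm (two_ne_zero)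
      (K (lp.single (E := fun _ : J => EuclideanSpace ℂ (Fin 2)) 2 p.2 (ξ p.2))) p.1
    have h2 := K.le_opNorm (lp.single (E := fun _ : J => EuclideanSpace ℂ (Fin 2)) 2 p.2 (ξ p.2))
    rw [lp.norm_single (by norm_num)] at h2
    calc 2 * (‖ξ p.1‖ * _) ≤ 2 * (‖ξ p.1‖ * (‖K‖ * ‖ξ p.2‖)) := by
          gcongr; exact h1.trans h2
      _ = _ := by ring
  -- For fixed n, ξ is the norm-convergent sum of its single components and K is continuous;
  -- absolute summability over pairs then permits iterated summation.
  have hfib : ∀ n, HasSum (fun m => ξ n 0 *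
      K (lp.single (E := fun _ : J => EuclideanSpace ℂ (Fin 2)) 2 m (ξ m)) n 0 + ξ n 1 *
      K (lp.single (E := fun _ : J => EuclideanSpace ℂ (Fin 2)) 2 m (ξ m)) n 1)
      (ξ n 0 * K ξ n 0 + ξ n 1 * K ξ n 1) := by
    intro n
    have h1 := (lp.hasSum_single (p := 2) (by norm_num) ξ).mapL
      ((lp.evalCLM ℂ (fun _ : J => EuclideanSpace ℂ (Fin 2)) 2 n).comp K)
    have h2 := hasSum_euclidean_iff.1 h1
    exact ((h2 0).mul_left (ξ n 0)).add ((h2 1).mul_left (ξ n 1))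
  have := hsum.hasSum.prod_fiberwise hfib
  rw [← this.unique h]
  exact hsum.hasSum

end Series

end PointInteraction

/-! ### The main theorem -/

open PointInteraction
theorem mainTheorem7 {J : Type*} (μ : AtomicMeasure J) (z : ℂ)
    (hz : ¬ (0 ≤ z.re ∧ z.im = 0)) :
    μ.trace.domain = dirichletLaplacian.domain ∧
    (μ.T z).domain = ⊤ ∧
    ∃ (R₀ R₀' R : L2HalfLine →L[ℂ] L2HalfLine) (Γ Γ' : L2HalfLine →L[ℂ] TraceSpace J)
      (K : TraceSpace J →L[ℂ] TraceSpace J) (m : ℂ),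
      IsBoundedInverse (shift dirichletLaplacian z) R₀ ∧
      IsBoundedInverse (shift dirichletLaplacian (starRingEnd ℂ z)) R₀' ∧
      IsBoundedInverse (shift μ.laplacian z) R ∧
      IsComp μ.trace R₀ Γ ∧
      IsComp μ.trace R₀' Γ' ∧
      IsBoundedInverse (μ.T z + μ.B) K ∧
      R = R₀ + ContinuousLinearMap.adjoint Γ' ∘L K ∘L Γ ∧
      μ.IsMPlus z 0 m ∧
      HasSum (fun p : J × J =>
          Complex.exp (Complex.I * momentum z * (μ.t p.1 + μ.t p.2 : ℝ)) *
            (![1, Complex.I * momentum z] ⬝ᵥ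
              (Matrix.mulVec (blockEntry K p.1 p.2) ![1, Complex.I * momentum z])))
        (m - Complex.I * momentum z) := by
  have hk := momentum_im_pos hz
  have hk' : 0 < (momentum (starRingEnd ℂ z)).im := momentum_im_pos (by simpa using hz)
  have hkk := momentum_sq (starRingEnd ℂ z)
  have h0 := exists_isBoundedInverse_dirichlet hk
  have h0' := exists_isBoundedInverse_dirichlet hk'
  have hc : ∀ R, IsBoundedInverse (shift dirichletLaplacian z) R →
      ∃ Γ : L2HalfLine →L[ℂ] TraceSpace J, IsComp μ.trace R Γ := by
    have := fun R => exists_isComp_trace μ hk (R := R)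
    rwa [momentum_sq] at this
  have hc' : ∀ R, IsBoundedInverse (shift dirichletLaplacian (starRingEnd ℂ z)) R →
      ∃ Γ : L2HalfLine →L[ℂ] TraceSpace J, IsComp μ.trace R Γ := by
    have := fun R => exists_isComp_trace μ hk' (R := R)
    rwa [hkk] at this
  rw [momentum_sq] at h0 h0'
  obtain ⟨R₀, hR₀⟩ := h0
  obtain ⟨R₀', hR₀'⟩ := h0'
  obtain ⟨Γ, hΓ⟩ := hc R₀ hR₀
  obtain ⟨Γ', hΓ'⟩ := hc' R₀' hR₀'
  obtain ⟨K, hK⟩ := exists_isBoundedInverse_T_add_B μ hk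
  obtain ⟨ξ, hξ⟩ := exists_exp_trace μ hk
  have hx : (K ξ, ξ) ∈ (μ.T z + μ.B).graph := by
    obtain ⟨f, hf1, hf2⟩ := hK.2 ξ
    have := (μ.T z + μ.B).mem_graph f
    rwa [hf1, ← hf2] at this
  obtain ⟨m, hm, hsum⟩ := exists_halfLine_solution hk hξ hx
  -- ξ_n is e^{ik t_n} times the fixed vector (1, ik), so ξ lies in ℓ¹ as well as ℓ².
  have hs : Summable fun n => ‖ξ n‖ := by
    refine Summable.of_nonneg_of_le (fun _ => norm_nonneg _) (fun n => ?_)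
      ((summable_exp_neg_mul μ hk).mul_left ‖!₂[(1 : ℂ), Complex.I * momentum z]‖)
    have e : ξ n = Complex.exp (Complex.I * momentum z * μ.t n) •
        !₂[(1 : ℂ), Complex.I * momentum z] := by
      rw [hξ]
      ext i
      fin_cases i <;> simp
      ring
    rw [e, norm_smul, norm_exp_I_mul, mul_comm]
  refine ⟨trace_domain_eq μ, T_domain_eq_top μ hk, R₀, R₀', _, Γ, Γ', K, m, hR₀, hR₀',
    isBoundedInverse_krein hk hk' hkk hR₀ hR₀' hΓ hΓ' hK, hΓ, hΓ', hK, rfl, hm, ?_⟩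
  refine (hasSum_double K hs hsum).congr_fun fun p => ?_
  rw [blockEntry_mulVec, blockEntry_mulVec, hξ, hξ, Complex.ofReal_add, mul_add, Complex.exp_add]
  simp only [Matrix.cons_val_zero, Matrix.cons_val_one, dotProduct, Matrix.mulVec,
    Fin.sum_univ_two]
  ring
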